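/- **Setting.** Let $\mathcal S,\mathcal A$ be measurable spaces (the diagonal of $\mathcal A$ being measurable) and consider a linear MDP of horizon $H\ge1$ with features $\phi_h(s,a)\in\mathbb R^d$ ($d\ge 1$), $\|\phi_h(s,a)\|_2\le1$, rewards $r_h(s,a)=\langle\phi_h(s,a),\theta_h\rangle\in[0,1]$, transitions $P_h(\cdot\mid s,a)=\sum_i\phi_{h,i}(s,a)\,m_{h,i}(\cdot)$ with signed measures $m_{h,i}$, and initial law $\rho$. Let $\pi^\dagger$ be a deterministic target policy, $\phi_h^\dagger(s)=\phi_h(s,\pi^\dagger_h(s))$, and let $\mathcal C_h$ be measurable sets with $\rho(\mathcal C_1)=1$ and $P_h(\mathcal C_{h+1}\mid s,a)=1$ for all $h<H$, $s\in\mathcal C_h$, $a\in\mathcal A$. For $T$ episodes a learner chooses, before each episode $t$, a (possibly stochastic) Markov policy $\pi_t$ from the past states, actions and fed rewards, and the attacker may replace each observed reward $r_h(s_h^t,a_h^t)$ by $\hat r_h^t$. Fix a budget parameter $S>0$, a ridge parameter $\lambda>0$, $1\le T_1\le T$, $\delta\in(0,1)$, a threshold $\eta_1$, and deterministic radii $\beta_{h,t}$,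 $\alpha_h$. Write $\|x\|_{G^{-1}}=\sqrt{x^\top G^{-1}x}$ and $L=1+\log(dHT/\delta)$; $Q^{\pi,r},V^{\pi,r}$ are the value functions of $\pi$ under the reward $r$. *Stage 1* ($t\le T_1$). Let $w_h$ maximize $\min_{s\in\mathcal C_h}\bigl(\langle\phi_h^\dagger(s),w\rangle-\max_{a\ne\pi_h^\dagger(s)}\langle\phi_h(s,a),w\rangle\bigr)$ over $\|w\|_2\le\frac1{2S}$, and let $\epsilon_1^\star$ be the minimum over $h$ of the maximal values; put $q_h=Sw_h$, $q_{H+1}=0$, $v_h(s)=\langle\phi_h^\dagger(s),q_h\rangle$. Let $\hat b_{h,t}=\Lambda_{h,t}^{-1}\sum_{k<t}\phi_h(s_h^k,a_h^k)v_{h+1}(s_{h+1}^k)$ with $\Lambda_{h,t}=\lambda I+\sum_{k<t}\phi_h(s_h^k,a_h^k)\phi_h(s_h^k,a_h^k)^\top$, let $\overline U_{h,t}=\sup_{s\in\mathcal C_h,\,a}\beta_{h,t}\|\phi_h(s,a)\|_{\Lambda_{h,t}^{-1}}$ and $\underline\Gamma_t=\min_h\bigl(S\epsilon_1^\star-2\sum_{j=h}^{H-1}\overline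 U_{j,t}\bigr)$. Stage 1 *certifies* if $\tau:=\min\{t\le T_1:\underline\Gamma_t\ge\eta_1\}$ exists. The fed reward is $\langle\phi_h(s,a),q_h-\hat b_{h,\min(t,\tau)}\rangle$ (with $\hat b_{h,t}$ if there is no certification up to $t$). Let $\mathcal T$ be the set of clean episodes: those $t\in[\tau,T_1]$ in which no action $a_h^t\ne\pi_h^\dagger(s_h^t)$ is taken at any $s_h^t\in\mathcal C_h$. Let $S_0$ be the number of pairs $(t,h)$, $t\le T_1$, with $s_h^t\in\mathcal C_h$ and $a_h^t\neq\pi_h^\dagger(s_h^t)$. *Stage 2* ($T_1<t\le T$). Let $\Gamma_h=\lambda I+\sum_{t\in\mathcal T}\phi_h^\dagger(s_h^t)\phi_h^\dagger(s_h^t)^\top$, $\hat w_h=\Gamma_h^{-1}\sum_{t\in\mathcal T}\phi_h^\dagger(s_h^t)\sum_{j\ge h}r_j(s_j^t,\pi_j^\dagger(s_j^t))$, $\hat Q_h=\langle\phi_h,\hat w_h\rangle$, $\gamma_{\rm tar}=\max_h\sup_{s\in\mathcal C_h}|\hat Q_h(s,\pi_h^\dagger(s))-Q_h^{\pi^\dagger,r}(s,\pi_h^\dagger(s))|$,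 and $g_h(s,a)=[\hat Q_h(s,a)-\hat Q_h(s,\pi_h^\dagger(s))]_++\alpha_h\bigl(\|\phi_h(s,a)\|_{\Gamma_h^{-1}}+\|\phi_h^\dagger(s)\|_{\Gamma_h^{-1}}\bigr)$. Let $\epsilon_2^\star$ be the maximum, and $\{u_h\}$ a maximizer, of $\epsilon$ subject to, for all $h$ and $s\in\mathcal C_h$: $\langle\phi_h(s,a),u_h\rangle\ge g_h(s,a)+\epsilon$ for all $a\ne\pi_h^\dagger(s)$; $\langle\phi_h^\dagger(s),u_h\rangle=0$; $\|u_h\|_2\le\sqrt d$. Let $\bar r_h(s,a)=r_h(s,a)$ if $a=\pi^\dagger_h(s)$ and $\bar r_h(s,a)=[r_h(s,a)-\langle\phi_h(s,a),u_h\rangle]_{[0,1]}$ otherwise. If Stage 1 certifies and $\epsilon_2^\star>0$, the fed reward is $r_h+c_h^t$ on target actions, for a predictable compensation $c_h^t$, and $\bar r_h$ on non-target actions; otherwise the clean reward is fed. Put $R=\sum_{t=T_1+1}^T\bigl(V_1^{\pi^\dagger,\bar r}(s_1^t)-V_1^{\pi_t,\bar r}(s_1^t)\bigr)$ and $\mathrm{Cost}(T,T_1)=\sum_{t\le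 T}\sum_{h\le H}|r_h(s_h^t,a_h^t)-\hat r_h^t|$. *Success.* Fix constants $\kappa,c_{\rm exc},c,C_{\rm wr},b>0$ and $p\in\mathbb N$. Let $\mathcal G$ be the event that Stage 1 certifies; $|\mathcal T|\ge T_1-\kappa L^p\sqrt{T_1}$; the clean design is exciting, $c_{\rm exc}|\mathcal T|\,\|\phi^\dagger_h(s)\|^2_{\Gamma_h^{-1}}\le1$ for all $h$, $s\in\mathcal C_h$; $\epsilon_2^\star\ge c/S$; all fed rewards lie in $[0,1]$, and so do the penalized rewards $r_h(s,a)-\langle\phi_h(s,a),u_h\rangle$ for $s\in\mathcal C_h$, $a\ne\pi_h^\dagger(s)$; and $\sum_{t>T_1}\sum_h|c_h^t|\le HT_1$. **Theorem.** There are $K>0$, $k\in\mathbb N$ depending only on $(\kappa,p,c_{\rm exc},c,C_{\rm wr},b)$ such that for all $C_\alpha\in\mathbb R$, $r\in\mathbb N$ there are $C\in\mathbb R$, $l\in\mathbb N$, depending only on these constants and on $C_\alpha,r$, for which the following holds for every instance as above. Suppose that $\eta_1\ge c/S$; that $Q_h^{\pi^\dagger,r}=\langle\phi_h,w_h^\dagger\rangle$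 for vectors $w_h^\dagger$ with $\sqrt\lambda\|w_h^\dagger\|_2+KH\sqrt d\,L^k\le\alpha_h\le C_\alpha H\sqrt d\,L^r$ for all $h$; and that the learner (for instance UCRL-VTR) satisfies the warm-start regret interface: outside an event of probability at most $\delta$, $$\mathcal G\ \Longrightarrow\ R\le C_{\rm wr}\,dH^{3/2}\sqrt T\bigl(1+S_0+\gamma_{\rm tar}\sqrt T\bigr).$$ Then, with probability at least $1-4\delta$, if $\mathcal G$ occurs, $$\mathrm{Cost}(T,T_1)\le C L^l\Bigl(HT_1+d^{3/2}H^{5/2}S\bigl(\sqrt{T\,T_1}+T/\sqrt{T_1}\bigr)\Bigr),$$ and if moreover $\sqrt T/b\le T_1\le b\sqrt T$, then $$\mathrm{Cost}(T,T_1)\le C L^l\,d^{3/2}H^{5/2}S\,T^{3/4},$$ and in at least $T-CL^l\,d^{3/2}H^{5/2}S\,T^{3/4}$ of the $T$ episodes the learner stays in the certified support and plays $\pi^\dagger$ at every stage. -/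

import Mathlib

open MeasureTheory ProbabilityTheory
open scoped Matrix RealInnerProductSpace

noncomputable section

namespace BlackBox

/-- Feature space `ℝ^d` with its Euclidean norm. -/
abbrev Vec (d : ℕ) := EuclideanSpace ℝ (Fin d)

/-- A trajectory of the whole interaction: `x t h` is the state-action pair at stage `h` of
episode `t`. Episodes and stages are numbered from `0`; only stages `h < H` matter. -/
abbrev Traj (X A : Type*) := ℕ → ℕ → X × A

/-- A finite-horizon linear MDP with stages `0, …, H - 1`: the reward is `⟨φ_h(s,a), θ_h⟩ ∈ [0,1]`
and the transition law is `∑ i, φ_{h,i}(s,a) m_{h,i}` for signed measures `m_{h,i}`. -/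
structure LinearMDP (X A : Type*) [MeasurableSpace X] [MeasurableSpace A] (d H : ℕ) where
  φ : ℕ → X → A → Vec d
  measurable_φ : ∀ h < H, Measurable fun p : X × A => φ h p.1 p.2
  norm_φ_le : ∀ h < H, ∀ s a, ‖φ h s a‖ ≤ 1
  θ : ℕ → Vec d
  reward_mem : ∀ h < H, ∀ s a, ⟪φ h s a, θ h⟫ ∈ Set.Icc (0 : ℝ) 1
  P : ℕ → Kernel (X × A) X
  markov_P : ∀ h, IsMarkovKernel (P h)
  m : ℕ → Fin d → SignedMeasure X
  P_eq : ∀ h < H, ∀ s a, ∀ B : Set X, MeasurableSet B →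
    (P h (s, a)).real B = ∑ i, φ h s a i * m h i B
  ρ : Measure X
  prob_ρ : IsProbabilityMeasure ρ

/-- Value with `n` steps to go, started at stage `h` in state `s`, of the Markov policy `π`
under the reward `r`. -/
def value {X A : Type*} [MeasurableSpace X] [MeasurableSpace A]
    (P : ℕ → Kernel (X × A) X) (r : ℕ → X → A → ℝ) (π : ℕ → X → Measure A) :
    ℕ → ℕ → X → ℝ
  | 0, _, _ => 0
  | n + 1, h, s => ∫ a, (r h s a + ∫ s', value P r π n (h + 1) s' ∂(P h (s, a))) ∂(π h s)

namespace LinearMDP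

variable {X A : Type*} [MeasurableSpace X] [MeasurableSpace A] {d H : ℕ}

/-- The clean reward `r_h(s,a)`. -/
def reward (M : LinearMDP X A d H) (h : ℕ) (s : X) (a : A) : ℝ := ⟪M.φ h s a, M.θ h⟫

/-- `V_h^{π,r}(s)` for a (possibly stochastic) Markov policy `π` and a reward `r`. -/
def V (M : LinearMDP X A d H) (r : ℕ → X → A → ℝ) (π : ℕ → X → Measure A) (h : ℕ) (s : X) : ℝ :=
  value M.P r π (H - h) h s

/-- `Q_h^{π,r}(s,a)`. -/
def Q (M : LinearMDP X A d H) (r : ℕ → X → A → ℝ) (π : ℕ → X → Measure A)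
    (h : ℕ) (s : X) (a : A) : ℝ :=
  r h s a + ∫ s', M.V r π (h + 1) s' ∂(M.P h (s, a))

end LinearMDP

/-! Ridge regression -/

/-- `lam • I + ∑ k ∈ I, f k (f k)ᵀ`. -/
def gram {d : ℕ} (lam : ℝ) (I : Finset ℕ) (f : ℕ → Vec d) : Matrix (Fin d) (Fin d) ℝ :=
  lam • (1 : Matrix (Fin d) (Fin d) ℝ) + ∑ k ∈ I, Matrix.vecMulVec (f k).ofLp (f k).ofLp

/-- The ridge estimate with regressors `f k` and targets `y k`, `k ∈ I`. -/
def ridge {d : ℕ} (lam : ℝ) (I : Finset ℕ) (f : ℕ → Vec d) (y : ℕ → ℝ) : Vec d :=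
  WithLp.toLp 2 ((gram lam I f)⁻¹ *ᵥ ∑ k ∈ I, y k • (f k).ofLp)

/-- `‖v‖_{G⁻¹} = √(vᵀ G⁻¹ v)`. -/
def invNorm {d : ℕ} (G : Matrix (Fin d) (Fin d) ℝ) (v : Vec d) : ℝ :=
  √(v.ofLp ⬝ᵥ (G⁻¹ *ᵥ v.ofLp))

/-- The inputs and choices of the two-stage attack. -/
structure Attack (X A : Type*) (d : ℕ) where
  /-- target policy `π†_h` -/
  target : ℕ → X → A
  /-- certified support `C_h` -/
  supp : ℕ → Set X
  /-- budget parameter -/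
  S : ℝ
  /-- ridge regularization -/
  lam : ℝ
  /-- number of Stage 1 episodes -/
  T₁ : ℕ
  /-- certification threshold -/
  η₁ : ℝ
  /-- Stage 1 confidence radii `β_{h,t}` -/
  β : ℕ → ℕ → ℝ
  /-- Stage 2 confidence radii `α_h` -/
  α : ℕ → ℝ
  /-- optimizers of the relaxed Stage 1 program -/
  w₀ : ℕ → Vec d
  /-- Stage 2 penalty directions `u_h` (a function of the observed data) -/
  u : Traj X A → ℕ → Vec d
  /-- compensation `c_h^t` (a function of the observed data); `c x t h` -/
  c : Traj X A → ℕ → ℕ → ℝ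

namespace Attack

variable {X A : Type*} [MeasurableSpace X] [MeasurableSpace A] {d H : ℕ}

/-- `φ†_h(s) = φ_h(s, π†_h(s))`. -/
def phiT (𝒜 : Attack X A d) (M : LinearMDP X A d H) (h : ℕ) (s : X) : Vec d :=
  M.φ h s (𝒜.target h s)

/-- The target policy as a Markov policy. -/
def targetPolicy (𝒜 : Attack X A d) (h : ℕ) (s : X) : Measure A := Measure.dirac (𝒜.target h s)

/-- A certified non-target action is taken at stage `h` of episode `t`. -/
def Deviates (𝒜 : Attack X A d) (x : Traj X A) (t h : ℕ) : Prop :=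
  (x t h).1 ∈ 𝒜.supp h ∧ (x t h).2 ≠ 𝒜.target h (x t h).1

/-! Stage 1 -/

/-- `min_{s ∈ C_h} (⟨φ†_h(s), w⟩ - max_{a ≠ π†(s)} ⟨φ_h(s,a), w⟩)`. -/
def margin (𝒜 : Attack X A d) (M : LinearMDP X A d H) (h : ℕ) (w : Vec d) : ℝ :=
  ⨅ p : {p : X × A // p.1 ∈ 𝒜.supp h ∧ p.2 ≠ 𝒜.target h p.1},
    ⟪𝒜.phiT M h p.1.1 - M.φ h p.1.1 p.1.2, w⟫

/-- `w₀` solves the relaxed Stage 1 program. -/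
def IsStage1Optimal (𝒜 : Attack X A d) (M : LinearMDP X A d H) : Prop :=
  ∀ h < H, ‖𝒜.w₀ h‖ ≤ 1 / (2 * 𝒜.S) ∧
    ∀ w : Vec d, ‖w‖ ≤ 1 / (2 * 𝒜.S) → 𝒜.margin M h w ≤ 𝒜.margin M h (𝒜.w₀ h)

/-- The optimal value of the relaxed Stage 1 program (minimum over the stages). -/
def eps1 (𝒜 : Attack X A d) (M : LinearMDP X A d H) : ℝ := ⨅ h : Fin H, 𝒜.margin M h (𝒜.w₀ h)

/-- `q_h = S w_{0,h}` for a stage `h`, and `0` after the last stage. -/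
def q (𝒜 : Attack X A d) (H h : ℕ) : Vec d := if h < H then 𝒜.S • 𝒜.w₀ h else 0

/-- Surrogate values `v_h(s) = ⟨φ†_h(s), q_h⟩`. -/
def v (𝒜 : Attack X A d) (M : LinearMDP X A d H) (h : ℕ) (s : X) : ℝ :=
  ⟪𝒜.phiT M h s, 𝒜.q H h⟫

/-- Stage 1 design matrix at the start of episode `t`. -/
def design1 (𝒜 : Attack X A d) (M : LinearMDP X A d H) (x : Traj X A) (h t : ℕ) :
    Matrix (Fin d) (Fin d) ℝ :=
  gram 𝒜.lam (Finset.range t) (fun k => M.φ h (x k h).1 (x k h).2)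

/-- Estimate of the continuation coefficient at the start of episode `t`. -/
def bhat (𝒜 : Attack X A d) (M : LinearMDP X A d H) (x : Traj X A) (h t : ℕ) : Vec d :=
  ridge 𝒜.lam (Finset.range t) (fun k => M.φ h (x k h).1 (x k h).2)
    (fun k => 𝒜.v M (h + 1) (x k (h + 1)).1)

/-- Uniform Stage 1 bonus over the certified domain. -/
def Ubar (𝒜 : Attack X A d) (M : LinearMDP X A d H) (x : Traj X A) (h t : ℕ) : ℝ :=
  ⨆ p : {p : X × A // p.1 ∈ 𝒜.supp h},
    𝒜.β h t * invNorm (𝒜.design1 M x h t) (M.φ h p.1.1 p.1.2)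

/-- Lower-confidence Stage 1 margin at episode `t`. The last stage has no continuation term, so
the sum runs over `h ≤ j < H - 1`. -/
def gamma1 (𝒜 : Attack X A d) (M : LinearMDP X A d H) (x : Traj X A) (t : ℕ) : ℝ :=
  ⨅ h : Fin H, (𝒜.S * 𝒜.eps1 M - 2 * ∑ j ∈ Finset.Ico (h : ℕ) (H - 1), 𝒜.Ubar M x j t)

/-- Stage 1 certifies within the first `T₁` episodes. -/
def Certified (𝒜 : Attack X A d) (M : LinearMDP X A d H) (x : Traj X A) : Prop :=
  ∃ t < 𝒜.T₁, 𝒜.η₁ ≤ 𝒜.gamma1 M x t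

/-- The certification (freezing) time; meaningful when `Certified` holds. -/
def tauFix (𝒜 : Attack X A d) (M : LinearMDP X A d H) (x : Traj X A) : ℕ :=
  sInf {t | t < 𝒜.T₁ ∧ 𝒜.η₁ ≤ 𝒜.gamma1 M x t}

/-- The episode whose estimate is used at episode `t < T₁`: the certification time if it is
before `t`, and `t` itself otherwise. -/
def freeze (𝒜 : Attack X A d) (M : LinearMDP X A d H) (x : Traj X A) (t : ℕ) : ℕ :=
  sInf {k | k = t ∨ (k < t ∧ 𝒜.η₁ ≤ 𝒜.gamma1 M x k)}

/-- The Stage 1 steering reward of episode `t` (provisional, then frozen). -/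
def steer (𝒜 : Attack X A d) (M : LinearMDP X A d H) (x : Traj X A) (t h : ℕ) (s : X) (a : A) : ℝ :=
  ⟪M.φ h s a, 𝒜.q H h - 𝒜.bhat M x h (𝒜.freeze M x t)⟫

open Classical in
/-- The clean Stage 1 episodes: after certification and without certified deviation. -/
def clean (𝒜 : Attack X A d) (M : LinearMDP X A d H) (x : Traj X A) : Finset ℕ :=
  {t ∈ Finset.range 𝒜.T₁ | 𝒜.tauFix M x ≤ t ∧ ∀ h < H, ¬ 𝒜.Deviates x t h}

open Classical in
/-- Warm-start corruption mass `S₀`: number of certified non-target steps in Stage 1. -/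
def corruption (𝒜 : Attack X A d) (H : ℕ) (x : Traj X A) : ℝ :=
  ∑ t ∈ Finset.range 𝒜.T₁, ∑ h ∈ Finset.range H, if 𝒜.Deviates x t h then 1 else 0

/-! Stage 2 -/

/-- Stage 2 design matrix, built from the clean episodes. -/
def design2 (𝒜 : Attack X A d) (M : LinearMDP X A d H) (x : Traj X A) (h : ℕ) :
    Matrix (Fin d) (Fin d) ℝ :=
  gram 𝒜.lam (𝒜.clean M x) (fun t => 𝒜.phiT M h (x t h).1)

/-- Clean Monte Carlo return from stage `h` on. -/
def mcReturn (𝒜 : Attack X A d) (M : LinearMDP X A d H) (x : Traj X A) (h t : ℕ) : ℝ :=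
  ∑ j ∈ Finset.Ico h H, M.reward j (x t j).1 (𝒜.target j (x t j).1)

/-- Ridge estimate of the coefficient vector of `Q_h^{π†,r}`. -/
def what (𝒜 : Attack X A d) (M : LinearMDP X A d H) (x : Traj X A) (h : ℕ) : Vec d :=
  ridge 𝒜.lam (𝒜.clean M x) (fun t => 𝒜.phiT M h (x t h).1) (fun t => 𝒜.mcReturn M x h t)

/-- Plug-in estimate of `Q_h^{π†,r}`. -/
def Qhat (𝒜 : Attack X A d) (M : LinearMDP X A d H) (x : Traj X A) (h : ℕ) (s : X) (a : A) : ℝ :=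
  ⟪M.φ h s a, 𝒜.what M x h⟫

/-- Conservative comparison gap `g_h(s,a)`. -/
def g (𝒜 : Attack X A d) (M : LinearMDP X A d H) (x : Traj X A) (h : ℕ) (s : X) (a : A) : ℝ :=
  max (𝒜.Qhat M x h s a - 𝒜.Qhat M x h s (𝒜.target h s)) 0
    + 𝒜.α h * (invNorm (𝒜.design2 M x h) (M.φ h s a)
      + invNorm (𝒜.design2 M x h) (𝒜.phiT M h s))

/-- `(ε, u)` is feasible for the Stage 2 penalty program. -/
def Feasible (𝒜 : Attack X A d) (M : LinearMDP X A d H) (x : Traj X A)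
    (ε : ℝ) (u : ℕ → Vec d) : Prop :=
  ∀ h < H,
    (∀ s ∈ 𝒜.supp h, ∀ a, a ≠ 𝒜.target h s → 𝒜.g M x h s a + ε ≤ ⟪M.φ h s a, u h⟫) ∧
    (∀ s ∈ 𝒜.supp h, ⟪𝒜.phiT M h s, u h⟫ = 0) ∧
    ‖u h‖ ≤ √(d : ℝ)

/-- The optimal value `ε₂⋆` of the Stage 2 penalty program. -/
def eps2 (𝒜 : Attack X A d) (M : LinearMDP X A d H) (x : Traj X A) : ℝ :=
  sSup {ε | ∃ u, 𝒜.Feasible M x ε u}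

open Classical in
/-- Stage 2 reference reward, clipped to `[0,1]`. -/
def rbar (𝒜 : Attack X A d) (M : LinearMDP X A d H) (x : Traj X A) (h : ℕ) (s : X) (a : A) : ℝ :=
  if a = 𝒜.target h s then M.reward h s a
  else max 0 (min 1 (M.reward h s a - ⟪M.φ h s a, 𝒜.u x h⟫))

open Classical in
/-- The reward fed to the learner at stage `h` of episode `t`. If one of the two certificates
fails, the attack stops and the clean reward is passed on in the remaining episodes. -/
def fed (𝒜 : Attack X A d) (M : LinearMDP X A d H) (x : Traj X A) (t h : ℕ) : ℝ :=
  if t < 𝒜.T₁ then 𝒜.steer M x t h (x t h).1 (x t h).2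
  else if 𝒜.Certified M x ∧ 0 < 𝒜.eps2 M x then
    if (x t h).2 = 𝒜.target h (x t h).1 then M.reward h (x t h).1 (x t h).2 + 𝒜.c x t h
    else 𝒜.rbar M x h (x t h).1 (x t h).2
  else M.reward h (x t h).1 (x t h).2

/-- Total attack cost over `T` episodes. -/
def cost (𝒜 : Attack X A d) (M : LinearMDP X A d H) (T : ℕ) (x : Traj X A) : ℝ :=
  ∑ t ∈ Finset.range T, ∑ h ∈ Finset.range H,
    |M.reward h (x t h).1 (x t h).2 - 𝒜.fed M x t h|

open Classical in
/-- Number of the first `T` episodes in which the learner stays in the certified support and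
plays the target action at every stage. -/
def followCount (𝒜 : Attack X A d) (H T : ℕ) (x : Traj X A) : ℕ :=
  ((Finset.range T).filter fun t =>
    ∀ h < H, (x t h).1 ∈ 𝒜.supp h ∧ (x t h).2 = 𝒜.target h (x t h).1).card

/-- Target-side mismatch `γ_tar`. -/
def gammaTar (𝒜 : Attack X A d) (M : LinearMDP X A d H) (x : Traj X A) : ℝ :=
  ⨆ h : Fin H, ⨆ s : 𝒜.supp h,
    |𝒜.Qhat M x h s (𝒜.target h s) - M.Q M.reward 𝒜.targetPolicy h s (𝒜.target h s)|

end Attack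

/-! The learner and the interaction -/

/-- A learner: before episode `t` it has seen, for every stage of every earlier episode, the
state, the action and the reward that it was fed; from this it forms the (possibly stochastic)
Markov policy `s ↦ L t h (data, s)`, `h < H`, that it plays in episode `t`. -/
abbrev Learner (X A : Type*) [MeasurableSpace X] [MeasurableSpace A] (H : ℕ) :=
  (t : ℕ) → ℕ → Kernel ((Fin t → Fin H → (X × A) × ℝ) × X) A

section interaction

variable {X A : Type*} [MeasurableSpace X] [MeasurableSpace A] {d H : ℕ}

/-- What the learner has observed before episode `t`. -/
def observed (𝒜 : Attack X A d) (M : LinearMDP X A d H) (x : Traj X A) (t : ℕ) :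
    Fin t → Fin H → (X × A) × ℝ :=
  fun k h => (x k h, 𝒜.fed M x k h)

/-- The learner's policy `π_t` in episode `t`. -/
def policy (L : Learner X A H) (𝒜 : Attack X A d) (M : LinearMDP X A d H) (x : Traj X A)
    (t h : ℕ) (s : X) : Measure A :=
  L t h (observed 𝒜 M x t, s)

/-- The σ-algebra of the state-action pairs of all earlier episodes and of the stages `j < h` of
episode `t`. -/
@[reducible] def history (X A : Type*) [MeasurableSpace X] [MeasurableSpace A] (H t h : ℕ) :
    MeasurableSpace (Traj X A) :=
  (⨆ k < t, ⨆ j < H, MeasurableSpace.comap (fun x : Traj X A => x k j) inferInstance) ⊔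
    ⨆ j < h, MeasurableSpace.comap (fun x : Traj X A => x t j) inferInstance

/-- `history` together with the state at stage `h` of episode `t`. -/
@[reducible] def historyState (X A : Type*) [MeasurableSpace X] [MeasurableSpace A] (H t h : ℕ) :
    MeasurableSpace (Traj X A) :=
  history X A H t h ⊔ MeasurableSpace.comap (fun x : Traj X A => (x t h).1) inferInstance

/-- `μ` is a law of the first `T` episodes of the interaction of the learner `L` with the MDP `M`
under the attack `𝒜`. -/
structure IsInteraction (M : LinearMDP X A d H) (𝒜 : Attack X A d) (L : Learner X A H) (T : ℕ)
    (μ : Measure (Traj X A)) : Prop where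
  init : ∀ t < T, ∀ B : Set X, MeasurableSet B →
    μ⟦{x | (x t 0).1 ∈ B} | history X A H t 0⟧ =ᵐ[μ] fun _ => M.ρ.real B
  act : ∀ t < T, ∀ h < H, ∀ B : Set A, MeasurableSet B →
    μ⟦{x | (x t h).2 ∈ B} | historyState X A H t h⟧ =ᵐ[μ]
      fun x => (policy L 𝒜 M x t h (x t h).1).real B
  step : ∀ t < T, ∀ h, h + 1 < H → ∀ B : Set X, MeasurableSet B →
    μ⟦{x | (x t (h + 1)).1 ∈ B} | history X A H t (h + 1)⟧ =ᵐ[μ]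
      fun x => (M.P h (x t h)).real B

/-- Stage 2 pseudo-regret of the learner's policies against the reference reward. -/
def regret2 (L : Learner X A H) (𝒜 : Attack X A d) (M : LinearMDP X A d H) (T : ℕ)
    (x : Traj X A) : ℝ :=
  ∑ t ∈ Finset.Ico 𝒜.T₁ T,
    (M.V (𝒜.rbar M x) 𝒜.targetPolicy 0 (x t 0).1
      - M.V (𝒜.rbar M x) (fun h => policy L 𝒜 M x t h) 0 (x t 0).1)

/-- The non-random part of the standing conditions on the attack. -/
structure Attack.IsValid (𝒜 : Attack X A d) (M : LinearMDP X A d H) : Prop where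
  S_pos : 0 < 𝒜.S
  lam_pos : 0 < 𝒜.lam
  T₁_pos : 1 ≤ 𝒜.T₁
  measurable_target : ∀ h < H, Measurable (𝒜.target h)
  measurable_supp : ∀ h < H, MeasurableSet (𝒜.supp h)
  /-- the initial state lies in the certified support -/
  init_supp : ∀ᵐ s ∂M.ρ, s ∈ 𝒜.supp 0
  /-- the certified support is closed under all actions -/
  closed_supp : ∀ h, h + 1 < H → ∀ s ∈ 𝒜.supp h, ∀ a, ∀ᵐ s' ∂(M.P h (s, a)), s' ∈ 𝒜.supp (h + 1)
  stage1_optimal : 𝒜.IsStage1Optimal M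
  /-- if the Stage 2 certificate succeeds, `u` is an optimizer of the Stage 2 program -/
  stage2_optimal : ∀ x, 0 < 𝒜.eps2 M x → 𝒜.Feasible M x (𝒜.eps2 M x) (𝒜.u x)
  /-- `u` depends on the Stage 1 data only -/
  u_stage1 : ∀ x y : Traj X A, (∀ t < 𝒜.T₁, ∀ h < H, x t h = y t h) → 𝒜.u x = 𝒜.u y
  /-- `c` is predictable: `c_h^t` depends only on what precedes the action at stage `h` of
  episode `t` -/
  c_predictable : ∀ (t h : ℕ) (x y : Traj X A), (∀ k < t, ∀ j < H, x k j = y k j) →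
    (∀ j < h, x t j = y t j) → (x t h).1 = (y t h).1 → 𝒜.c x t h = 𝒜.c y t h
  /-- the rewards fed to the learner are random variables -/
  measurable_fed : ∀ t, ∀ h < H, Measurable fun x => 𝒜.fed M x t h

end interaction

/-- The logarithmic factor `1 + log (d H T / δ)` hidden in `Õ`. -/
def logFactor (d H T : ℕ) (δ : ℝ) : ℝ := 1 + Real.log ((d : ℝ) * H * T / δ)

/-- The random part of the conditions along a trajectory: both stages succeed, the clean data
are exciting, and the attacked rewards and the compensation are admissible. -/
structure Succeeds {X A : Type*} [MeasurableSpace X] [MeasurableSpace A] {d H : ℕ}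
    (M : LinearMDP X A d H) (𝒜 : Attack X A d) (T : ℕ) (δ κ cexc c : ℝ) (p : ℕ)
    (x : Traj X A) : Prop where
  certified : 𝒜.Certified M x
  /-- the clean history has length `T₁ - Õ(√T₁)` -/
  clean_length :
    (𝒜.T₁ : ℝ) - κ * √(𝒜.T₁ : ℝ) * logFactor d H T δ ^ p ≤ ((𝒜.clean M x).card : ℝ)
  /-- on the certified target features the design is at least of the order of the number of
  clean episodes -/
  excitation : ∀ h < H, ∀ s ∈ 𝒜.supp h,
    cexc * (𝒜.clean M x).card * invNorm (𝒜.design2 M x h) (𝒜.phiT M h s) ^ 2 ≤ 1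
  eps2_ge : c / 𝒜.S ≤ 𝒜.eps2 M x
  fed_admissible : ∀ t < T, ∀ h < H, 𝒜.fed M x t h ∈ Set.Icc (0 : ℝ) 1
  /-- the penalized rewards are in `[0,1]` on the certified support without clipping -/
  penalty_admissible : ∀ h < H, ∀ s ∈ 𝒜.supp h, ∀ a, a ≠ 𝒜.target h s →
    M.reward h s a - ⟪M.φ h s a, 𝒜.u x h⟫ ∈ Set.Icc (0 : ℝ) 1
  /-- total compensation mass at most `H T₁` -/
  mass_le : ∑ t ∈ Finset.Ico 𝒜.T₁ T, ∑ h ∈ Finset.range H, |𝒜.c x t h| ≤ (H : ℝ) * 𝒜.T₁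

end BlackBox

end

/-!
Write `‖·‖_Γ` for the inverse norm of the Stage 2 design `Γ_h`. The cost consists of at most `H T₁` in
Stage 1, at most `H T₁` of compensation, and at most one unit per non-target action in Stage 2
(`cost_le`), so everything reduces to counting the non-target actions of Stage 2.

*Counting by regret.* Conditionally on the past, the expected number of non-target actions of an
episode is the value of the learner's policy under the reward `1{a ≠ π†}` (`integral_mul_devCount`);
a multiplicative Chernoff bound passes from these conditional means to the actual count
(`devCount_tail`). Under the reference reward every certified non-target action is worse than the
target action by at least `ε₂⋆ ≥ c / S`, provided that the plug-in estimate of `Q^{π†}` is accurate to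
within `α_h ‖φ_h(s,a)‖_Γ` at every feature (`rbar_add_le_targetValue`). A backward induction then
bounds the sum of the conditional means by `S / c` times the pseudo-regret
(`mul_sum_devValue_le_regret2`). This comparison is made separately for each trajectory, so no
measurability of the data-dependent penalty `u` is needed. The regret interface, with `S₀` bounded by
the number of discarded episodes and `γ_tar` by excitation, gives the rate (`sum_devCount_le`).

*The confidence bound.* The admissible radii involve the ridge parameter only through `√λ ‖w_h†‖`, so
the usual log-determinant bound for self-normalized martingales is not available, and the clean
episodes are selected by looking at future actions. Both difficulties are removed by a deterministic
matrix. Among the positive definite matrices dominated by `λ / T₁` plus the largest squared certified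
target feature, one of nearly maximal determinant bounds all these features by `5 d` in its squared
inverse norm, a form of the Kiefer–Wolfowitz theorem without compactness (`exists_design`). After
scaling by `T₁` it is, by excitation, at most a constant times the random design, so it suffices to
bound the noise in a fixed Euclidean norm in which each feature has size `√(5 d / T₁)`.

The noise of an episode is replaced by a stopped version, `residual`, which follows the episode until
the first non-target action. It is bounded by `H`, has conditional mean zero given the state at its
first stage (`integral_mul_residual`), and agrees with the Monte Carlo error on clean episodes. Its sum
over *all* Stage 1 episodes is a vector martingale, bounded by a dimension-free Azuma inequality
(`norm_sum_tail`, `exists_noise_design`); the discarded episodes number `Õ(√T₁)`, so removing them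
changes the sum by only `Õ(H √d)` (`invNorm_clean_noise_le`). If fewer than half of the Stage 1
episodes are clean, then `√T₁` is polylogarithmic and trivial bounds suffice.
-/

namespace BlackBox

/-! ### Conditional laws and exponential tail bounds -/

section concentration

variable {Ω : Type*} {m m0 : MeasurableSpace Ω} {μ : Measure Ω} [IsProbabilityMeasure μ]

/-- If the conditional law of `Y` given a σ-algebra `m` is `κ (g ω)` for an `m`-measurable `g`, then
the joint law of `(g, Y)` is the composition product of the law of `g` with `κ`. -/
theorem map_prod_eq_compProd {E F : Type*} [MeasurableSpace E] [MeasurableSpace F]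
    (hm : m ≤ m0) {g : Ω → E} (hg : Measurable[m] g) {Y : Ω → F}
    (hY : Measurable Y) (κ : Kernel E F) [IsMarkovKernel κ]
    (h : ∀ B : Set F, MeasurableSet B →
      μ⟦{ω | Y ω ∈ B} | m⟧ =ᵐ[μ] fun ω => (κ (g ω)).real B) :
    μ.map (fun ω => (g ω, Y ω)) = (μ.map g) ⊗ₘ κ := by
  have hg0 : Measurable g := hg.mono hm le_rfl
  have := Measure.isProbabilityMeasure_map (μ := μ) hg0.aemeasurable
  have := Measure.isProbabilityMeasure_map (μ := μ) (hg0.prodMk hY).aemeasurable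
  refine Measure.ext_prod fun {s t} hs ht => ?_
  rw [Measure.map_apply (hg0.prodMk hY) (hs.prod ht), Measure.compProd_apply_prod hs ht,
    setLIntegral_map hs (κ.measurable_coe ht) hg0]
  have hYt : MeasurableSet {ω | Y ω ∈ t} := hY ht
  have h1 := setIntegral_condExp hm (μ := μ) (f := Set.indicator {ω | Y ω ∈ t} fun _ => (1 : ℝ))
    ((integrable_const 1).indicator hYt) (hg hs)
  have h2 : ∫ ω in g ⁻¹' s, (κ (g ω)).real t ∂μ = μ.real (g ⁻¹' s ∩ {ω | Y ω ∈ t}) := by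
    rw [← setIntegral_congr_ae (hg0 hs) ((h t ht).mono fun ω hω _ => hω), h1,
      setIntegral_indicator hYt]
    simp
  have h3 : ∫⁻ ω in g ⁻¹' s, κ (g ω) t ∂μ
      = ENNReal.ofReal (∫ ω in g ⁻¹' s, (κ (g ω)).real t ∂μ) := by
    rw [ofReal_integral_eq_lintegral_ofReal]
    · simp
    · refine (integrable_const (1 : ℝ)).mono' ?_ (ae_of_all _ fun ω => ?_)
      · exact (((κ.measurable_coe ht).comp hg0).ennreal_toReal).aestronglyMeasurable
      · rw [Real.norm_of_nonneg measureReal_nonneg]; exact measureReal_le_one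
    · exact ae_of_all _ fun ω => measureReal_nonneg
  rw [h3, h2, ofReal_measureReal]
  rfl

/-- The tower rule for a bounded function of `g` and `Y`, where `κ (g ω)` is the conditional law of
`Y`. -/
theorem integral_of_condLaw {E F : Type*} [MeasurableSpace E] [MeasurableSpace F]
    (hm : m ≤ m0) {g : Ω → E} (hg : Measurable[m] g) {Y : Ω → F}
    (hY : Measurable Y) (κ : Kernel E F) [IsMarkovKernel κ]
    (h : ∀ B : Set F, MeasurableSet B →
      μ⟦{ω | Y ω ∈ B} | m⟧ =ᵐ[μ] fun ω => (κ (g ω)).real B)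
    {f : E × F → ℝ} (hf : Measurable f) (hfi : Integrable (fun ω => f (g ω, Y ω)) μ) :
    ∫ ω, f (g ω, Y ω) ∂μ = ∫ ω, ∫ y, f (g ω, y) ∂(κ (g ω)) ∂μ := by
  have hg0 : Measurable g := hg.mono hm le_rfl
  have := Measure.isProbabilityMeasure_map (μ := μ) hg0.aemeasurable
  have hfi' : Integrable f ((μ.map g) ⊗ₘ κ) := by
    rw [← map_prod_eq_compProd hm hg hY κ h]
    exact (integrable_map_measure hf.aestronglyMeasurable (hg0.prodMk hY).aemeasurable).2 hfi
  rw [← integral_map (hg0.prodMk hY).aemeasurable hf.aestronglyMeasurable,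
    map_prod_eq_compProd hm hg hY κ h, Measure.integral_compProd hfi',
    integral_map hg0.aemeasurable]
  exact (hf.stronglyMeasurable.integral_kernel_prod_right').aestronglyMeasurable

/-- The chord bound of the exponential on `[-b, b]`. -/
theorem exp_mul_le_cosh_add {b x : ℝ} (hb : 0 < b) (hx : |x| ≤ b) (θ : ℝ) :
    Real.exp (θ * x) ≤ Real.cosh (θ * b) + x * (Real.sinh (θ * b) / b) := by
  have hx' := abs_le.1 hx
  have h := convexOn_exp.2 (Set.mem_univ (θ * b)) (Set.mem_univ (-(θ * b)))
    (div_nonneg (by linarith) (by linarith) : 0 ≤ (b + x) / (2 * b))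
    (div_nonneg (by linarith) (by linarith) : 0 ≤ (b - x) / (2 * b))
    (by field_simp; ring)
  simp only [smul_eq_mul] at h
  have e1 : (b + x) / (2 * b) * (θ * b) + (b - x) / (2 * b) * -(θ * b) = θ * x := by
    field_simp; ring
  rw [e1] at h
  refine h.trans (le_of_eq ?_)
  rw [Real.cosh_eq, Real.sinh_eq]
  field_simp
  ring

theorem abs_sum_le_card_mul {D : ℕ → Ω → ℝ} {b : ℝ} {n : ℕ}
    (hDb : ∀ t < n, ∀ ω, |D t ω| ≤ b) (ω : Ω) : |∑ k ∈ Finset.range n, D k ω| ≤ n * b := by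
  refine (Finset.abs_sum_le_sum_abs _ _).trans ?_
  refine (Finset.sum_le_card_nsmul _ _ b fun k hk => hDb k (Finset.mem_range.1 hk) ω).trans ?_
  simp

/-- Azuma's inequality for increments `D t` bounded by `b` that are orthogonal to the exponentials
of the earlier partial sums. -/
theorem azuma {D : ℕ → Ω → ℝ} {b : ℝ} (hb : 0 < b) (n : ℕ) (hD : ∀ t < n, Measurable (D t))
    (hDb : ∀ t < n, ∀ ω, |D t ω| ≤ b)
    (h0 : ∀ t < n, ∀ θ : ℝ,
      ∫ ω, Real.exp (θ * ∑ k ∈ Finset.range t, D k ω) * D t ω ∂μ = 0)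
    {ℓ : ℝ} (hℓ : 0 ≤ ℓ) :
    μ {ω | b * √(2 * n * ℓ) < ∑ k ∈ Finset.range n, D k ω} ≤ ENNReal.ofReal (Real.exp (-ℓ)) := by
  have hmeas : ∀ t ≤ n, Measurable fun ω => ∑ k ∈ Finset.range t, D k ω := fun t ht =>
    Finset.measurable_sum _ fun k hk => hD k (by have := Finset.mem_range.1 hk; omega)
  have hint : ∀ t ≤ n, ∀ θ : ℝ,
      Integrable (fun ω => Real.exp (θ * ∑ k ∈ Finset.range t, D k ω)) μ := by
    intro t ht θ
    refine (integrable_const (Real.exp (|θ| * (t * b)))).mono'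
      (((hmeas t ht).const_mul θ).exp).aestronglyMeasurable (ae_of_all _ fun ω => ?_)
    rw [Real.norm_of_nonneg (Real.exp_pos _).le]
    refine Real.exp_le_exp.2 ((le_abs_self _).trans ?_)
    rw [abs_mul]
    exact mul_le_mul_of_nonneg_left
      (abs_sum_le_card_mul (fun k hk => hDb k (by omega)) ω) (abs_nonneg _)
  have hmgf : ∀ t ≤ n, ∀ θ : ℝ, ∫ ω, Real.exp (θ * ∑ k ∈ Finset.range t, D k ω) ∂μ
      ≤ Real.exp (t * (θ ^ 2 * b ^ 2 / 2)) := by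
    intro t
    induction t with
    | zero => intro _ θ; simp
    | succ t ih =>
      intro ht θ
      have hle : ∀ ω, Real.exp (θ * ∑ k ∈ Finset.range (t + 1), D k ω)
          ≤ Real.cosh (θ * b) * Real.exp (θ * ∑ k ∈ Finset.range t, D k ω)
            + (Real.sinh (θ * b) / b) *
              (Real.exp (θ * ∑ k ∈ Finset.range t, D k ω) * D t ω) := by
        intro ω
        rw [Finset.sum_range_succ, mul_add, Real.exp_add]
        have := mul_le_mul_of_nonneg_left
          (exp_mul_le_cosh_add hb (hDb t (by omega) ω) θ)
          (Real.exp_pos (θ * ∑ k ∈ Finset.range t, D k ω)).le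
        linarith
      have hi2 : Integrable
          (fun ω => Real.exp (θ * ∑ k ∈ Finset.range t, D k ω) * D t ω) μ :=
        (hint t (by omega) θ).mul_bdd (c := b) (hD t (by omega)).aestronglyMeasurable
          (ae_of_all _ fun ω => hDb t (by omega) ω)
      calc ∫ ω, Real.exp (θ * ∑ k ∈ Finset.range (t + 1), D k ω) ∂μ
          ≤ ∫ ω, (Real.cosh (θ * b) * Real.exp (θ * ∑ k ∈ Finset.range t, D k ω)
            + (Real.sinh (θ * b) / b) *
              (Real.exp (θ * ∑ k ∈ Finset.range t, D k ω) * D t ω)) ∂μ :=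
            integral_mono (hint _ ht θ)
              (((hint t (by omega) θ).const_mul _).add (hi2.const_mul _)) hle
        _ = Real.cosh (θ * b) * ∫ ω, Real.exp (θ * ∑ k ∈ Finset.range t, D k ω) ∂μ := by
            rw [integral_add ((hint t (by omega) θ).const_mul _) (hi2.const_mul _),
              integral_const_mul, integral_const_mul, h0 t (by omega) θ, mul_zero, add_zero]
        _ ≤ Real.exp ((θ * b) ^ 2 / 2) * Real.exp (t * (θ ^ 2 * b ^ 2 / 2)) :=
            mul_le_mul (Real.cosh_le_exp_half_sq _) (ih (by omega) θ)
              (integral_nonneg fun ω => (Real.exp_pos _).le) (Real.exp_pos _).le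
        _ = Real.exp (((t + 1 : ℕ) : ℝ) * (θ ^ 2 * b ^ 2 / 2)) := by
            rw [← Real.exp_add]; congr 1; push_cast; ring
  rcases Nat.eq_zero_or_pos n with rfl | hn
  · simp
  have hn' : (0 : ℝ) < n := by exact_mod_cast hn
  -- the minimizer of the Chernoff exponent `n θ² b² / 2 - θ b √(2 n ℓ)`
  set θ : ℝ := √(2 * n * ℓ) / (n * b) with hθ
  have hs : √(2 * n * ℓ) ^ 2 = 2 * n * ℓ := Real.sq_sqrt (by positivity)
  have hmark := mul_meas_ge_le_integral_of_nonneg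
    (ae_of_all μ fun ω => (Real.exp_pos (θ * ∑ k ∈ Finset.range n, D k ω)).le)
    (hint n le_rfl θ) (Real.exp (2 * ℓ))
  have hsub : {ω | b * √(2 * n * ℓ) < ∑ k ∈ Finset.range n, D k ω}
      ⊆ {ω | Real.exp (2 * ℓ) ≤ Real.exp (θ * ∑ k ∈ Finset.range n, D k ω)} := by
    intro ω hω
    have hθ0 : 0 ≤ θ := by positivity
    refine Real.exp_le_exp.2 ?_
    calc 2 * ℓ = θ * (b * √(2 * n * ℓ)) := by
          have h1 : θ * (b * √(2 * n * ℓ)) = √(2 * n * ℓ) ^ 2 / n := by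
            rw [hθ]; field_simp
          rw [h1, hs]; field_simp
      _ ≤ _ := mul_le_mul_of_nonneg_left (le_of_lt hω) hθ0
  refine (measure_mono hsub).trans ?_
  rw [← ofReal_measureReal]
  refine ENNReal.ofReal_le_ofReal ?_
  have h2 := hmark.trans (hmgf n le_rfl θ)
  have h3 : (n : ℝ) * (θ ^ 2 * b ^ 2 / 2) = ℓ := by
    rw [hθ, div_pow, hs]; field_simp
  rw [h3] at h2
  have h4 : Real.exp ℓ = Real.exp (2 * ℓ) * Real.exp (-ℓ) := by rw [← Real.exp_add]; congr 1; ring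
  rw [h4] at h2
  exact le_of_mul_le_mul_left h2 (Real.exp_pos _)

/-- One step of the smoothed norm `√(R² + ‖S‖²)`: by concavity of the square root it grows by at
most a linear term and a quadratic remainder. -/
theorem sqrt_sq_add_norm_add_le {E : Type*} [NormedAddCommGroup E] [InnerProductSpace ℝ E]
    {R b : ℝ} (hR : 0 < R) (s x : E) (hx : ‖x‖ ≤ b) :
    √(R ^ 2 + ‖s + x‖ ^ 2)
      ≤ √(R ^ 2 + ‖s‖ ^ 2) + ⟪(√(R ^ 2 + ‖s‖ ^ 2))⁻¹ • s, x⟫ + b ^ 2 / (2 * R) := by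
  set N := √(R ^ 2 + ‖s‖ ^ 2) with hN
  have hN2 : N ^ 2 = R ^ 2 + ‖s‖ ^ 2 := Real.sq_sqrt (by positivity)
  have hRN : R ≤ N := Real.le_sqrt_of_sq_le (by nlinarith [sq_nonneg ‖s‖])
  have hNp : 0 < N := hR.trans_le hRN
  have hb : ‖x‖ ^ 2 ≤ b ^ 2 := pow_le_pow_left₀ (norm_nonneg _) hx 2
  have h1 : √(R ^ 2 + ‖s + x‖ ^ 2) ≤ N + ⟪N⁻¹ • s, x⟫ + ‖x‖ ^ 2 / (2 * N) := by
    have e : R ^ 2 + ‖s + x‖ ^ 2 = N ^ 2 + 2 * ⟪s, x⟫ + ‖x‖ ^ 2 := by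
      rw [hN2, norm_add_sq_real]; ring
    have h2 : (√(R ^ 2 + ‖s + x‖ ^ 2)) ^ 2 = N ^ 2 + 2 * ⟪s, x⟫ + ‖x‖ ^ 2 := by
      rw [Real.sq_sqrt (by positivity), e]
    set y := √(R ^ 2 + ‖s + x‖ ^ 2)
    rw [real_inner_smul_left]
    have h3 : N + N⁻¹ * ⟪s, x⟫ + ‖x‖ ^ 2 / (2 * N) = (N ^ 2 + y ^ 2) / (2 * N) := by
      rw [h2]; field_simp; ring
    rw [h3, le_div_iff₀ (by positivity)]
    nlinarith [sq_nonneg (N - y)]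
  have h4 : ‖x‖ ^ 2 / (2 * N) ≤ b ^ 2 / (2 * R) :=
    div_le_div₀ (sq_nonneg _) hb (by positivity) (by linarith)
  linarith

/-- A dimension-free tail bound for a vector-valued martingale with increments bounded by `b`. -/
theorem norm_sum_tail {E : Type*} [NormedAddCommGroup E] [InnerProductSpace ℝ E]
    [MeasurableSpace E] [BorelSpace E] [SecondCountableTopology E]
    {X : ℕ → Ω → E} {b : ℝ} (hb : 0 < b) (n : ℕ) (ℱ : ℕ → MeasurableSpace Ω)
    (hX : ∀ t < n, Measurable (X t))
    (hXℱ : ∀ t < n, ∀ k < t, Measurable[ℱ t] (X k)) (hXb : ∀ t < n, ∀ ω, ‖X t ω‖ ≤ b)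
    (h0 : ∀ t < n, ∀ U : Ω → E, Measurable[ℱ t] U → (∃ C, ∀ ω, ‖U ω‖ ≤ C) →
      ∫ ω, ⟪U ω, X t ω⟫ ∂μ = 0) {ℓ : ℝ} (hℓ : 0 ≤ ℓ) :
    μ {ω | b * √n * (3 / 2) + b * √(2 * n * ℓ) < ‖∑ k ∈ Finset.range n, X k ω‖}
      ≤ ENNReal.ofReal (Real.exp (-ℓ)) := by
  rcases Nat.eq_zero_or_pos n with rfl | hn
  · simp
  have hn' : (0 : ℝ) < n := by exact_mod_cast hn
  set R : ℝ := b * √n with hRdef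
  have hR : 0 < R := by positivity
  set S : ℕ → Ω → E := fun t ω => ∑ k ∈ Finset.range t, X k ω with hS
  set N : E → ℝ := fun s => √(R ^ 2 + ‖s‖ ^ 2) with hN
  have hNR : ∀ s, R ≤ N s := fun s => Real.le_sqrt_of_sq_le (by nlinarith [sq_nonneg ‖s‖])
  have hNpos : ∀ s, 0 < N s := fun s => hR.trans_le (hNR s)
  have hNs : ∀ s, ‖s‖ ≤ N s := fun s => Real.le_sqrt_of_sq_le (by nlinarith [sq_nonneg R])
  set G : E → E := fun s => (N s)⁻¹ • s with hG
  have hGm : Measurable G := by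
    have : Measurable N := by fun_prop
    exact this.inv.smul measurable_id
  have hGb : ∀ s, ‖G s‖ ≤ 1 := by
    intro s
    rw [hG]
    simp only [norm_smul, norm_inv, Real.norm_of_nonneg (hNpos s).le]
    rw [inv_mul_le_iff₀ (hNpos s), mul_one]
    exact hNs s
  set D : ℕ → Ω → ℝ := fun t ω => ⟪G (S t ω), X t ω⟫ with hD
  have hSm : ∀ t ≤ n, Measurable (S t) := fun t ht =>
    Finset.measurable_sum _ fun k hk => hX k (by have := Finset.mem_range.1 hk; omega)
  have hSℱ : ∀ t < n, ∀ k ≤ t, Measurable[ℱ t] (S k) := fun t ht k hk =>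
    Finset.measurable_sum _ fun j hj => hXℱ t ht j (by have := Finset.mem_range.1 hj; omega)
  have hDm : ∀ t < n, Measurable (D t) := fun t ht =>
    (hGm.comp (hSm t ht.le)).inner (hX t ht)
  have hDb : ∀ t < n, ∀ ω, |D t ω| ≤ b := by
    intro t ht ω
    calc |D t ω| ≤ ‖G (S t ω)‖ * ‖X t ω‖ := abs_real_inner_le_norm _ _
      _ ≤ 1 * b := mul_le_mul (hGb _) (hXb t ht ω) (norm_nonneg _) zero_le_one
      _ = b := one_mul b
  have hDℱ : ∀ t < n, ∀ k < t, Measurable[ℱ t] (D k) := fun t ht k hk =>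
    Measurable.inner (hGm.comp (hSℱ t ht k hk.le)) (hXℱ t ht k hk)
  have hD0 : ∀ t < n, ∀ θ : ℝ,
      ∫ ω, Real.exp (θ * ∑ k ∈ Finset.range t, D k ω) * D t ω ∂μ = 0 := by
    intro t ht θ
    have := h0 t ht (fun ω => Real.exp (θ * ∑ k ∈ Finset.range t, D k ω) • G (S t ω)) ?_ ?_
    · simpa only [real_inner_smul_left] using this
    · refine Measurable.smul ?_ (hGm.comp (hSℱ t ht t le_rfl))
      exact ((Finset.measurable_sum _ fun k hk =>
        hDℱ t ht k (Finset.mem_range.1 hk)).const_mul θ).exp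
    · refine ⟨Real.exp (|θ| * (t * b)), fun ω => ?_⟩
      rw [norm_smul, Real.norm_of_nonneg (Real.exp_pos _).le]
      refine (mul_le_of_le_one_right (Real.exp_pos _).le (hGb _)).trans ?_
      refine Real.exp_le_exp.2 ((le_abs_self _).trans ?_)
      rw [abs_mul]
      exact mul_le_mul_of_nonneg_left
        (abs_sum_le_card_mul (fun k hk => hDb k (by omega)) ω) (abs_nonneg _)
  refine (measure_mono ?_).trans (azuma hb n hDm hDb hD0 hℓ)
  intro ω hω
  have hstep : ∀ t ≤ n, N (S t ω)
      ≤ R + (∑ k ∈ Finset.range t, D k ω) + t * (b ^ 2 / (2 * R)) := by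
    intro t
    induction t with
    | zero =>
      intro _
      simp [hS, hN, Real.sqrt_sq hR.le]
    | succ t ih =>
      intro ht
      have h1 := sqrt_sq_add_norm_add_le hR (S t ω) (X t ω) (hXb t (by omega) ω)
      have h2 : S (t + 1) ω = S t ω + X t ω := Finset.sum_range_succ _ _
      rw [h2, Finset.sum_range_succ]
      have h3 := ih (by omega)
      have h4 : N (S t ω + X t ω) ≤ N (S t ω) + D t ω + b ^ 2 / (2 * R) := h1
      push_cast
      linarith
  have h5 := (hNs (S n ω)).trans (hstep n le_rfl)
  have h6 : (n : ℝ) * (b ^ 2 / (2 * R)) = R / 2 := by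
    have : R ^ 2 = b ^ 2 * n := by rw [hRdef, mul_pow, Real.sq_sqrt hn'.le]
    field_simp
    linarith
  simp only [Set.mem_ofPred_eq] at hω ⊢
  have h7 : S n ω = ∑ k ∈ Finset.range n, X k ω := rfl
  rw [h7] at h5
  linarith

/-- A multiplicative Chernoff bound: a sum of `[0,1]`-valued variables is at most `e - 1` times the
sum of their conditional means plus a logarithmic term. -/
theorem sum_le_condMean_tail {D M : ℕ → Ω → ℝ} (n : ℕ) (ℱ : ℕ → MeasurableSpace Ω)
    (hD : ∀ t < n, Measurable (D t)) (hM : ∀ t < n, Measurable (M t))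
    (hDℱ : ∀ t < n, ∀ k < t, Measurable[ℱ t] (D k))
    (hMℱ : ∀ t < n, ∀ k ≤ t, Measurable[ℱ t] (M k))
    (hD0 : ∀ t < n, ∀ ω, 0 ≤ D t ω) (hD1 : ∀ t < n, ∀ ω, D t ω ≤ 1)
    (hM0 : ∀ t < n, ∀ ω, 0 ≤ M t ω) (hM1 : ∀ t < n, ∀ ω, M t ω ≤ 1)
    (h0 : ∀ t < n, ∀ W : Ω → ℝ, Measurable[ℱ t] W → (∃ C, ∀ ω, |W ω| ≤ C) →
      ∫ ω, W ω * D t ω ∂μ = ∫ ω, W ω * M t ω ∂μ) (ℓ : ℝ) :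
    μ {ω | (Real.exp 1 - 1) * (∑ k ∈ Finset.range n, M k ω) + ℓ < ∑ k ∈ Finset.range n, D k ω}
      ≤ ENNReal.ofReal (Real.exp (-ℓ)) := by
  set e : ℝ := Real.exp 1 - 1 with he
  have he0 : 0 ≤ e := by have := Real.add_one_le_exp 1; linarith
  set Z : ℕ → Ω → ℝ := fun t ω => ∑ k ∈ Finset.range t, (D k ω - e * M k ω) with hZ
  have hZm : ∀ t ≤ n, Measurable (Z t) := fun t ht =>
    Finset.measurable_sum _ fun k hk => by
      have hk' : k < n := by have := Finset.mem_range.1 hk; omega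
      exact (hD k hk').sub ((hM k hk').const_mul e)
  have hZℱ : ∀ t < n, Measurable[ℱ t] (Z t) := fun t ht =>
    Finset.measurable_sum _ fun k hk => by
      have hk' := Finset.mem_range.1 hk
      exact (hDℱ t ht k hk').sub ((hMℱ t ht k hk'.le).const_mul e)
  have hZb : ∀ t ≤ n, ∀ ω, Z t ω ≤ t := by
    intro t ht ω
    have : Z t ω ≤ ∑ k ∈ Finset.range t, (1 : ℝ) := Finset.sum_le_sum fun k hk => by
      have hk' : k < n := by have := Finset.mem_range.1 hk; omega
      have := hD1 k hk' ω
      have := mul_nonneg he0 (hM0 k hk' ω)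
      linarith
    simpa using this
  have hint : ∀ t ≤ n, Integrable (fun ω => Real.exp (Z t ω)) μ := by
    intro t ht
    refine (integrable_const (Real.exp t)).mono' ((hZm t ht).exp).aestronglyMeasurable
      (ae_of_all _ fun ω => ?_)
    rw [Real.norm_of_nonneg (Real.exp_pos _).le]
    exact Real.exp_le_exp.2 (hZb t ht ω)
  have hmgf : ∀ t ≤ n, ∫ ω, Real.exp (Z t ω) ∂μ ≤ 1 := by
    intro t
    induction t with
    | zero => intro _; simp [hZ]
    | succ t ih =>
      intro ht
      set W : Ω → ℝ := fun ω => Real.exp (Z t ω - e * M t ω) with hW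
      have hWℱ : Measurable[ℱ t] W := ((hZℱ t ht).sub ((hMℱ t ht t le_rfl).const_mul e)).exp
      have hWm : Measurable W :=
        ((hZm t (by omega)).sub ((hM t ht).const_mul e)).exp
      have hWb : ∀ ω, |W ω| ≤ Real.exp t := by
        intro ω
        rw [abs_of_pos (Real.exp_pos _)]
        refine Real.exp_le_exp.2 ?_
        have := hZb t (by omega) ω
        have := mul_nonneg he0 (hM0 t ht ω)
        linarith
      have hWi : Integrable W μ := (integrable_const (Real.exp t)).mono' hWm.aestronglyMeasurable
        (ae_of_all _ hWb)
      have hWD : Integrable (fun ω => W ω * D t ω) μ :=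
        hWi.mul_bdd (c := 1) (hD t ht).aestronglyMeasurable (ae_of_all _ fun ω => by
          rw [Real.norm_of_nonneg (hD0 t ht ω)]; exact hD1 t ht ω)
      have hWM : Integrable (fun ω => W ω * M t ω) μ :=
        hWi.mul_bdd (c := 1) (hM t ht).aestronglyMeasurable (ae_of_all _ fun ω => by
          rw [Real.norm_of_nonneg (hM0 t ht ω)]; exact hM1 t ht ω)
      have hle : ∀ ω, Real.exp (Z (t + 1) ω) ≤ W ω + e * (W ω * D t ω) := by
        intro ω
        have h1 : Z (t + 1) ω = (Z t ω - e * M t ω) + D t ω := by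
          simp only [hZ, Finset.sum_range_succ]; ring
        rw [h1, Real.exp_add]
        have h2 := convexOn_exp.2 (Set.mem_univ (1 : ℝ)) (Set.mem_univ (0 : ℝ)) (hD0 t ht ω)
          (sub_nonneg.2 (hD1 t ht ω)) (by ring)
        simp only [smul_eq_mul, mul_one, mul_zero, add_zero, Real.exp_zero] at h2
        have h3 := mul_le_mul_of_nonneg_left h2 (Real.exp_pos (Z t ω - e * M t ω)).le
        have h4 : W ω = Real.exp (Z t ω - e * M t ω) := rfl
        rw [h4, he]
        linarith
      have hle2 : ∀ ω, W ω + e * (W ω * M t ω) ≤ Real.exp (Z t ω) := by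
        intro ω
        have h1 : Real.exp (Z t ω) = W ω * Real.exp (e * M t ω) := by
          rw [hW, ← Real.exp_add]; congr 1; ring
        have h2 := mul_le_mul_of_nonneg_left (Real.add_one_le_exp (e * M t ω))
          (Real.exp_pos (Z t ω - e * M t ω)).le
        rw [h1]
        have h4 : W ω = Real.exp (Z t ω - e * M t ω) := rfl
        rw [h4]
        linarith
      calc ∫ ω, Real.exp (Z (t + 1) ω) ∂μ ≤ ∫ ω, (W ω + e * (W ω * D t ω)) ∂μ :=
            integral_mono (hint _ ht) (hWi.add (hWD.const_mul e)) hle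
        _ = ∫ ω, (W ω + e * (W ω * M t ω)) ∂μ := by
            rw [integral_add hWi (hWD.const_mul e), integral_add hWi (hWM.const_mul e),
              integral_const_mul, integral_const_mul, h0 t ht W hWℱ ⟨_, hWb⟩]
        _ ≤ ∫ ω, Real.exp (Z t ω) ∂μ :=
            integral_mono (hWi.add (hWM.const_mul e)) (hint t (by omega)) hle2
        _ ≤ 1 := ih (by omega)
  have hmark := mul_meas_ge_le_integral_of_nonneg
    (ae_of_all μ fun ω => (Real.exp_pos (Z n ω)).le) (hint n le_rfl) (Real.exp ℓ)
  refine (measure_mono (t := {ω | Real.exp ℓ ≤ Real.exp (Z n ω)}) fun ω hω => ?_).trans ?_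
  · simp only [Set.mem_ofPred_eq] at hω ⊢
    refine Real.exp_le_exp.2 ?_
    simp only [hZ, Finset.sum_sub_distrib, ← Finset.mul_sum]
    linarith
  · rw [← ofReal_measureReal]
    refine ENNReal.ofReal_le_ofReal ?_
    have h2 := hmark.trans (hmgf n le_rfl)
    rw [Real.exp_neg, ← one_div, le_div_iff₀ (Real.exp_pos _), mul_comm]
    exact h2

end concentration

/-! ### Ridge regression and approximately optimal designs -/

section ridge

variable {d : ℕ}

theorem dotProduct_eq_inner (x y : Vec d) : x.ofLp ⬝ᵥ y.ofLp = ⟪x, y⟫ := by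
  simp [PiLp.inner_apply, dotProduct, mul_comm]

/-- The inverse of a positive definite matrix is the Gram form of a linear map into a Euclidean
space. -/
theorem exists_inner_eq_inv {G : Matrix (Fin d) (Fin d) ℝ} (hG : G.PosDef) :
    ∃ (m : ℕ) (R : Vec d →ₗ[ℝ] Vec m), ∀ x y : Vec d,
      x.ofLp ⬝ᵥ (G⁻¹ *ᵥ y.ofLp) = ⟪R x, R y⟫ := by
  obtain ⟨m, v, hv⟩ := Matrix.posSemidef_iff_eq_sum_vecMulVec.1 hG.inv.posSemidef
  refine ⟨m, Matrix.toLpLin 2 2 (Matrix.of v), fun x y => ?_⟩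
  rw [← dotProduct_eq_inner, hv, Matrix.sum_mulVec, dotProduct_sum]
  simp only [dotProduct, Matrix.toLpLin_apply, Matrix.mulVec, Matrix.of_apply]
  refine Finset.sum_congr rfl fun i _ => ?_
  have h : ∀ a, (∑ b, Matrix.vecMulVec (v i) (star (v i)) a b * y.ofLp b)
      = v i a * ∑ b, v i b * y.ofLp b := fun a => by
    simp [Matrix.vecMulVec_apply, Finset.mul_sum, mul_assoc]
  simp only [h]
  rw [Finset.sum_mul]
  exact Finset.sum_congr rfl fun a _ => by ring

theorem invNorm_eq_norm {G : Matrix (Fin d) (Fin d) ℝ} {m : ℕ} {R : Vec d →ₗ[ℝ] Vec m}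
    (hR : ∀ x y : Vec d, x.ofLp ⬝ᵥ (G⁻¹ *ᵥ y.ofLp) = ⟪R x, R y⟫) (v : Vec d) :
    invNorm G v = ‖R v‖ := by
  rw [invNorm, hR, real_inner_self_eq_norm_sq, Real.sqrt_sq (norm_nonneg _)]

theorem invNorm_nonneg (G : Matrix (Fin d) (Fin d) ℝ) (v : Vec d) : 0 ≤ invNorm G v :=
  Real.sqrt_nonneg _

theorem invNorm_sq {G : Matrix (Fin d) (Fin d) ℝ} (hG : G.PosDef) (v : Vec d) :
    invNorm G v ^ 2 = v.ofLp ⬝ᵥ (G⁻¹ *ᵥ v.ofLp) := by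
  obtain ⟨m, R, hR⟩ := exists_inner_eq_inv hG
  rw [invNorm_eq_norm hR, hR, real_inner_self_eq_norm_sq]

theorem abs_dotProduct_inv_le {G : Matrix (Fin d) (Fin d) ℝ} (hG : G.PosDef) (x y : Vec d) :
    |x.ofLp ⬝ᵥ (G⁻¹ *ᵥ y.ofLp)| ≤ invNorm G x * invNorm G y := by
  obtain ⟨m, R, hR⟩ := exists_inner_eq_inv hG
  rw [hR, invNorm_eq_norm hR, invNorm_eq_norm hR]
  exact abs_real_inner_le_norm _ _

theorem invNorm_smul_sq {B : Matrix (Fin d) (Fin d) ℝ} (hB : B.PosDef) {c : ℝ} (hc : 0 < c)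
    (v : Vec d) : invNorm (c • B) v ^ 2 = invNorm B v ^ 2 / c := by
  have hdet := Matrix.isUnit_iff_isUnit_det _ |>.1 hB.isUnit
  have h1 : (c • B)⁻¹ = c⁻¹ • B⁻¹ := by
    refine Matrix.inv_eq_left_inv ?_
    rw [Matrix.smul_mul, Matrix.mul_smul, smul_smul, inv_mul_cancel₀ hc.ne', one_smul,
      Matrix.nonsing_inv_mul _ hdet]
  rw [invNorm_sq (hB.smul hc), invNorm_sq hB, h1, Matrix.smul_mulVec, dotProduct_smul, smul_eq_mul]
  field_simp

theorem invNorm_add_le {G : Matrix (Fin d) (Fin d) ℝ} (hG : G.PosDef) (v w : Vec d) :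
    invNorm G (v + w) ≤ invNorm G v + invNorm G w := by
  obtain ⟨m, R, hR⟩ := exists_inner_eq_inv hG
  simp only [invNorm_eq_norm hR, map_add]
  exact norm_add_le _ _

theorem invNorm_sum_smul_le {G : Matrix (Fin d) (Fin d) ℝ} (hG : G.PosDef) (I : Finset ℕ)
    (c : ℕ → ℝ) (v : ℕ → Vec d) {C b : ℝ} (hc : ∀ k ∈ I, |c k| ≤ C)
    (hv : ∀ k ∈ I, invNorm G (v k) ≤ b) :
    invNorm G (∑ k ∈ I, c k • v k) ≤ I.card * (C * b) := by
  obtain ⟨m, R, hR⟩ := exists_inner_eq_inv hG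
  simp only [invNorm_eq_norm hR, map_sum, map_smul] at hv ⊢
  refine (norm_sum_le _ _).trans ((Finset.sum_le_card_nsmul _ _ (C * b) fun k hk => ?_).trans ?_)
  · rw [norm_smul, Real.norm_eq_abs]
    exact mul_le_mul (hc k hk) (hv k hk) (norm_nonneg _) ((abs_nonneg _).trans (hc k hk))
  · simp

theorem inv_mulVec_mulVec {G : Matrix (Fin d) (Fin d) ℝ} (hG : G.PosDef) (y : Fin d → ℝ) :
    G⁻¹ *ᵥ (G *ᵥ y) = y := by
  rw [Matrix.mulVec_mulVec, Matrix.nonsing_inv_mul _ (Matrix.isUnit_iff_isUnit_det _ |>.1 hG.isUnit),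
    Matrix.one_mulVec]

theorem mulVec_inv_mulVec {G : Matrix (Fin d) (Fin d) ℝ} (hG : G.PosDef) (y : Fin d → ℝ) :
    G *ᵥ (G⁻¹ *ᵥ y) = y := by
  rw [Matrix.mulVec_mulVec, Matrix.mul_nonsing_inv _ (Matrix.isUnit_iff_isUnit_det _ |>.1 hG.isUnit),
    Matrix.one_mulVec]

/-- Cauchy–Schwarz for the dual pair of norms given by `G⁻¹` and `G`. -/
theorem inner_sq_le_invNorm_sq_mul {G : Matrix (Fin d) (Fin d) ℝ} (hG : G.PosDef) (z y : Vec d) :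
    ⟪z, y⟫ ^ 2 ≤ invNorm G z ^ 2 * (y.ofLp ⬝ᵥ (G *ᵥ y.ofLp)) := by
  have h := abs_dotProduct_inv_le hG z (WithLp.toLp 2 (G *ᵥ y.ofLp))
  rw [inv_mulVec_mulVec hG, dotProduct_eq_inner] at h
  have h2 := invNorm_sq hG (WithLp.toLp 2 (G *ᵥ y.ofLp))
  rw [inv_mulVec_mulVec hG] at h2
  rw [← sq_abs, dotProduct_comm, ← h2, ← mul_pow]
  exact pow_le_pow_left₀ (abs_nonneg _) h 2

/-- A comparison of quadratic forms reverses for the inverse matrices. -/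
theorem invNorm_sq_le_of_form_le {G V : Matrix (Fin d) (Fin d) ℝ} (hG : G.PosDef) (hV : V.PosDef)
    {C : ℝ} (h : ∀ y : Vec d, y.ofLp ⬝ᵥ (V *ᵥ y.ofLp) ≤ C * (y.ofLp ⬝ᵥ (G *ᵥ y.ofLp)))
    (z : Vec d) : invNorm G z ^ 2 ≤ C * invNorm V z ^ 2 := by
  set y : Vec d := WithLp.toLp 2 (G⁻¹ *ᵥ z.ofLp) with hy
  have h1 : ⟪z, y⟫ = invNorm G z ^ 2 := by
    rw [invNorm_sq hG, ← dotProduct_eq_inner]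
  have h2 : y.ofLp ⬝ᵥ (G *ᵥ y.ofLp) = invNorm G z ^ 2 := by
    rw [hy, mulVec_inv_mulVec hG, invNorm_sq hG, dotProduct_comm]
  have h3 := inner_sq_le_invNorm_sq_mul hV z y
  have h4 := h y
  rw [h2] at h4
  rw [h1] at h3
  rcases (sq_nonneg (invNorm G z)).eq_or_lt with h0 | h0
  · rw [← h0] at h4 ⊢
    rcases eq_or_ne z 0 with rfl | hz
    · simp [invNorm]
    · exfalso
      have := hG.inv.dotProduct_mulVec_pos (x := z.ofLp) (by simpa using hz)
      rw [invNorm_sq hG] at h0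
      simp only [star_trivial] at this
      linarith
  · have h5 := h3.trans (mul_le_mul_of_nonneg_left h4 (sq_nonneg (invNorm V z)))
    nlinarith

theorem dotProduct_gram (lam : ℝ) (I : Finset ℕ) (f : ℕ → Vec d) (y : Vec d) :
    y.ofLp ⬝ᵥ (gram lam I f *ᵥ y.ofLp) = lam * ‖y‖ ^ 2 + ∑ k ∈ I, ⟪f k, y⟫ ^ 2 := by
  rw [gram, Matrix.add_mulVec, dotProduct_add, Matrix.smul_mulVec, Matrix.one_mulVec,
    dotProduct_smul, dotProduct_eq_inner, real_inner_self_eq_norm_sq, Matrix.sum_mulVec,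
    dotProduct_sum, smul_eq_mul]
  congr 1
  refine Finset.sum_congr rfl fun k _ => ?_
  rw [Matrix.vecMulVec_mulVec, dotProduct_smul, dotProduct_eq_inner, dotProduct_eq_inner,
    real_inner_comm, MulOpposite.smul_eq_mul_unop, MulOpposite.unop_op, sq]

theorem posDef_gram {lam : ℝ} (hl : 0 < lam) (I : Finset ℕ) (f : ℕ → Vec d) :
    (gram lam I f).PosDef := by
  refine Matrix.PosDef.add_posSemidef (Matrix.PosDef.one.smul hl) ?_
  refine Matrix.posSemidef_sum _ fun k _ => ?_
  simpa using Matrix.posSemidef_vecMulVec_self_star (R := ℝ) (f k).ofLp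

theorem invNorm_gram_le {lam : ℝ} (hl : 0 < lam) (I : Finset ℕ) (f : ℕ → Vec d) (z : Vec d) :
    √lam * invNorm (gram lam I f) z ≤ ‖z‖ := by
  have hV : (lam • (1 : Matrix (Fin d) (Fin d) ℝ)).PosDef := Matrix.PosDef.one.smul hl
  have h := invNorm_sq_le_of_form_le (posDef_gram hl I f) hV (C := 1) (fun y => by
    rw [dotProduct_gram, one_mul, Matrix.smul_mulVec, Matrix.one_mulVec, dotProduct_smul,
      dotProduct_eq_inner, real_inner_self_eq_norm_sq, smul_eq_mul]
    have : 0 ≤ ∑ k ∈ I, ⟪f k, y⟫ ^ 2 := Finset.sum_nonneg fun k _ => sq_nonneg _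
    linarith) z
  have h2 : lam * invNorm (lam • (1 : Matrix (Fin d) (Fin d) ℝ)) z ^ 2 = ‖z‖ ^ 2 := by
    have h3 : lam • ((lam • (1 : Matrix (Fin d) (Fin d) ℝ))⁻¹ *ᵥ z.ofLp) = z.ofLp := by
      have := mulVec_inv_mulVec hV z.ofLp
      rwa [Matrix.smul_mulVec, Matrix.one_mulVec] at this
    rw [invNorm_sq hV, ← smul_eq_mul, ← dotProduct_smul, h3, dotProduct_eq_inner,
      real_inner_self_eq_norm_sq]
  refine le_of_sq_le_sq ?_ (norm_nonneg _)
  rw [mul_pow, Real.sq_sqrt hl.le]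
  nlinarith

/-- The prediction error of ridge regression: a noise term and a regularization term. -/
theorem abs_inner_ridge_sub_le {lam : ℝ} (hl : 0 < lam) (I : Finset ℕ) (f : ℕ → Vec d) (y : ℕ → ℝ)
    (w x : Vec d) :
    |⟪x, ridge lam I f y - w⟫| ≤ invNorm (gram lam I f) x *
      (invNorm (gram lam I f) (∑ k ∈ I, (y k - ⟪f k, w⟫) • f k) + √lam * ‖w‖) := by
  set G := gram lam I f with hGdef
  have hG : G.PosDef := posDef_gram hl I f
  have hGw : G *ᵥ w.ofLp = lam • w.ofLp + ∑ k ∈ I, ⟪f k, w⟫ • (f k).ofLp := by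
    rw [hGdef, gram, Matrix.add_mulVec, Matrix.smul_mulVec, Matrix.one_mulVec, Matrix.sum_mulVec]
    congr 1
    refine Finset.sum_congr rfl fun k _ => ?_
    rw [Matrix.vecMulVec_mulVec, dotProduct_eq_inner]
    ext i
    simp [mul_comm]
  have hsum : (∑ k ∈ I, (y k - ⟪f k, w⟫) • f k).ofLp
      = (∑ k ∈ I, y k • (f k).ofLp) - ∑ k ∈ I, ⟪f k, w⟫ • (f k).ofLp := by
    rw [WithLp.ofLp_sum, ← Finset.sum_sub_distrib]
    exact Finset.sum_congr rfl fun k _ => by rw [WithLp.ofLp_smul, sub_smul]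
  have key : ⟪x, ridge lam I f y - w⟫
      = x.ofLp ⬝ᵥ (G⁻¹ *ᵥ (∑ k ∈ I, (y k - ⟪f k, w⟫) • f k).ofLp)
        - lam * (x.ofLp ⬝ᵥ (G⁻¹ *ᵥ w.ofLp)) := by
    have h1 : (ridge lam I f y - w).ofLp
        = G⁻¹ *ᵥ ((∑ k ∈ I, (y k - ⟪f k, w⟫) • f k).ofLp - lam • w.ofLp) := by
      rw [WithLp.ofLp_sub, hsum]
      conv_lhs => rw [← inv_mulVec_mulVec hG w.ofLp]
      rw [ridge, ← Matrix.mulVec_sub, hGw]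
      congr 1
      abel
    rw [← dotProduct_eq_inner, h1, Matrix.mulVec_sub, dotProduct_sub, Matrix.mulVec_smul,
      dotProduct_smul, smul_eq_mul]
  rw [key]
  have h2 := abs_dotProduct_inv_le hG x (∑ k ∈ I, (y k - ⟪f k, w⟫) • f k)
  have h3 := abs_dotProduct_inv_le hG x w
  have h4 := invNorm_gram_le hl I f w
  have h5 : lam * |x.ofLp ⬝ᵥ (G⁻¹ *ᵥ w.ofLp)| ≤ invNorm G x * (√lam * ‖w‖) := by
    have hs : lam = √lam * √lam := (Real.mul_self_sqrt hl.le).symm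
    calc lam * |x.ofLp ⬝ᵥ (G⁻¹ *ᵥ w.ofLp)|
        ≤ lam * (invNorm G x * invNorm G w) := mul_le_mul_of_nonneg_left h3 hl.le
      _ = invNorm G x * (√lam * (√lam * invNorm G w)) := by
          conv_lhs => rw [hs]
          ring
      _ ≤ _ := mul_le_mul_of_nonneg_left
          (mul_le_mul_of_nonneg_left h4 (Real.sqrt_nonneg _)) (invNorm_nonneg _ _)
  calc _ ≤ |x.ofLp ⬝ᵥ (G⁻¹ *ᵥ (∑ k ∈ I, (y k - ⟪f k, w⟫) • f k).ofLp)|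
        + |lam * (x.ofLp ⬝ᵥ (G⁻¹ *ᵥ w.ofLp))| := abs_sub _ _
    _ ≤ _ := by
        rw [abs_mul, abs_of_pos hl, mul_add]
        exact add_le_add h2 h5

/-- The matrices that are dominated, as quadratic forms, by `μ` times the identity plus the largest
squared feature: a substitute for the convex hull of the designs `φ φᵀ`. -/
def dominated {ι : Type*} (φ : ι → Vec d) (μ : ℝ) : Set (Matrix (Fin d) (Fin d) ℝ) :=
  {B | B.PosDef ∧ ∀ (y : Vec d) (q : ℝ), 0 ≤ q → (∀ i, ⟪φ i, y⟫ ^ 2 ≤ q) →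
    y.ofLp ⬝ᵥ (B *ᵥ y.ofLp) ≤ μ * ‖y‖ ^ 2 + q}

theorem abs_entry_le_of_form_le {B : Matrix (Fin d) (Fin d) ℝ} (hB : B.PosSemidef) {c : ℝ}
    (h : ∀ y : Vec d, y.ofLp ⬝ᵥ (B *ᵥ y.ofLp) ≤ c * ‖y‖ ^ 2) (i j : Fin d) : |B i j| ≤ c := by
  have hdiag : ∀ i, B i i ≤ c := fun i => by
    have := h (EuclideanSpace.single i 1)
    simpa [PiLp.norm_single] using this
  have hsymm : B j i = B i j := by simpa using hB.1.apply i j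
  have hp := hB.dotProduct_mulVec_nonneg (Pi.single i 1 + Pi.single j 1)
  have hm := hB.dotProduct_mulVec_nonneg (Pi.single i 1 - Pi.single j 1)
  simp only [star_trivial, Matrix.mulVec_add, Matrix.mulVec_sub, add_dotProduct, sub_dotProduct,
    dotProduct_add, dotProduct_sub, single_one_dotProduct, Matrix.mulVec_single_one,
    Matrix.col_apply, hsymm] at hp hm
  have := hdiag i
  have := hdiag j
  rw [abs_le]
  constructor <;> linarith

/-- Adding the multiple `d⁻¹` of a design `φ φᵀ` and renormalizing keeps a matrix dominated. -/
theorem dominated_update {ι : Type*} {φ : ι → Vec d} {μ : ℝ} (hμ : 0 < μ) (hd : 1 ≤ d)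
    {B : Matrix (Fin d) (Fin d) ℝ} (hB : B ∈ dominated φ μ) (i : ι) :
    (1 + (d : ℝ)⁻¹)⁻¹ • (B + (d : ℝ)⁻¹ • Matrix.vecMulVec (φ i).ofLp (φ i).ofLp)
      ∈ dominated φ μ := by
  have hd' : (0 : ℝ) < (d : ℝ)⁻¹ := by positivity
  refine ⟨((hB.1).add_posSemidef (Matrix.PosSemidef.smul ?_ hd'.le)).smul (by positivity), ?_⟩
  · simpa using Matrix.posSemidef_vecMulVec_self_star (R := ℝ) (φ i).ofLp
  · intro y q hq hφ
    have h1 := hB.2 y q hq hφ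
    have h2 : y.ofLp ⬝ᵥ (Matrix.vecMulVec (φ i).ofLp (φ i).ofLp *ᵥ y.ofLp) = ⟪φ i, y⟫ ^ 2 := by
      rw [Matrix.vecMulVec_mulVec, dotProduct_smul, dotProduct_eq_inner, dotProduct_eq_inner,
        real_inner_comm, MulOpposite.smul_eq_mul_unop, MulOpposite.unop_op, sq]
    rw [Matrix.smul_mulVec, dotProduct_smul, Matrix.add_mulVec, dotProduct_add, Matrix.smul_mulVec,
      dotProduct_smul, h2, smul_eq_mul, smul_eq_mul, inv_mul_le_iff₀ (by positivity)]
    have h3 := mul_le_mul_of_nonneg_left (hφ i) hd'.le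
    have h4 : 0 ≤ (d : ℝ)⁻¹ * (μ * ‖y‖ ^ 2) := by positivity
    linarith

theorem det_dominated_update {ι : Type*} {φ : ι → Vec d}
    {B : Matrix (Fin d) (Fin d) ℝ} (hB : B.PosDef) (i : ι) :
    ((1 + (d : ℝ)⁻¹)⁻¹ • (B + (d : ℝ)⁻¹ • Matrix.vecMulVec (φ i).ofLp (φ i).ofLp)).det
      = ((1 + (d : ℝ)⁻¹)⁻¹) ^ d * (B.det * (1 + (d : ℝ)⁻¹ * invNorm B (φ i) ^ 2)) := by
  rw [Matrix.det_smul, Fintype.card_fin]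
  congr 1
  have h : (d : ℝ)⁻¹ • Matrix.vecMulVec (φ i).ofLp (φ i).ofLp
      = Matrix.replicateCol Unit ((d : ℝ)⁻¹ • (φ i).ofLp) * Matrix.replicateRow Unit (φ i).ofLp := by
    rw [Matrix.vecMulVec_eq Unit, ← Matrix.smul_mul, Matrix.replicateCol_smul]
  rw [h, Matrix.det_add_replicateCol_mul_replicateRow
    (Matrix.isUnit_iff_isUnit_det _ |>.1 hB.isUnit), invNorm_sq hB]
  congr 1
  rw [Matrix.mul_assoc, ← Matrix.replicateCol_mulVec, Matrix.det_unique, Matrix.add_apply,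
    Matrix.one_apply_eq, Matrix.replicateRow_mul_replicateCol_apply,
    Matrix.mulVec_smul, dotProduct_smul, smul_eq_mul]

/-- An approximately optimal design in the sense of Kiefer and Wolfowitz: near-maximality of the
determinant among the dominated matrices bounds all features in the inverse norm. -/
theorem exists_design {ι : Type*} (φ : ι → Vec d) (hφ : ∀ i, ‖φ i‖ ≤ 1) {μ : ℝ} (hμ : 0 < μ)
    (hd : 1 ≤ d) : ∃ B ∈ dominated φ μ, ∀ i, invNorm B (φ i) ^ 2 ≤ 5 * d := by
  have hne : (dominated φ μ).Nonempty := by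
    refine ⟨μ • 1, Matrix.PosDef.one.smul hμ, fun y q hq _ => ?_⟩
    rw [Matrix.smul_mulVec, Matrix.one_mulVec, dotProduct_smul, dotProduct_eq_inner,
      real_inner_self_eq_norm_sq, smul_eq_mul]
    linarith
  have hbdd : BddAbove (Matrix.det '' dominated φ μ) := by
    refine ⟨(Nat.factorial d) • (μ + 1) ^ d, ?_⟩
    rintro _ ⟨B, hB, rfl⟩
    have h1 : ∀ y : Vec d, y.ofLp ⬝ᵥ (B *ᵥ y.ofLp) ≤ (μ + 1) * ‖y‖ ^ 2 := fun y => by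
      have := hB.2 y (‖y‖ ^ 2) (sq_nonneg _) fun i => by
        rw [← sq_abs]
        refine pow_le_pow_left₀ (abs_nonneg _) ((abs_real_inner_le_norm _ _).trans ?_) 2
        exact mul_le_of_le_one_left (norm_nonneg _) (hφ i)
      linarith
    have h2 := Matrix.det_le (abv := AbsoluteValue.abs) (A := B) (x := μ + 1)
      fun i j => abs_entry_le_of_form_le hB.1.posSemidef h1 i j
    rw [Fintype.card_fin] at h2
    exact (le_abs_self _).trans h2
  obtain ⟨B₀, hB₀⟩ := hne
  have hsup : 0 < sSup (Matrix.det '' dominated φ μ) :=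
    hB₀.1.det_pos.trans_le (le_csSup hbdd ⟨B₀, hB₀, rfl⟩)
  obtain ⟨_, ⟨B, hB, rfl⟩, hlt⟩ := exists_lt_of_lt_csSup
    (Set.Nonempty.image Matrix.det ⟨B₀, hB₀⟩) (half_lt_self hsup)
  refine ⟨B, hB, fun i => ?_⟩
  have hd' : (0 : ℝ) < d := by exact_mod_cast hd
  have hle : _ ≤ sSup (Matrix.det '' dominated φ μ) :=
    le_csSup hbdd ⟨_, dominated_update hμ hd hB i, rfl⟩
  rw [det_dominated_update hB.1] at hle
  have hdet := hB.1.det_pos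
  -- `(1 + 1/d)^d ≤ e ≤ 3`, so near-maximality gives `1 + x / d ≤ 2 e ≤ 6`
  have he : (1 + (d : ℝ)⁻¹) ^ d ≤ 3 := by
    have h1 : (1 + (d : ℝ)⁻¹) ^ d ≤ Real.exp ((d : ℝ)⁻¹) ^ d :=
      pow_le_pow_left₀ (by positivity) (by linarith [Real.add_one_le_exp (d : ℝ)⁻¹]) d
    rw [← Real.exp_nat_mul, mul_inv_cancel₀ hd'.ne'] at h1
    linarith [Real.exp_one_lt_d9]
  have h2 : B.det * (1 + (d : ℝ)⁻¹ * invNorm B (φ i) ^ 2) ≤ 6 * B.det := by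
    rw [inv_pow, inv_mul_le_iff₀ (by positivity)] at hle
    calc _ ≤ _ := hle
      _ ≤ 3 * (2 * B.det) := mul_le_mul he (by linarith) hsup.le (by norm_num)
      _ = 6 * B.det := by ring
  have h3 : 1 + (d : ℝ)⁻¹ * invNorm B (φ i) ^ 2 ≤ 6 := by
    refine le_of_mul_le_mul_left ?_ hdet
    linarith
  have h4 : (d : ℝ)⁻¹ * invNorm B (φ i) ^ 2 ≤ 5 := by linarith
  rw [inv_mul_le_iff₀ hd'] at h4
  linarith

end ridge

/-! ### Value functions -/

section values

variable {X A D : Type*} [MeasurableSpace X] [MeasurableSpace A] [MeasurableSpace D]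
  {P : ℕ → Kernel (X × A) X} {r : ℕ → X → A → ℝ} {H : ℕ}

/-- A family of Markov policies, one for each `o : D`, whose first `H` stages are Markov kernels
jointly in the parameter `o` and the state. -/
def IsPolicyFamily (H : ℕ) (π : D → ℕ → X → Measure A) : Prop :=
  ∀ h < H, ∃ κ : Kernel (D × X) A, IsMarkovKernel κ ∧ ∀ o s, κ (o, s) = π o h s

theorem IsPolicyFamily.isProbabilityMeasure {π : D → ℕ → X → Measure A} (hπ : IsPolicyFamily H π)
    {h : ℕ} (hh : h < H) (o : D) (s : X) : IsProbabilityMeasure (π o h s) := by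
  obtain ⟨κ, _, hκ⟩ := hπ h hh
  rw [← hκ]
  infer_instance

theorem measurable_integral_transition {Y : Type*} [MeasurableSpace Y] (κ : Kernel (X × A) X)
    [IsMarkovKernel κ] {f : Y × X → ℝ} (hf : Measurable f) {g : Y → X × A} (hg : Measurable g) :
    Measurable fun y => ∫ s', f (y, s') ∂(κ (g y)) :=
  (StronglyMeasurable.integral_kernel_prod_right' (κ := κ.comap g hg)
    hf.stronglyMeasurable).measurable

theorem measurable_value (hP : ∀ h, IsMarkovKernel (P h))
    (hr : ∀ h < H, Measurable fun p : X × A => r h p.1 p.2)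
    {π : D → ℕ → X → Measure A} (hπ : IsPolicyFamily H π) :
    ∀ n h, h + n ≤ H → Measurable fun p : D × X => value P r (π p.1) n h p.2 := by
  intro n
  induction n with
  | zero => intro h _; exact measurable_const
  | succ n ih =>
    intro h hh
    obtain ⟨κ, _, hκ⟩ := hπ h (by omega)
    have h1 : Measurable fun y : (D × X) × A =>
        ∫ s', value P r (π y.1.1) n (h + 1) s' ∂(P h (y.1.2, y.2)) :=
      measurable_integral_transition (P h)
        (f := fun q : ((D × X) × A) × X => value P r (π q.1.1.1) n (h + 1) q.2)
        ((ih (h + 1) (by omega)).comp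
          ((measurable_fst.comp (measurable_fst.comp measurable_fst)).prodMk measurable_snd))
        ((measurable_snd.comp measurable_fst).prodMk measurable_snd)
    have h2 : Measurable fun y : (D × X) × A => r h y.1.2 y.2 :=
      (hr h (by omega)).comp ((measurable_snd.comp measurable_fst).prodMk measurable_snd)
    have h3 := (StronglyMeasurable.integral_kernel_prod_right' (κ := κ)
      (h2.add h1).stronglyMeasurable).measurable
    convert h3 using 2 with p
    rw [value, ← hκ]
    rfl

theorem measurable_value_apply (hP : ∀ h, IsMarkovKernel (P h))
    (hr : ∀ h < H, Measurable fun p : X × A => r h p.1 p.2)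
    {π : D → ℕ → X → Measure A} (hπ : IsPolicyFamily H π) (o : D) {n h : ℕ} (hn : h + n ≤ H) :
    Measurable fun s : X => value P r (π o) n h s :=
  (measurable_value hP hr hπ n h hn).comp measurable_prodMk_left

theorem value_nonneg (hr0 : ∀ h < H, ∀ s a, 0 ≤ r h s a) (π : ℕ → X → Measure A) :
    ∀ n h, h + n ≤ H → ∀ s, 0 ≤ value P r π n h s := by
  intro n
  induction n with
  | zero => intro h _ s; exact le_rfl
  | succ n ih =>
    intro h hh s
    exact integral_nonneg fun a => add_nonneg (hr0 h (by omega) s a)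
      (integral_nonneg fun s' => ih (h + 1) (by omega) s')

theorem abs_value_le (hP : ∀ h, IsMarkovKernel (P h)) (hr1 : ∀ h < H, ∀ s a, |r h s a| ≤ 1)
    {π : D → ℕ → X → Measure A} (hπ : IsPolicyFamily H π) (o : D) :
    ∀ n h, h + n ≤ H → ∀ s, |value P r (π o) n h s| ≤ n := by
  intro n
  induction n with
  | zero => intro h _ s; simp [value]
  | succ n ih =>
    intro h hh s
    have := hπ.isProbabilityMeasure (h := h) (by omega) o s
    have h1 : ∀ a, ‖r h s a + ∫ s', value P r (π o) n (h + 1) s' ∂(P h (s, a))‖ ≤ (n + 1 : ℕ) := by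
      intro a
      have h2 := norm_integral_le_of_norm_le_const (μ := P h (s, a)) (C := (n : ℝ))
        (f := fun s' => value P r (π o) n (h + 1) s') (ae_of_all _ fun s' => ih (h + 1) (by omega) s')
      rw [probReal_univ, mul_one] at h2
      have h3 := hr1 h (by omega) s a
      push_cast
      exact (norm_add_le _ _).trans (by rw [Real.norm_eq_abs (r h s a)]; linarith)
    have h4 := norm_integral_le_of_norm_le_const (μ := π o h s) (ae_of_all _ h1)
    rw [probReal_univ, mul_one] at h4
    exact h4

/-- A function that dominates the one-step lookahead of the reward `r + ε r'` on an invariant family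
of state sets dominates the corresponding combination of values of every policy. -/
theorem value_add_mul_le_of_supersolution (hP : ∀ h, IsMarkovKernel (P h)) {r' : ℕ → X → A → ℝ}
    (hr : ∀ h < H, Measurable fun p : X × A => r h p.1 p.2)
    (hr' : ∀ h < H, Measurable fun p : X × A => r' h p.1 p.2)
    (hr1 : ∀ h < H, ∀ s a, |r h s a| ≤ 1) (hr1' : ∀ h < H, ∀ s a, |r' h s a| ≤ 1)
    {π : D → ℕ → X → Measure A} (hπ : IsPolicyFamily H π) (o : D) {supp : ℕ → Set X}
    (hcl : ∀ h, h + 1 < H → ∀ s ∈ supp h, ∀ a, ∀ᵐ s' ∂(P h (s, a)), s' ∈ supp (h + 1))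
    {W : ℕ → X → ℝ} {c ε : ℝ} (hW : ∀ h ≤ H, Measurable (W h)) (hWb : ∀ h ≤ H, ∀ s, |W h s| ≤ c)
    (hWH : ∀ s, W H s = 0)
    (hsup : ∀ h < H, ∀ s ∈ supp h, ∀ a,
      r h s a + ε * r' h s a + ∫ s', W (h + 1) s' ∂(P h (s, a)) ≤ W h s) :
    ∀ n h, h + n = H → ∀ s ∈ (if h < H then supp h else Set.univ),
      value P r (π o) n h s + ε * value P r' (π o) n h s ≤ W h s := by
  intro n
  induction n with
  | zero =>
    intro h hh s _
    obtain rfl : h = H := by omega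
    simp [value, hWH]
  | succ n ih =>
    intro h hh s hs
    have hh' : h < H := by omega
    rw [if_pos hh'] at hs
    have := hπ.isProbabilityMeasure hh' o s
    have hint : ∀ {q : ℕ → X → A → ℝ}, (∀ h < H, Measurable fun p : X × A => q h p.1 p.2) →
        (∀ h < H, ∀ s a, |q h s a| ≤ 1) →
        (∀ a, Integrable (fun s' => value P q (π o) n (h + 1) s') (P h (s, a))) ∧
        Integrable (fun a => q h s a + ∫ s', value P q (π o) n (h + 1) s' ∂(P h (s, a)))
          (π o h s) := by
      intro q hq hq1
      have hm := measurable_value_apply hP hq hπ o (n := n) (h := h + 1) (by omega)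
      have hb := abs_value_le hP hq1 hπ o n (h + 1) (by omega)
      have h1 : ∀ a, Integrable (fun s' => value P q (π o) n (h + 1) s') (P h (s, a)) := fun a =>
        (integrable_const (n : ℝ)).mono' hm.aestronglyMeasurable (ae_of_all _ hb)
      refine ⟨h1, (integrable_const ((n : ℝ) + 1)).mono' ?_ (ae_of_all _ fun a => ?_)⟩
      · refine (((hq h hh').comp measurable_prodMk_left).add ?_).aestronglyMeasurable
        exact measurable_integral_transition (P h) (f := fun p : A × X => _)
          (hm.comp measurable_snd) measurable_prodMk_left
      · have h2 := norm_integral_le_of_norm_le_const (μ := P h (s, a)) (C := (n : ℝ))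
          (f := fun s' => value P q (π o) n (h + 1) s') (ae_of_all _ hb)
        rw [probReal_univ, mul_one] at h2
        have h3 := hq1 h hh' s a
        exact (norm_add_le _ _).trans (by rw [Real.norm_eq_abs (q h s a)]; linarith)
    obtain ⟨hi1, hi2⟩ := hint hr hr1
    obtain ⟨hi1', hi2'⟩ := hint hr' hr1'
    calc value P r (π o) (n + 1) h s + ε * value P r' (π o) (n + 1) h s
        = ∫ a, ((r h s a + ∫ s', value P r (π o) n (h + 1) s' ∂(P h (s, a)))
          + ε * (r' h s a + ∫ s', value P r' (π o) n (h + 1) s' ∂(P h (s, a)))) ∂(π o h s) := by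
          rw [integral_add hi2 (hi2'.const_mul ε), integral_const_mul]; rfl
      _ ≤ ∫ _, W h s ∂(π o h s) := by
          refine integral_mono (hi2.add (hi2'.const_mul ε)) (integrable_const _) fun a => ?_
          refine le_trans ?_ (hsup h hh' s hs a)
          have h1 : ∫ s', value P r (π o) n (h + 1) s' ∂(P h (s, a))
              + ε * ∫ s', value P r' (π o) n (h + 1) s' ∂(P h (s, a))
              ≤ ∫ s', W (h + 1) s' ∂(P h (s, a)) := by
            rw [← integral_const_mul, ← integral_add (hi1 a) ((hi1' a).const_mul ε)]
            refine integral_mono_ae ((hi1 a).add ((hi1' a).const_mul ε))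
              ((integrable_const c).mono' (hW _ (by omega)).aestronglyMeasurable
                (ae_of_all _ (hWb _ (by omega)))) ?_
            by_cases hlast : h + 1 < H
            · filter_upwards [hcl h hlast s hs a] with s' hs'
              exact ih (h + 1) (by omega) s' (by rwa [if_pos hlast])
            · refine ae_of_all _ fun s' => ?_
              exact ih (h + 1) (by omega) s' (by rw [if_neg hlast]; trivial)
          simp only
          linarith
      _ = W h s := by simp

end values

section target

open Classical in
/-- The indicator that an action is not the target action. -/
noncomputable def offTarget {X A : Type*} (tgt : ℕ → X → A) (h : ℕ) (s : X) (a : A) : ℝ := if a = tgt h s then 0 else 1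

theorem offTarget_nonneg {X A : Type*} (tgt : ℕ → X → A) (h : ℕ) (s : X) (a : A) : 0 ≤ offTarget tgt h s a := by
  unfold offTarget; split_ifs <;> norm_num

theorem offTarget_le_one {X A : Type*} (tgt : ℕ → X → A) (h : ℕ) (s : X) (a : A) : offTarget tgt h s a ≤ 1 := by
  unfold offTarget; split_ifs <;> norm_num

variable {X A : Type*} [MeasurableSpace X] [MeasurableSpace A] {d H : ℕ}

theorem measurableSingletonClass_of_diagonal (hA : MeasurableSet (Set.diagonal A)) :
    MeasurableSingletonClass A := by
  refine ⟨fun a => ?_⟩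
  have : MeasurableSet ((fun b : A => (b, a)) ⁻¹' Set.diagonal A) :=
    measurable_prodMk_right hA
  convert this using 1
  ext b
  simp

theorem measurableSet_eq_target (hA : MeasurableSet (Set.diagonal A)) {f : X → A}
    (hf : Measurable f) : MeasurableSet {p : X × A | p.2 = f p.1} :=
  (measurable_snd.prodMk (hf.comp measurable_fst)) hA

theorem measurable_offTarget (hA : MeasurableSet (Set.diagonal A)) {tgt : ℕ → X → A} {h : ℕ}
    (ht : Measurable (tgt h)) : Measurable fun p : X × A => offTarget tgt h p.1 p.2 := by
  classical
  exact Measurable.ite (measurableSet_eq_target hA ht) measurable_const measurable_const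

theorem isPolicyFamily_target {𝒜 : Attack X A d} (ht : ∀ h < H, Measurable (𝒜.target h)) :
    IsPolicyFamily H (fun _ : Unit => 𝒜.targetPolicy) := fun h hh =>
  ⟨Kernel.deterministic (fun p : Unit × X => 𝒜.target h p.2) ((ht h hh).comp measurable_snd),
    inferInstance, fun o s => by rw [Kernel.deterministic_apply]; rfl⟩

theorem value_target_succ [MeasurableSingletonClass A] (P : ℕ → Kernel (X × A) X)
    (r : ℕ → X → A → ℝ) (𝒜 : Attack X A d) (n h : ℕ) (s : X) :
    value P r 𝒜.targetPolicy (n + 1) h s = r h s (𝒜.target h s)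
      + ∫ s', value P r 𝒜.targetPolicy n (h + 1) s' ∂(P h (s, 𝒜.target h s)) := by
  rw [value, Attack.targetPolicy, integral_dirac]

theorem value_target_congr [MeasurableSingletonClass A] (P : ℕ → Kernel (X × A) X)
    {r r' : ℕ → X → A → ℝ} (𝒜 : Attack X A d)
    (hrr : ∀ h s, r h s (𝒜.target h s) = r' h s (𝒜.target h s)) :
    ∀ n h s, value P r 𝒜.targetPolicy n h s = value P r' 𝒜.targetPolicy n h s := by
  intro n
  induction n with
  | zero => intro h s; rfl
  | succ n ih =>
    intro h s
    rw [value_target_succ, value_target_succ, hrr]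
    simp only [ih]

end target

/-! ### Dependence on the past -/

section history

variable {X A : Type*} [MeasurableSpace X] [MeasurableSpace A] {H : ℕ}

theorem measurable_coord (k j : ℕ) : Measurable fun x : Traj X A => x k j :=
  (measurable_pi_apply j).comp (measurable_pi_apply k)

theorem history_le (t h : ℕ) : history X A H t h ≤ (inferInstance : MeasurableSpace (Traj X A)) :=
  sup_le (iSup₂_le fun k _ => iSup₂_le fun j _ => (measurable_coord k j).comap_le)
    (iSup₂_le fun j _ => (measurable_coord t j).comap_le)

theorem historyState_le (t h : ℕ) :
    historyState X A H t h ≤ (inferInstance : MeasurableSpace (Traj X A)) :=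
  sup_le (history_le t h) (measurable_coord t h).fst.comap_le

/-- Two trajectories agree on the stages `j < H` of all episodes before `t`. -/
def AgreeBefore (H t : ℕ) (x y : Traj X A) : Prop := ∀ k < t, ∀ j < H, x k j = y k j

theorem AgreeBefore.mono {X A : Type*} {H t u : ℕ} {x y : Traj X A} (h : AgreeBefore H t x y) (hu : u ≤ t) :
    AgreeBefore H u x y := fun k hk j hj => h k (by omega) j hj

/-- A measurable function that depends only on the coordinates generating `historyState` is
measurable for that σ-algebra: freeze all other coordinates. -/
theorem measurable_historyState {E : Type*} [MeasurableSpace E] {f : Traj X A → E}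
    (hf : Measurable f) {t h : ℕ}
    (hdep : ∀ x y : Traj X A, AgreeBefore H t x y → (∀ j < h, x t j = y t j) →
      (x t h).1 = (y t h).1 → f x = f y) : Measurable[historyState X A H t h] f := by
  classical
  rcases isEmpty_or_nonempty (Traj X A) with he | ⟨⟨x₀⟩⟩
  · intro s _
    rw [Set.eq_empty_of_isEmpty (f ⁻¹' s)]
    exact @MeasurableSet.empty _ (historyState X A H t h)
  set p : Traj X A → Traj X A := fun x k j =>
    if (k < t ∧ j < H) ∨ (k = t ∧ j < h) then x k j
    else if k = t ∧ j = h then ((x t h).1, (x₀ t h).2) else x₀ k j with hp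
  have hfp : f = f ∘ p := by
    funext x
    refine hdep _ _ (fun k hk j hj => ?_) (fun j hj => ?_) ?_
    · simp [hp, hk, hj]
    · simp [hp, hj]
    · by_cases hh : h < H <;> simp [hp]
  have hpm : Measurable[historyState X A H t h] p := by
    refine @measurable_pi_iff _ _ _ (historyState X A H t h) _ p |>.2 fun k => ?_
    refine @measurable_pi_iff _ _ _ (historyState X A H t h) _ (fun x => p x k) |>.2 fun j => ?_
    simp only [hp]
    split_ifs with h1 h2
    · refine Measurable.of_comap_le ?_
      rcases h1 with ⟨hk, hj⟩ | ⟨rfl, hj⟩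
      · refine le_sup_of_le_left (le_sup_of_le_left ?_)
        exact le_iSup₂_of_le k hk (le_iSup₂_of_le (f := fun j (_ : j < H) =>
          MeasurableSpace.comap (fun x : Traj X A => x k j) inferInstance) j hj le_rfl)
      · refine le_sup_of_le_left (le_sup_of_le_right ?_)
        exact le_iSup₂_of_le (f := fun j (_ : j < h) =>
          MeasurableSpace.comap (fun x : Traj X A => x k j) inferInstance) j hj le_rfl
    · refine Measurable.prodMk ?_ measurable_const
      exact Measurable.of_comap_le le_sup_right
    · exact measurable_const
  rw [hfp]
  exact hf.comp hpm

theorem historyState_le_history_succ (t h : ℕ) : historyState X A H t h ≤ history X A H t (h + 1) := by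
  refine sup_le (sup_le le_sup_left (le_sup_of_le_right ?_)) (le_sup_of_le_right ?_)
  · refine iSup₂_le fun j hj => ?_
    exact le_iSup₂_of_le (f := fun j (_ : j < h + 1) =>
      MeasurableSpace.comap (fun x : Traj X A => x t j) inferInstance) j (by omega) le_rfl
  · refine le_trans ?_ (le_iSup₂_of_le (f := fun j (_ : j < h + 1) =>
      MeasurableSpace.comap (fun x : Traj X A => x t j) inferInstance) h (by omega) le_rfl)
    have h1 : (fun x : Traj X A => (x t h).1) = Prod.fst ∘ fun x : Traj X A => x t h := rfl
    rw [h1, ← MeasurableSpace.comap_comp]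
    exact MeasurableSpace.comap_mono measurable_fst.comap_le

theorem measurable_coord_history (t h : ℕ) :
    Measurable[history X A H t (h + 1)] fun x : Traj X A => x t h :=
  Measurable.of_comap_le (le_sup_of_le_right (le_iSup₂_of_le (f := fun j (_ : j < h + 1) =>
      MeasurableSpace.comap (fun x : Traj X A => x t j) inferInstance) h (by omega) le_rfl))

theorem measurable_state_historyState (t h : ℕ) :
    Measurable[historyState X A H t h] fun x : Traj X A => (x t h).1 :=
  Measurable.of_comap_le le_sup_right

theorem history_le_historyState (t h : ℕ) : history X A H t h ≤ historyState X A H t h :=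
  le_sup_left

end history

section predictable

variable {X A : Type*} [MeasurableSpace X] [MeasurableSpace A] {d H : ℕ}
  (𝒜 : Attack X A d) (M : LinearMDP X A d H) {x y : Traj X A} {t : ℕ}

theorem gram_congr {lam : ℝ} {I : Finset ℕ} {f f' : ℕ → Vec d} (hf : ∀ k ∈ I, f k = f' k) :
    gram lam I f = gram lam I f' := by
  unfold gram
  rw [Finset.sum_congr rfl fun k hk => by rw [hf k hk]]

theorem ridge_congr {lam : ℝ} {I : Finset ℕ} {f f' : ℕ → Vec d} {y y' : ℕ → ℝ}
    (hf : ∀ k ∈ I, f k = f' k) (hy : ∀ k ∈ I, y k = y' k) :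
    ridge lam I f y = ridge lam I f' y' := by
  unfold ridge
  rw [gram_congr hf, Finset.sum_congr rfl fun k hk => by rw [hf k hk, hy k hk]]

theorem design1_congr (hxy : AgreeBefore H t x y) {h : ℕ} (hh : h < H) :
    𝒜.design1 M x h t = 𝒜.design1 M y h t :=
  gram_congr fun k hk => by rw [hxy k (Finset.mem_range.1 hk) h hh]

theorem bhat_congr (hxy : AgreeBefore H t x y) {h : ℕ} (hh : h < H) :
    𝒜.bhat M x h t = 𝒜.bhat M y h t := by
  refine ridge_congr (fun k hk => by rw [hxy k (Finset.mem_range.1 hk) h hh]) fun k hk => ?_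
  by_cases h1 : h + 1 < H
  · rw [hxy k (Finset.mem_range.1 hk) (h + 1) h1]
  · -- after the last stage the surrogate value vanishes
    simp [Attack.v, Attack.q, h1]

theorem gamma1_congr (hxy : AgreeBefore H t x y) : 𝒜.gamma1 M x t = 𝒜.gamma1 M y t := by
  unfold Attack.gamma1
  congr 1
  funext h
  congr 2
  refine Finset.sum_congr rfl fun j hj => ?_
  unfold Attack.Ubar
  rw [design1_congr 𝒜 M hxy (by have := Finset.mem_Ico.1 hj; omega)]

theorem freeze_le (x : Traj X A) (t : ℕ) : 𝒜.freeze M x t ≤ t := Nat.sInf_le (Or.inl rfl)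

theorem freeze_congr (hxy : AgreeBefore H t x y) : 𝒜.freeze M x t = 𝒜.freeze M y t := by
  unfold Attack.freeze
  congr 1
  ext k
  simp only [Set.mem_ofPred_eq]
  refine or_congr_right (and_congr_right fun hk => ?_)
  rw [gamma1_congr 𝒜 M (hxy.mono hk.le)]

theorem steer_congr (hxy : AgreeBefore H t x y) {h : ℕ} (hh : h < H) (s : X) (a : A) :
    𝒜.steer M x t h s a = 𝒜.steer M y t h s a := by
  unfold Attack.steer
  rw [freeze_congr 𝒜 M hxy, bhat_congr 𝒜 M (hxy.mono (freeze_le 𝒜 M y t)) hh]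

theorem certified_congr (hxy : AgreeBefore H 𝒜.T₁ x y) : 𝒜.Certified M x ↔ 𝒜.Certified M y := by
  unfold Attack.Certified
  refine exists_congr fun k => and_congr_right fun hk => ?_
  rw [gamma1_congr 𝒜 M (hxy.mono hk.le)]

theorem tauFix_congr (hxy : AgreeBefore H 𝒜.T₁ x y) : 𝒜.tauFix M x = 𝒜.tauFix M y := by
  unfold Attack.tauFix
  congr 1
  ext k
  simp only [Set.mem_ofPred_eq]
  refine and_congr_right fun hk => ?_
  rw [gamma1_congr 𝒜 M (hxy.mono hk.le)]

theorem mem_clean {k : ℕ} : k ∈ 𝒜.clean M x ↔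
    k < 𝒜.T₁ ∧ 𝒜.tauFix M x ≤ k ∧ ∀ h < H, ¬ 𝒜.Deviates x k h := by
  simp [Attack.clean]

theorem clean_congr (hxy : AgreeBefore H 𝒜.T₁ x y) : 𝒜.clean M x = 𝒜.clean M y := by
  ext k
  rw [mem_clean, mem_clean, tauFix_congr 𝒜 M hxy]
  refine and_congr_right fun hk => and_congr_right fun _ => forall₂_congr fun h hh => ?_
  unfold Attack.Deviates
  rw [hxy k hk h hh]

theorem mem_clean_lt {k : ℕ} (hk : k ∈ 𝒜.clean M x) : k < 𝒜.T₁ := ((mem_clean 𝒜 M).1 hk).1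

theorem design2_congr (hxy : AgreeBefore H 𝒜.T₁ x y) {h : ℕ} (hh : h < H) :
    𝒜.design2 M x h = 𝒜.design2 M y h := by
  unfold Attack.design2
  rw [clean_congr 𝒜 M hxy]
  exact gram_congr fun k hk => by rw [hxy k (mem_clean_lt 𝒜 M hk) h hh]

theorem what_congr (hxy : AgreeBefore H 𝒜.T₁ x y) {h : ℕ} (hh : h < H) :
    𝒜.what M x h = 𝒜.what M y h := by
  unfold Attack.what
  rw [clean_congr 𝒜 M hxy]
  refine ridge_congr (fun k hk => by rw [hxy k (mem_clean_lt 𝒜 M hk) h hh]) fun k hk => ?_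
  refine Finset.sum_congr rfl fun j hj => ?_
  rw [hxy k (mem_clean_lt 𝒜 M hk) j (Finset.mem_Ico.1 hj).2]

theorem feasible_congr (hxy : AgreeBefore H 𝒜.T₁ x y) (ε : ℝ) (u : ℕ → Vec d) :
    𝒜.Feasible M x ε u ↔ 𝒜.Feasible M y ε u := by
  unfold Attack.Feasible
  refine forall₂_congr fun h hh => ?_
  have hg : ∀ s a, 𝒜.g M x h s a = 𝒜.g M y h s a := fun s a => by
    unfold Attack.g Attack.Qhat
    rw [what_congr 𝒜 M hxy hh, design2_congr 𝒜 M hxy hh]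
  simp only [hg]

theorem eps2_congr (hxy : AgreeBefore H 𝒜.T₁ x y) : 𝒜.eps2 M x = 𝒜.eps2 M y := by
  unfold Attack.eps2
  simp only [feasible_congr 𝒜 M hxy]

/-- The fed reward is determined by the past and the current state-action pair. -/
theorem fed_congr (h𝒜 : 𝒜.IsValid M) (hxy : AgreeBefore H t x y) {h : ℕ} (hh : h < H)
    (hcur : ∀ j ≤ h, x t j = y t j) : 𝒜.fed M x t h = 𝒜.fed M y t h := by
  have e := hcur h le_rfl
  unfold Attack.fed
  by_cases ht : t < 𝒜.T₁
  · rw [if_pos ht, if_pos ht, e, steer_congr 𝒜 M hxy hh]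
  · have hxy1 : AgreeBefore H 𝒜.T₁ x y := hxy.mono (by omega)
    have hu : 𝒜.u x = 𝒜.u y := h𝒜.u_stage1 x y hxy1
    have hc : 𝒜.c x t h = 𝒜.c y t h :=
      h𝒜.c_predictable t h x y hxy (fun j hj => hcur j hj.le) (by rw [e])
    have hr : ∀ s a, 𝒜.rbar M x h s a = 𝒜.rbar M y h s a := fun s a => by
      unfold Attack.rbar
      rw [hu]
    rw [if_neg ht, if_neg ht, hc]
    have hiff : (𝒜.Certified M x ∧ 0 < 𝒜.eps2 M x) ↔ (𝒜.Certified M y ∧ 0 < 𝒜.eps2 M y) := by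
      rw [certified_congr 𝒜 M hxy1, eps2_congr 𝒜 M hxy1]
    classical
    refine if_congr hiff (if_congr (by rw [e]) (by rw [e]) (by rw [hr, e])) (by rw [e])

theorem observed_congr (h𝒜 : 𝒜.IsValid M) (hxy : AgreeBefore H t x y) :
    observed 𝒜 M x t = observed 𝒜 M y t := by
  funext k h
  unfold observed
  rw [hxy k k.2 h h.2, fed_congr 𝒜 M h𝒜 (hxy.mono k.2.le) h.2
    fun j hj => hxy k k.2 j (lt_of_le_of_lt hj h.2)]

theorem measurable_observed (h𝒜 : 𝒜.IsValid M) (t : ℕ) :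
    Measurable fun x : Traj X A => observed 𝒜 M x t :=
  measurable_pi_iff.2 fun k => measurable_pi_iff.2 fun h =>
    (measurable_coord k h).prodMk (h𝒜.measurable_fed k h h.2)

theorem measurable_observed_historyState (h𝒜 : 𝒜.IsValid M) {k : ℕ} (hk : k ≤ t) (h : ℕ) :
    Measurable[historyState X A H t h] fun x : Traj X A => observed 𝒜 M x k :=
  measurable_historyState (measurable_observed 𝒜 M h𝒜 k) fun _ _ hxy _ _ =>
    observed_congr 𝒜 M h𝒜 (hxy.mono hk)

end predictable

/-! ### Conditional means along the interaction -/

section interaction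

variable {X A : Type*} [MeasurableSpace X] [MeasurableSpace A] {d H T : ℕ}
  {M : LinearMDP X A d H} {𝒜 : Attack X A d} {L : Learner X A H} {μ : Measure (Traj X A)}

/-- The transition step of the tower rule, with a parameter `g` known before the transition. -/
theorem integral_step [IsProbabilityMeasure μ] (hint : IsInteraction M 𝒜 L T μ) {t h : ℕ}
    (ht : t < T) (hh : h + 1 < H) {E : Type*} [MeasurableSpace E] {g : Traj X A → E}
    (hg : Measurable[history X A H t (h + 1)] g) {f : E × X → ℝ} (hf : Measurable f)
    (hfi : Integrable (fun x => f (g x, (x t (h + 1)).1)) μ) :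
    ∫ x, f (g x, (x t (h + 1)).1) ∂μ = ∫ x, ∫ s', f (g x, s') ∂(M.P h (x t h)) ∂μ := by
  have := M.markov_P h
  exact integral_of_condLaw (history_le t (h + 1))
    (g := fun x : Traj X A => (g x, x t h)) (hg.prodMk (measurable_coord_history t h))
    (measurable_coord t (h + 1)).fst ((M.P h).comap Prod.snd measurable_snd)
    (hint.step t ht h hh)
    (f := fun p : (E × (X × A)) × X => f (p.1.1, p.2)) (by fun_prop) hfi

/-- The action step of the tower rule, with a parameter `g` known before the action. -/
theorem integral_act [IsProbabilityMeasure μ] (hL : ∀ t h, IsMarkovKernel (L t h))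
    (h𝒜 : 𝒜.IsValid M) (hint : IsInteraction M 𝒜 L T μ) {t h : ℕ}
    (ht : t < T) (hh : h < H) {E : Type*} [MeasurableSpace E] {g : Traj X A → E}
    (hg : Measurable[historyState X A H t h] g) {f : E × A → ℝ} (hf : Measurable f)
    (hfi : Integrable (fun x => f (g x, (x t h).2)) μ) :
    ∫ x, f (g x, (x t h).2) ∂μ
      = ∫ x, ∫ a, f (g x, a) ∂(policy L 𝒜 M x t h (x t h).1) ∂μ := by
  have := hL t h
  exact integral_of_condLaw (historyState_le t h)
    (g := fun x : Traj X A => (g x, (observed 𝒜 M x t, (x t h).1)))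
    (hg.prodMk ((measurable_observed_historyState 𝒜 M h𝒜 le_rfl h).prodMk
      (measurable_state_historyState t h)))
    (measurable_coord t h).snd ((L t h).comap Prod.snd measurable_snd)
    (hint.act t ht h hh)
    (f := fun p : (E × _) × A => f (p.1.1, p.2)) (by fun_prop) hfi

theorem ae_mem_of_condProb_eq_one {Ω : Type*} {m m0 : MeasurableSpace Ω} {μ : Measure Ω}
    [IsProbabilityMeasure μ] (hm : m ≤ m0) {S : Set Ω} (hS : MeasurableSet[m0] S)
    (h : μ⟦S | m⟧ =ᵐ[μ] fun _ => (1 : ℝ)) : ∀ᵐ x ∂μ, x ∈ S := by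
  have h1 := integral_condExp hm (μ := μ) (f := S.indicator fun _ => (1 : ℝ))
  rw [integral_congr_ae h, integral_indicator_const _ hS] at h1
  simp only [integral_const, probReal_univ, smul_eq_mul, mul_one] at h1
  refine (prob_compl_eq_zero_iff hS).2 ?_
  rw [← ofReal_measureReal, ← h1, ENNReal.ofReal_one]

/-- The learner never leaves the certified support. -/
theorem ae_mem_supp [IsProbabilityMeasure μ] (h𝒜 : 𝒜.IsValid M) (hint : IsInteraction M 𝒜 L T μ)
    {t : ℕ} (ht : t < T) : ∀ h < H, ∀ᵐ x ∂μ, (x t h).1 ∈ 𝒜.supp h := by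
  intro h
  induction h with
  | zero =>
    intro hh
    refine ae_mem_of_condProb_eq_one (history_le (H := H) t 0)
      ((measurable_coord t 0).fst (h𝒜.measurable_supp 0 hh)) ?_
    refine (hint.init t ht _ (h𝒜.measurable_supp 0 hh)).trans (ae_of_all _ fun _ => ?_)
    have := M.prob_ρ
    have h2 : M.ρ (𝒜.supp 0) = 1 := (prob_compl_eq_zero_iff (h𝒜.measurable_supp 0 hh)).1 h𝒜.init_supp
    simp [Measure.real, h2]
  | succ h ih =>
    intro hh
    refine ae_mem_of_condProb_eq_one (history_le (H := H) t (h + 1))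
      ((measurable_coord t (h + 1)).fst (h𝒜.measurable_supp (h + 1) hh)) ?_
    refine (hint.step t ht h hh _ (h𝒜.measurable_supp (h + 1) hh)).trans ?_
    filter_upwards [ih (by omega)] with x hx
    have := M.markov_P h
    have h2 : M.P h (x t h) (𝒜.supp (h + 1)) = 1 :=
      (prob_compl_eq_zero_iff (h𝒜.measurable_supp (h + 1) hh)).1
        (h𝒜.closed_supp h hh _ hx (x t h).2)
    simp [Measure.real, h2]

theorem integrable_of_abs_le {Ω : Type*} {m0 : MeasurableSpace Ω} {μ : Measure Ω}
    [IsProbabilityMeasure μ] {f : Ω → ℝ} (hf : Measurable f) {C : ℝ} (hC : ∀ ω, |f ω| ≤ C) :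
    Integrable f μ :=
  (integrable_const C).mono' hf.aestronglyMeasurable (ae_of_all _ hC)

theorem abs_mul_le_of_abs_le {a b C c : ℝ} (ha : |a| ≤ C) (hb : |b| ≤ c) : |a * b| ≤ C * c := by
  rw [abs_mul]
  exact mul_le_mul ha hb (abs_nonneg _) ((abs_nonneg _).trans ha)

theorem measurable_reward {h : ℕ} (hh : h < H) : Measurable fun p : X × A => M.reward h p.1 p.2 :=
  (M.measurable_φ h hh).inner measurable_const

theorem abs_reward_le {h : ℕ} (hh : h < H) (s : X) (a : A) : |M.reward h s a| ≤ 1 := by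
  have := M.reward_mem h hh s a
  rw [abs_le]
  exact ⟨by linarith [this.1, show M.reward h s a = ⟪M.φ h s a, M.θ h⟫ from rfl], this.2⟩

/-- The value of the target policy under the clean reward, with `n` steps to go. -/
noncomputable def targetValue (𝒜 : Attack X A d) (M : LinearMDP X A d H) (n h : ℕ) (s : X) : ℝ :=
  value M.P M.reward 𝒜.targetPolicy n h s

theorem targetValue_mem_Icc (h𝒜 : 𝒜.IsValid M) {n h : ℕ} (hn : h + n ≤ H) (s : X) :
    targetValue 𝒜 M n h s ∈ Set.Icc (0 : ℝ) n :=
  ⟨value_nonneg (fun j hj s a => (M.reward_mem j hj s a).1) _ n h hn s,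
    (le_abs_self _).trans (abs_value_le M.markov_P (fun _ hh s a => abs_reward_le hh s a)
      (isPolicyFamily_target h𝒜.measurable_target) () n h hn s)⟩

theorem measurable_targetValue (h𝒜 : 𝒜.IsValid M) {n h : ℕ} (hn : h + n ≤ H) :
    Measurable (targetValue 𝒜 M n h) :=
  measurable_value_apply M.markov_P (fun _ hh => measurable_reward hh)
    (isPolicyFamily_target h𝒜.measurable_target) () hn

open Classical in
/-- The return of an episode `e` from stage `h` on, where at the first non-target action the rest of
the episode is replaced by the value of the target policy. -/
noncomputable def stoppedReturn (𝒜 : Attack X A d) (M : LinearMDP X A d H) :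
    ℕ → ℕ → (ℕ → X × A) → ℝ
  | 0, _, _ => 0
  | n + 1, h, e =>
    if (e h).2 = 𝒜.target h (e h).1 then
      M.reward h (e h).1 (𝒜.target h (e h).1) + stoppedReturn 𝒜 M n (h + 1) e
    else targetValue 𝒜 M (n + 1) h (e h).1

/-- The noise of the stopped return around the value of the target policy. -/
noncomputable def residual (𝒜 : Attack X A d) (M : LinearMDP X A d H) (n h : ℕ) (e : ℕ → X × A) :
    ℝ :=
  stoppedReturn 𝒜 M n h e - targetValue 𝒜 M n h (e h).1

open Classical in
theorem stoppedReturn_succ (n h : ℕ) (e : ℕ → X × A) :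
    stoppedReturn 𝒜 M (n + 1) h e = if (e h).2 = 𝒜.target h (e h).1 then
      M.reward h (e h).1 (𝒜.target h (e h).1) + stoppedReturn 𝒜 M n (h + 1) e
    else targetValue 𝒜 M (n + 1) h (e h).1 := rfl

theorem stoppedReturn_mem_Icc (h𝒜 : 𝒜.IsValid M) (e : ℕ → X × A) :
    ∀ n h, h + n ≤ H → stoppedReturn 𝒜 M n h e ∈ Set.Icc (0 : ℝ) n := by
  intro n
  induction n with
  | zero => intro h _; simp [stoppedReturn]
  | succ n ih =>
    intro h hh
    rw [stoppedReturn_succ]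
    split_ifs
    · have h1 : 0 ≤ M.reward h (e h).1 (𝒜.target h (e h).1) ∧
          M.reward h (e h).1 (𝒜.target h (e h).1) ≤ 1 := M.reward_mem h (by omega) _ _
      have h2 := ih (h + 1) (by omega)
      push_cast
      exact ⟨by linarith [h2.1], by linarith [h2.2]⟩
    · exact targetValue_mem_Icc h𝒜 hh _

theorem abs_residual_le (h𝒜 : 𝒜.IsValid M) (e : ℕ → X × A) {n h : ℕ} (hn : h + n ≤ H) :
    |residual 𝒜 M n h e| ≤ n := by
  have h1 := stoppedReturn_mem_Icc h𝒜 e n h hn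
  have h2 := targetValue_mem_Icc h𝒜 hn (e h).1
  unfold residual
  rw [abs_le]
  constructor <;> linarith [h1.1, h1.2, h2.1, h2.2]

theorem measurable_stoppedReturn (hA : MeasurableSet (Set.diagonal A)) (h𝒜 : 𝒜.IsValid M) :
    ∀ n h, h + n ≤ H → Measurable (stoppedReturn 𝒜 M n h) := by
  intro n
  induction n with
  | zero => intro h _; exact measurable_const
  | succ n ih =>
    intro h hh
    have hc : Measurable fun e : ℕ → X × A => e h := measurable_pi_apply h
    have ht := h𝒜.measurable_target h (by omega)
    classical
    refine Measurable.ite (hc (measurableSet_eq_target hA ht))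
      (Measurable.add ?_ (ih (h + 1) (by omega))) ((measurable_targetValue h𝒜 hh).comp hc.fst)
    exact (measurable_reward (M := M) (h := h) (by omega)).comp
      (hc.fst.prodMk (ht.comp hc.fst))

theorem measurable_residual (hA : MeasurableSet (Set.diagonal A)) (h𝒜 : 𝒜.IsValid M) {n h : ℕ}
    (hn : h + n ≤ H) : Measurable (residual 𝒜 M n h) :=
  (measurable_stoppedReturn hA h𝒜 n h hn).sub
    ((measurable_targetValue h𝒜 hn).comp (measurable_pi_apply h).fst)

theorem stoppedReturn_congr {e e' : ℕ → X × A} : ∀ n h, (∀ j, h ≤ j → j < h + n → e j = e' j) →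
    stoppedReturn 𝒜 M n h e = stoppedReturn 𝒜 M n h e' := by
  intro n
  induction n with
  | zero => intro h _; rfl
  | succ n ih =>
    intro h hh
    rw [stoppedReturn_succ, stoppedReturn_succ, hh h le_rfl (by omega), ih (h + 1) fun j hj hj' => hh j (by omega) (by omega)]

/-- The stopped return of an episode without non-target actions is its Monte Carlo return. -/
theorem stoppedReturn_eq_sum {e : ℕ → X × A} : ∀ n h, h + n = H →
    (∀ j, h ≤ j → j < H → (e j).2 = 𝒜.target j (e j).1) →
    stoppedReturn 𝒜 M n h e = ∑ j ∈ Finset.Ico h H, M.reward j (e j).1 (𝒜.target j (e j).1) := by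
  intro n
  induction n with
  | zero => intro h hh _; simp [stoppedReturn, show H ≤ h by omega]
  | succ n ih =>
    intro h hh htgt
    rw [stoppedReturn_succ, if_pos (htgt h le_rfl (by omega)), Finset.sum_eq_sum_Ico_succ_bot (by omega),
      ih (h + 1) (by omega) fun j hj hj' => htgt j (by omega) hj']

/-- The residual has conditional mean zero given the state at its first stage: it is a sum of
transition noises, each switched off after the first non-target action. -/
theorem integral_mul_residual [IsProbabilityMeasure μ] (hA : MeasurableSet (Set.diagonal A))
    (h𝒜 : 𝒜.IsValid M) (hint : IsInteraction M 𝒜 L T μ) {t : ℕ} (ht : t < T) :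
    ∀ n h, h + n = H → ∀ W : Traj X A → ℝ, Measurable[historyState X A H t h] W →
      (∃ C, ∀ x, |W x| ≤ C) → ∫ x, W x * residual 𝒜 M n h (x t) ∂μ = 0 := by
  classical
  have := measurableSingletonClass_of_diagonal hA
  intro n
  induction n with
  | zero =>
    intro h _ W _ _
    simp [residual, stoppedReturn, targetValue, value]
  | succ n ih =>
    intro h hh W hW ⟨C, hC⟩
    have hep : Measurable fun x : Traj X A => x t := measurable_pi_apply t
    set W' : Traj X A → ℝ := fun x =>
      W x * (1 - offTarget 𝒜.target h (x t h).1 (x t h).2) with hW'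
    have hW'm : Measurable[history X A H t (h + 1)] W' := by
      refine (hW.mono (historyState_le_history_succ t h) le_rfl).mul (measurable_const.sub ?_)
      exact (measurable_offTarget hA (h𝒜.measurable_target h (by omega))).comp
        (measurable_coord_history t h)
    have hW'0 : Measurable W' := hW'm.mono (history_le t (h + 1)) le_rfl
    have hW'b : ∀ x, |W' x| ≤ C := by
      intro x
      have h1 := offTarget_nonneg 𝒜.target h (x t h).1 (x t h).2
      have h2 := offTarget_le_one 𝒜.target h (x t h).1 (x t h).2
      have := abs_mul_le_of_abs_le (hC x)
        (show |1 - offTarget 𝒜.target h (x t h).1 (x t h).2| ≤ 1 by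
          rw [abs_le]; constructor <;> linarith)
      simpa [hW'] using this
    have hdec : ∀ x, W x * residual 𝒜 M (n + 1) h (x t) =
        W' x * residual 𝒜 M n (h + 1) (x t) +
          (W' x * targetValue 𝒜 M n (h + 1) (x t (h + 1)).1 -
            W' x * ∫ s', targetValue 𝒜 M n (h + 1) s' ∂(M.P h (x t h))) := by
      intro x
      unfold residual
      rw [stoppedReturn_succ]
      by_cases hx : (x t h).2 = 𝒜.target h (x t h).1
      · have h1 : targetValue 𝒜 M (n + 1) h (x t h).1 = M.reward h (x t h).1 (𝒜.target h (x t h).1)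
            + ∫ s', targetValue 𝒜 M n (h + 1) s' ∂(M.P h (x t h)) := by
          have h2 : x t h = ((x t h).1, 𝒜.target h (x t h).1) := by rw [← hx]
          unfold targetValue
          rw [value_target_succ, ← h2]
        rw [if_pos hx, h1]
        simp only [hW', offTarget, if_pos hx]
        ring
      · rw [if_neg hx]
        simp [hW', offTarget, if_neg hx]
    have hVm := measurable_targetValue h𝒜 (n := n) (h := h + 1) (by omega)
    have hVb : ∀ s, |targetValue 𝒜 M n (h + 1) s| ≤ n := fun s => by
      have := targetValue_mem_Icc h𝒜 (n := n) (h := h + 1) (by omega) s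
      rw [abs_of_nonneg this.1]; exact this.2
    have hPm := M.markov_P h
    have hIb : ∀ x : Traj X A, |∫ s', targetValue 𝒜 M n (h + 1) s' ∂(M.P h (x t h))| ≤ n := by
      intro x
      have := norm_integral_le_of_norm_le_const (μ := M.P h (x t h)) (C := (n : ℝ))
        (f := targetValue 𝒜 M n (h + 1)) (ae_of_all _ hVb)
      rwa [probReal_univ, mul_one] at this
    have hIm : Measurable fun x : Traj X A =>
        ∫ s', targetValue 𝒜 M n (h + 1) s' ∂(M.P h (x t h)) :=
      measurable_integral_transition (M.P h) (f := fun p : Traj X A × X => _)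
        (hVm.comp measurable_snd) (measurable_coord t h)
    have i1 : Integrable (fun x => W' x * residual 𝒜 M n (h + 1) (x t)) μ :=
      integrable_of_abs_le (hW'0.mul ((measurable_residual hA h𝒜 (by omega)).comp hep))
        fun x => abs_mul_le_of_abs_le (hW'b x) (abs_residual_le h𝒜 (x t) (by omega))
    have i2 : Integrable (fun x => W' x * targetValue 𝒜 M n (h + 1) (x t (h + 1)).1) μ :=
      integrable_of_abs_le (hW'0.mul (hVm.comp (measurable_coord t (h + 1)).fst))
        fun x => abs_mul_le_of_abs_le (hW'b x) (hVb _)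
    have i3 : Integrable
        (fun x => W' x * ∫ s', targetValue 𝒜 M n (h + 1) s' ∂(M.P h (x t h))) μ :=
      integrable_of_abs_le (hW'0.mul hIm) fun x => abs_mul_le_of_abs_le (hW'b x) (hIb x)
    have i23 : Integrable (fun x => W' x * targetValue 𝒜 M n (h + 1) (x t (h + 1)).1 -
        W' x * ∫ s', targetValue 𝒜 M n (h + 1) s' ∂(M.P h (x t h))) μ := i2.sub i3
    simp only [hdec]
    rw [integral_add i1 i23, integral_sub i2 i3,
      ih (h + 1) (by omega) W' (hW'm.mono (history_le_historyState t (h + 1)) le_rfl) ⟨C, hW'b⟩,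
      zero_add, sub_eq_zero]
    rcases Nat.eq_zero_or_pos n with rfl | hn
    · simp [targetValue, value]
    · have := integral_step hint ht (show h + 1 < H by omega) (g := W') hW'm
        (f := fun p : ℝ × X => p.1 * targetValue 𝒜 M n (h + 1) p.2)
        (measurable_fst.mul (hVm.comp measurable_snd)) i2
      rw [this]
      simp only [integral_const_mul]

theorem isPolicyFamily_learner (hL : ∀ t h, IsMarkovKernel (L t h)) (t : ℕ) :
    IsPolicyFamily H (fun (o : Fin t → Fin H → (X × A) × ℝ) h s => L t h (o, s)) :=
  fun h _ => ⟨L t h, hL t h, fun _ _ => rfl⟩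

/-- The expected number of non-target actions in the last `n` stages of episode `t`, given the data
`o` and the state `s`. -/
noncomputable def devValue (𝒜 : Attack X A d) (M : LinearMDP X A d H) (L : Learner X A H)
    (t n h : ℕ) (o : Fin t → Fin H → (X × A) × ℝ) (s : X) : ℝ :=
  value M.P (offTarget 𝒜.target) (fun h s => L t h (o, s)) n h s

theorem measurable_devValue (hA : MeasurableSet (Set.diagonal A)) (h𝒜 : 𝒜.IsValid M)
    (hL : ∀ t h, IsMarkovKernel (L t h)) {t n h : ℕ} (hn : h + n ≤ H) :
    Measurable fun p : (Fin t → Fin H → (X × A) × ℝ) × X => devValue 𝒜 M L t n h p.1 p.2 :=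
  measurable_value M.markov_P
    (fun h hh => measurable_offTarget hA (h𝒜.measurable_target h hh))
    (isPolicyFamily_learner hL t) n h hn

theorem abs_offTarget_le {X A : Type*} (tgt : ℕ → X → A) (h : ℕ) (s : X) (a : A) : |offTarget tgt h s a| ≤ 1 := by
  rw [abs_of_nonneg (offTarget_nonneg _ _ _ _)]
  exact offTarget_le_one _ _ _ _

theorem devValue_nonneg {t n h : ℕ} (hn : h + n ≤ H) (o : Fin t → Fin H → (X × A) × ℝ) (s : X) :
    0 ≤ devValue 𝒜 M L t n h o s :=
  value_nonneg (fun _ _ _ _ => offTarget_nonneg _ _ _ _) _ n h hn s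

theorem abs_devValue_le (hL : ∀ t h, IsMarkovKernel (L t h)) {t n h : ℕ}
    (hn : h + n ≤ H) (o : Fin t → Fin H → (X × A) × ℝ) (s : X) :
    |devValue 𝒜 M L t n h o s| ≤ n :=
  abs_value_le M.markov_P (fun _ _ _ _ => abs_offTarget_le _ _ _ _) (isPolicyFamily_learner hL t)
    o n h hn s

/-- The number of non-target actions in the stages `h ≤ j < H` of an episode. -/
noncomputable def devCount {X A : Type*} {d : ℕ} (𝒜 : Attack X A d) (H h : ℕ) (e : ℕ → X × A) : ℝ :=
  ∑ j ∈ Finset.Ico h H, offTarget 𝒜.target j (e j).1 (e j).2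

theorem devCount_nonneg {X A : Type*} {d H : ℕ} {𝒜 : Attack X A d} (h : ℕ) (e : ℕ → X × A) : 0 ≤ devCount 𝒜 H h e :=
  Finset.sum_nonneg fun _ _ => offTarget_nonneg _ _ _ _

theorem devCount_le {X A : Type*} {d H : ℕ} {𝒜 : Attack X A d} (h : ℕ) (e : ℕ → X × A) : devCount 𝒜 H h e ≤ H := by
  refine (Finset.sum_le_card_nsmul _ _ 1 fun _ _ => offTarget_le_one _ _ _ _).trans ?_
  simp

theorem measurable_devCount (hA : MeasurableSet (Set.diagonal A)) (h𝒜 : 𝒜.IsValid M) (h : ℕ) :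
    Measurable (devCount 𝒜 H h) :=
  Finset.measurable_sum _ fun j hj =>
    (measurable_offTarget hA (h𝒜.measurable_target j (Finset.mem_Ico.1 hj).2)).comp
      (measurable_pi_apply j)

/-- The conditional mean of the number of non-target actions is its value under the learner's
policy. -/
theorem integral_mul_devCount [IsProbabilityMeasure μ] (hA : MeasurableSet (Set.diagonal A))
    (hL : ∀ t h, IsMarkovKernel (L t h))
    (h𝒜 : 𝒜.IsValid M) (hint : IsInteraction M 𝒜 L T μ) {t : ℕ} (ht : t < T) :
    ∀ n h, h + n = H → ∀ W : Traj X A → ℝ, Measurable[historyState X A H t h] W →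
      (∃ C, ∀ x, |W x| ≤ C) → ∫ x, W x * devCount 𝒜 H h (x t) ∂μ
        = ∫ x, W x * devValue 𝒜 M L t n h (observed 𝒜 M x t) (x t h).1 ∂μ := by
  intro n
  induction n with
  | zero =>
    intro h hh W _ _
    simp [devCount, show H ≤ h by omega, devValue, value]
  | succ n ih =>
    intro h hh W hW ⟨C, hC⟩
    have hh' : h < H := by omega
    have hPm := M.markov_P h
    have hep : Measurable fun x : Traj X A => x t := measurable_pi_apply t
    have hW0 : Measurable W := hW.mono (historyState_le t h) le_rfl
    have hoff := measurable_offTarget hA (h𝒜.measurable_target h hh')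
    have hobs := measurable_observed 𝒜 M h𝒜 t
    have hU := measurable_devValue (L := L) (t := t) (n := n) (h := h + 1) hA h𝒜 hL (by omega)
    have hUb := fun o s => abs_devValue_le (M := M) (𝒜 := 𝒜) (L := L) (t := t) (n := n)
      (h := h + 1) hL (by omega) o s
    -- the lookahead of the count at stage `h`, as a function of data, state and action
    set Φ : (Fin t → Fin H → (X × A) × ℝ) → X × A → ℝ := fun o p =>
      ∫ s', devValue 𝒜 M L t n (h + 1) o s' ∂(M.P h p) with hΦ
    have hΦm : Measurable fun q : (Fin t → Fin H → (X × A) × ℝ) × (X × A) => Φ q.1 q.2 :=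
      measurable_integral_transition (M.P h)
        (f := fun r : ((Fin t → Fin H → (X × A) × ℝ) × (X × A)) × X =>
          devValue 𝒜 M L t n (h + 1) r.1.1 r.2)
        (hU.comp (measurable_fst.fst.prodMk measurable_snd)) measurable_snd
    have hΦb : ∀ o p, |Φ o p| ≤ n := by
      intro o p
      have := norm_integral_le_of_norm_le_const (μ := M.P h p) (C := (n : ℝ))
        (f := fun s' => devValue 𝒜 M L t n (h + 1) o s') (ae_of_all _ (hUb o))
      rwa [probReal_univ, mul_one] at this
    have i1 : Integrable (fun x => W x * offTarget 𝒜.target h (x t h).1 (x t h).2) μ :=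
      integrable_of_abs_le (hW0.mul (hoff.comp (measurable_coord t h)))
        fun x => abs_mul_le_of_abs_le (hC x) (abs_offTarget_le _ _ _ _)
    have i2 : Integrable (fun x => W x * devCount 𝒜 H (h + 1) (x t)) μ :=
      integrable_of_abs_le (hW0.mul ((measurable_devCount hA h𝒜 (h + 1)).comp hep))
        fun x => abs_mul_le_of_abs_le (hC x) (c := H) (by
          rw [abs_of_nonneg (devCount_nonneg _ _)]; exact devCount_le _ _)
    have i3 : Integrable (fun x => W x * Φ (observed 𝒜 M x t) (x t h)) μ :=
      integrable_of_abs_le (hW0.mul (hΦm.comp (hobs.prodMk (measurable_coord t h))))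
        fun x => abs_mul_le_of_abs_le (hC x) (hΦb _ _)
    have i4 : Integrable (fun x =>
        W x * devValue 𝒜 M L t n (h + 1) (observed 𝒜 M x t) (x t (h + 1)).1) μ :=
      integrable_of_abs_le (hW0.mul (hU.comp (hobs.prodMk (measurable_coord t (h + 1)).fst)))
        fun x => abs_mul_le_of_abs_le (hC x) (hUb _ _)
    have hWh : Measurable[history X A H t (h + 1)] W :=
      hW.mono (historyState_le_history_succ t h) le_rfl
    have hobsS := measurable_observed_historyState 𝒜 M h𝒜 (le_refl t) h
    have hobsh : Measurable[history X A H t (h + 1)] fun x : Traj X A => observed 𝒜 M x t :=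
      hobsS.mono (historyState_le_history_succ t h) le_rfl
    have step1 : ∫ x, W x * devCount 𝒜 H (h + 1) (x t) ∂μ
        = ∫ x, W x * Φ (observed 𝒜 M x t) (x t h) ∂μ := by
      rw [ih (h + 1) (by omega) W
        (hWh.mono (history_le_historyState t (h + 1)) le_rfl) ⟨C, hC⟩]
      rcases Nat.eq_zero_or_pos n with rfl | hn
      · simp [hΦ, devValue, value]
      · have := integral_step hint ht (show h + 1 < H by omega)
          (g := fun x => (W x, observed 𝒜 M x t)) (hWh.prodMk hobsh)
          (f := fun p => p.1.1 * devValue 𝒜 M L t n (h + 1) p.1.2 p.2)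
          (measurable_fst.fst.mul (hU.comp (measurable_fst.snd.prodMk measurable_snd))) i4
        rw [this]
        simp only [integral_const_mul, hΦ]
    have hdec : ∀ x, W x * devCount 𝒜 H h (x t)
        = W x * offTarget 𝒜.target h (x t h).1 (x t h).2 + W x * devCount 𝒜 H (h + 1) (x t) := by
      intro x
      unfold devCount
      rw [Finset.sum_eq_sum_Ico_succ_bot hh', mul_add]
    simp only [hdec]
    rw [integral_add i1 i2, step1, ← integral_add i1 i3]
    have hact := integral_act hL h𝒜 hint ht hh'
      (g := fun x => (W x, (observed 𝒜 M x t, (x t h).1)))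
      (hW.prodMk (hobsS.prodMk (measurable_state_historyState t h)))
      (f := fun p => p.1.1 * (offTarget 𝒜.target h p.1.2.2 p.2 + Φ p.1.2.1 (p.1.2.2, p.2)))
      (measurable_fst.fst.mul ((hoff.comp (measurable_fst.snd.snd.prodMk measurable_snd)).add
        (hΦm.comp (measurable_fst.snd.fst.prodMk (measurable_fst.snd.snd.prodMk measurable_snd)))))
      ((i1.add i3).congr (ae_of_all _ fun x => by simp only [Pi.add_apply, mul_add]))
    simp only [← mul_add]
    refine hact.trans ?_
    simp only [integral_const_mul]
    rfl

end interaction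

/-! ### High-probability events -/

section events

variable {X A : Type*} [MeasurableSpace X] [MeasurableSpace A] {d H T : ℕ}
  {M : LinearMDP X A d H} {𝒜 : Attack X A d} {L : Learner X A H} {μ : Measure (Traj X A)}

/-- Outside an event of probability `e^{-ℓ}`, the number of non-target actions of the second stage
is controlled by its predictable compensator. -/
theorem devCount_tail [IsProbabilityMeasure μ] (hA : MeasurableSet (Set.diagonal A))
    (hL : ∀ t h, IsMarkovKernel (L t h)) (h𝒜 : 𝒜.IsValid M) (hH : 1 ≤ H)
    (hint : IsInteraction M 𝒜 L T μ) (ℓ : ℝ) :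
    μ {x | (Real.exp 1 - 1) * (∑ t ∈ Finset.Ico 𝒜.T₁ T,
          devValue 𝒜 M L t H 0 (observed 𝒜 M x t) (x t 0).1) + H * ℓ
        < ∑ t ∈ Finset.Ico 𝒜.T₁ T, devCount 𝒜 H 0 (x t)} ≤ ENNReal.ofReal (Real.exp (-ℓ)) := by
  have hH' : (0 : ℝ) < H := by exact_mod_cast hH
  set D : ℕ → Traj X A → ℝ := fun i x => (H : ℝ)⁻¹ * devCount 𝒜 H 0 (x (𝒜.T₁ + i)) with hD
  set E : ℕ → Traj X A → ℝ := fun i x =>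
    (H : ℝ)⁻¹ * devValue 𝒜 M L (𝒜.T₁ + i) H 0 (observed 𝒜 M x (𝒜.T₁ + i)) (x (𝒜.T₁ + i) 0).1 with hE
  have hDm : ∀ i, Measurable (D i) := fun i =>
    ((measurable_devCount hA h𝒜 0).comp (measurable_pi_apply _)).const_mul _
  have hEdv : ∀ t, Measurable fun p : (Fin t → Fin H → (X × A) × ℝ) × X =>
      devValue 𝒜 M L t H 0 p.1 p.2 := fun t =>
    measurable_devValue (L := L) hA h𝒜 hL (by omega)
  have hEm : ∀ i, Measurable (E i) := fun i =>
    ((hEdv _).comp ((measurable_observed 𝒜 M h𝒜 _).prodMk (measurable_coord _ 0).fst)).const_mul _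
  have hle1 : ∀ z : ℝ, z ≤ H → (H : ℝ)⁻¹ * z ≤ 1 := fun z hz => by
    rw [inv_mul_le_iff₀ hH', mul_one]; exact hz
  have h := sum_le_condMean_tail (μ := μ) (D := D) (M := E) (T - 𝒜.T₁)
    (fun i => historyState X A H (𝒜.T₁ + i) 0) (fun i _ => hDm i) (fun i _ => hEm i)
    (fun i _ k hk => measurable_historyState (hDm k) fun x y hxy _ _ => by
      simp only [hD, devCount]
      congr 1
      refine Finset.sum_congr rfl fun j hj => ?_
      rw [hxy (𝒜.T₁ + k) (by omega) j (Finset.mem_Ico.1 hj).2])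
    (fun i _ k hk => measurable_historyState (hEm k) fun x y hxy _ h0 => by
      simp only [hE]
      rw [observed_congr 𝒜 M h𝒜 (hxy.mono (show 𝒜.T₁ + k ≤ 𝒜.T₁ + i by omega))]
      rcases hk.eq_or_lt with rfl | hk'
      · rw [h0]
      · rw [hxy (𝒜.T₁ + k) (by omega) 0 (by omega)])
    (fun i _ x => mul_nonneg (by positivity) (devCount_nonneg _ _))
    (fun i _ x => hle1 _ (devCount_le _ _))
    (fun i _ x => mul_nonneg (by positivity) (devValue_nonneg (by omega) _ _))
    (fun i _ x => hle1 _ ((le_abs_self _).trans (abs_devValue_le hL (by omega) _ _)))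
    (fun i hi W hW hWb => by
      have h1 := integral_mul_devCount hA hL h𝒜 hint (t := 𝒜.T₁ + i) (by omega) H 0 (by omega)
        W hW hWb
      simp only [hD, hE]
      simp only [mul_left_comm _ (H : ℝ)⁻¹]
      rw [integral_const_mul, integral_const_mul, h1]) ℓ
  refine (measure_mono fun x hx => ?_).trans h
  simp only [Set.mem_ofPred_eq, hD, hE, ← Finset.mul_sum, Finset.sum_Ico_eq_sum_range] at hx ⊢
  rw [lt_inv_mul_iff₀ hH']
  calc _ = _ := by field_simp
    _ < _ := hx

open Classical in
/-- The noise of the target value regression at stage `h` over all Stage 1 episodes, clean or not. -/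
noncomputable def noiseSum (𝒜 : Attack X A d) (M : LinearMDP X A d H) (h : ℕ) (x : Traj X A) :
    Vec d :=
  ∑ t ∈ Finset.range 𝒜.T₁, (if (x t h).1 ∈ 𝒜.supp h then residual 𝒜 M (H - h) h (x t) else 0) •
    𝒜.phiT M h (x t h).1

/-- A deterministic matrix that is comparable with every exciting clean design, in whose inverse norm
the certified target features are small and the regression noise concentrates. -/
theorem exists_noise_design [IsProbabilityMeasure μ] (hA : MeasurableSet (Set.diagonal A))
    (h𝒜 : 𝒜.IsValid M) (hint : IsInteraction M 𝒜 L T μ) (hd : 1 ≤ d) (hT : 𝒜.T₁ ≤ T)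
    {h : ℕ} (hh : h < H) {ℓ : ℝ} (hℓ : 0 ≤ ℓ) :
    ∃ V : Matrix (Fin d) (Fin d) ℝ, V.PosDef ∧
      (∀ s ∈ 𝒜.supp h, invNorm V (𝒜.phiT M h s) ≤ √(5 * d) / √𝒜.T₁) ∧
      (∀ (y : Vec d) (q : ℝ), 0 ≤ q → (∀ s ∈ 𝒜.supp h, ⟪𝒜.phiT M h s, y⟫ ^ 2 ≤ q) →
        y.ofLp ⬝ᵥ (V *ᵥ y.ofLp) ≤ 𝒜.lam * ‖y‖ ^ 2 + 𝒜.T₁ * q) ∧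
      μ {x | √(5 * d) * H * (3 / 2 + √(2 * ℓ)) < invNorm V (noiseSum 𝒜 M h x)}
        ≤ ENNReal.ofReal (Real.exp (-ℓ)) := by
  classical
  have hT₁ : (0 : ℝ) < 𝒜.T₁ := by exact_mod_cast h𝒜.T₁_pos
  have hH' : (0 : ℝ) < H := by exact_mod_cast (by omega : 0 < H)
  have hd' : (0 : ℝ) < d := by exact_mod_cast hd
  obtain ⟨B, ⟨hB, hBq⟩, hBφ⟩ := exists_design (fun s : 𝒜.supp h => 𝒜.phiT M h s)
    (fun s => M.norm_φ_le h hh _ _) (div_pos h𝒜.lam_pos hT₁) hd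
  have hV : ((𝒜.T₁ : ℝ) • B).PosDef := hB.smul hT₁
  have hφ : ∀ s ∈ 𝒜.supp h, invNorm ((𝒜.T₁ : ℝ) • B) (𝒜.phiT M h s) ≤ √(5 * d) / √𝒜.T₁ := by
    intro s hs
    rw [← Real.sqrt_div' _ hT₁.le]
    refine Real.le_sqrt_of_sq_le ?_
    rw [invNorm_smul_sq hB hT₁]
    exact div_le_div_of_nonneg_right (hBφ ⟨s, hs⟩) hT₁.le
  refine ⟨(𝒜.T₁ : ℝ) • B, hV, hφ, ?_, ?_⟩
  · intro y q hq hy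
    have h1 := hBq y q hq fun s => hy s s.2
    rw [Matrix.smul_mulVec, dotProduct_smul, smul_eq_mul]
    calc (𝒜.T₁ : ℝ) * (y.ofLp ⬝ᵥ (B *ᵥ y.ofLp))
        ≤ 𝒜.T₁ * (𝒜.lam / 𝒜.T₁ * ‖y‖ ^ 2 + q) := mul_le_mul_of_nonneg_left h1 hT₁.le
      _ = _ := by field_simp
  · -- in the coordinates `R` the inverse norm of the design is Euclidean, and the noise is a martingale
    -- with increments bounded by `b`
    obtain ⟨m, R, hR⟩ := exists_inner_eq_inv hV
    have hRm : Measurable R := (LinearMap.continuous_of_finiteDimensional R).measurable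
    set ψ : X → Vec m := fun s => if s ∈ 𝒜.supp h then R (𝒜.phiT M h s) else 0 with hψ
    have hφm : Measurable (𝒜.phiT M h) :=
      (M.measurable_φ h hh).comp (measurable_id.prodMk (h𝒜.measurable_target h hh))
    have hψm : Measurable ψ :=
      Measurable.ite (h𝒜.measurable_supp h hh) (hRm.comp hφm) measurable_const
    have hψb : ∀ s, ‖ψ s‖ ≤ √(5 * d) / √𝒜.T₁ := by
      intro s
      simp only [hψ]
      split_ifs with hs
      · rw [← invNorm_eq_norm hR]; exact hφ s hs
      · rw [norm_zero]; positivity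
    have hres := measurable_residual hA h𝒜 (n := H - h) (h := h) (by omega)
    have hresb : ∀ e, |residual 𝒜 M (H - h) h e| ≤ H := fun e =>
      (abs_residual_le h𝒜 e (by omega)).trans (by exact_mod_cast Nat.sub_le H h)
    set Y : ℕ → Traj X A → Vec m := fun t x =>
      residual 𝒜 M (H - h) h (x t) • ψ (x t h).1 with hY
    have hYm : ∀ t, Measurable (Y t) := fun t =>
      (hres.comp (measurable_pi_apply t)).smul (hψm.comp (measurable_coord t h).fst)
    set b : ℝ := H * (√(5 * d) / √𝒜.T₁) with hb
    have hsum : ∀ x, R (noiseSum 𝒜 M h x) = ∑ t ∈ Finset.range 𝒜.T₁, Y t x := by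
      intro x
      rw [noiseSum, map_sum]
      refine Finset.sum_congr rfl fun t _ => ?_
      simp only [hY, hψ, map_smul]
      split_ifs <;> simp
    have htail := norm_sum_tail (μ := μ) (X := Y) (b := b) (by positivity) 𝒜.T₁
      (fun t => historyState X A H t h) (fun t _ => hYm t)
      (fun t _ k hk => measurable_historyState (hYm k) fun x y hxy _ _ => by
        simp only [hY, residual]
        rw [hxy k hk h hh, stoppedReturn_congr (H - h) h
          fun j _ hj => hxy k hk j (by omega)])
      (fun t _ x => by
        simp only [hY, norm_smul, Real.norm_eq_abs, hb]
        exact mul_le_mul (hresb _) (hψb _) (norm_nonneg _) hH'.le)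
      (fun t ht U hU ⟨C, hC⟩ => by
        have := integral_mul_residual hA h𝒜 hint (t := t) (by omega) (H - h) h (by omega)
          (fun x => ⟪U x, ψ (x t h).1⟫)
          (hU.inner (hψm.comp (measurable_state_historyState t h)))
          ⟨C * (√(5 * d) / √𝒜.T₁), fun x => (abs_real_inner_le_norm _ _).trans
            (mul_le_mul (hC x) (hψb _) (norm_nonneg _) ((norm_nonneg _).trans (hC x)))⟩
        simpa only [hY, real_inner_smul_right, mul_comm] using this) hℓ
    refine (measure_mono fun x hx => ?_).trans htail
    simp only [Set.mem_ofPred_eq] at hx ⊢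
    rw [← hsum, ← invNorm_eq_norm hR]
    refine lt_of_eq_of_lt ?_ hx
    rw [show (2 : ℝ) * 𝒜.T₁ * ℓ = 𝒜.T₁ * (2 * ℓ) by ring, Real.sqrt_mul hT₁.le, hb]
    field_simp

end events

/-! ### The confidence bound of the clean regression -/

section confidence

variable {X A : Type*} [MeasurableSpace X] [MeasurableSpace A] {d H T : ℕ}
  {M : LinearMDP X A d H} {𝒜 : Attack X A d} {δ κ cexc c : ℝ} {p : ℕ} {x : Traj X A}

theorem div_le_mul_div {d H T : ℕ} {δ : ℝ} (hd : 1 ≤ d) (hH : 1 ≤ H) (hT : 1 ≤ T) (hδ : 0 < δ) :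
    (H : ℝ) / δ ≤ (d : ℝ) * H * T / δ ∧ 1 / δ ≤ (d : ℝ) * H * T / δ := by
  have hd' : (1 : ℝ) ≤ d := by exact_mod_cast hd
  have hH' : (1 : ℝ) ≤ H := by exact_mod_cast hH
  have hT' : (1 : ℝ) ≤ T := by exact_mod_cast hT
  have h1 : (H : ℝ) ≤ d * H * T := by
    calc (H : ℝ) = 1 * H * 1 := by ring
      _ ≤ d * H * T := by gcongr
  exact ⟨div_le_div_of_nonneg_right h1 hδ.le, div_le_div_of_nonneg_right (hH'.trans h1) hδ.le⟩

theorem log_le_logFactor {d H T : ℕ} {δ : ℝ} (hd : 1 ≤ d) (hH : 1 ≤ H) (hT : 1 ≤ T) (hδ : 0 < δ) :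
    Real.log (H / δ) ≤ logFactor d H T δ - 1 ∧ Real.log (1 / δ) ≤ logFactor d H T δ - 1 := by
  have hH' : (0 : ℝ) < H := by exact_mod_cast hH
  obtain ⟨h1, h2⟩ := div_le_mul_div hd hH hT hδ
  unfold logFactor
  constructor
  · linarith [Real.log_le_log (by positivity) h1]
  · linarith [Real.log_le_log (by positivity) h2]

theorem one_le_logFactor {d H T : ℕ} {δ : ℝ} (hd : 1 ≤ d) (hH : 1 ≤ H) (hT : 1 ≤ T) (hδ : 0 < δ)
    (hδ1 : δ < 1) : 1 ≤ logFactor d H T δ := by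
  have h1 := (log_le_logFactor hd hH hT hδ).2
  have h2 : 0 ≤ Real.log (1 / δ) := Real.log_nonneg (by rw [le_div_iff₀ hδ]; linarith)
  linarith

theorem Q_eq_add_integral (h : ℕ) (s : X) (a : A) :
    M.Q M.reward 𝒜.targetPolicy h s a
      = M.reward h s a + ∫ s', targetValue 𝒜 M (H - (h + 1)) (h + 1) s' ∂(M.P h (s, a)) := rfl

theorem targetValue_eq_Q [MeasurableSingletonClass A] {h : ℕ} (hh : h < H) (s : X) :
    targetValue 𝒜 M (H - h) h s = M.Q M.reward 𝒜.targetPolicy h s (𝒜.target h s) := by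
  rw [Q_eq_add_integral, show H - h = (H - (h + 1)) + 1 by omega]
  exact value_target_succ _ _ _ _ _ _

theorem card_clean_le : (𝒜.clean M x).card ≤ 𝒜.T₁ := by
  have : 𝒜.clean M x ⊆ Finset.range 𝒜.T₁ := fun k hk => Finset.mem_range.2 (mem_clean_lt 𝒜 M hk)
  simpa using Finset.card_le_card this

theorem posDef_design2 (h𝒜 : 𝒜.IsValid M) (x : Traj X A) (h : ℕ) : (𝒜.design2 M x h).PosDef :=
  posDef_gram h𝒜.lam_pos _ _

/-- If fewer than half of the Stage 1 episodes are clean, then `T₁` is of logarithmic size. -/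
theorem sqrt_le_of_card_clean_lt (hG : Succeeds M 𝒜 T δ κ cexc c p x) (h𝒜 : 𝒜.IsValid M)
    (hn : 2 * ((𝒜.clean M x).card : ℝ) < 𝒜.T₁) :
    √(𝒜.T₁ : ℝ) ≤ 2 * κ * logFactor d H T δ ^ p := by
  have hT₁ : (0 : ℝ) < 𝒜.T₁ := by exact_mod_cast h𝒜.T₁_pos
  have h1 := hG.clean_length
  have h2 : √(𝒜.T₁ : ℝ) * √(𝒜.T₁ : ℝ) = 𝒜.T₁ := Real.mul_self_sqrt hT₁.le
  have h3 : 0 < √(𝒜.T₁ : ℝ) := Real.sqrt_pos.2 hT₁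
  refine le_of_mul_le_mul_left ?_ h3
  linarith

theorem invNorm_target_le (hG : Succeeds M 𝒜 T δ κ cexc c p x) (hcexc : 0 < cexc)
    (hn : 0 < (𝒜.clean M x).card) {h : ℕ} (hh : h < H) {s : X} (hs : s ∈ 𝒜.supp h) :
    invNorm (𝒜.design2 M x h) (𝒜.phiT M h s) ≤ 1 / √(cexc * (𝒜.clean M x).card) := by
  have hn' : (0 : ℝ) < (𝒜.clean M x).card := by exact_mod_cast hn
  have h1 := hG.excitation h hh s hs
  rw [← Real.sqrt_one, ← Real.sqrt_div' _ (by positivity)]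
  refine Real.le_sqrt_of_sq_le ?_
  rw [le_div_iff₀ (by positivity)]
  linarith

/-- On an episode without certified deviations, the regression noise is the residual. -/
theorem mcReturn_sub_eq_residual [MeasurableSingletonClass A] {w : ℕ → Vec d}
    (hw : ∀ h < H, ∀ s a, M.Q M.reward 𝒜.targetPolicy h s a = ⟪M.φ h s a, w h⟫)
    (hsupp : ∀ t < 𝒜.T₁, ∀ h < H, (x t h).1 ∈ 𝒜.supp h) {h : ℕ} (hh : h < H) {t : ℕ}
    (ht : t ∈ 𝒜.clean M x) :
    𝒜.mcReturn M x h t - ⟪𝒜.phiT M h (x t h).1, w h⟫ = residual 𝒜 M (H - h) h (x t) := by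
  obtain ⟨ht1, _, hdev⟩ := (mem_clean 𝒜 M).1 ht
  have htgt : ∀ j, h ≤ j → j < H → (x t j).2 = 𝒜.target j (x t j).1 := by
    intro j _ hj
    by_contra hne
    exact hdev j hj ⟨hsupp t ht1 j hj, hne⟩
  unfold residual
  rw [stoppedReturn_eq_sum (H - h) h (by omega) htgt, targetValue_eq_Q hh, hw h hh]
  rfl

/-- The regression noise over the clean episodes. Selecting the clean episodes looks at later
actions, but it removes only order `√T₁` of the `T₁` episodes, each of size `√(d / T₁)` in the norm
of the deterministic design, so the bias is of the same order as the fluctuation. -/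
theorem invNorm_clean_noise_le (h𝒜 : 𝒜.IsValid M) (hcexc : 0 < cexc) (hκ : 0 < κ)
    (hG : Succeeds M 𝒜 T δ κ cexc c p x) (hd : 1 ≤ d) (hL1 : 1 ≤ logFactor d H T δ)
    (hsupp : ∀ t < 𝒜.T₁, ∀ h < H, (x t h).1 ∈ 𝒜.supp h) {h : ℕ} (hh : h < H)
    {V : Matrix (Fin d) (Fin d) ℝ} (hV : V.PosDef)
    (hVφ : ∀ s ∈ 𝒜.supp h, invNorm V (𝒜.phiT M h s) ≤ √(5 * d) / √𝒜.T₁)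
    (hVq : ∀ (y : Vec d) (q : ℝ), 0 ≤ q → (∀ s ∈ 𝒜.supp h, ⟪𝒜.phiT M h s, y⟫ ^ 2 ≤ q) →
        y.ofLp ⬝ᵥ (V *ᵥ y.ofLp) ≤ 𝒜.lam * ‖y‖ ^ 2 + 𝒜.T₁ * q)
    (hnoise : invNorm V (noiseSum 𝒜 M h x) ≤ √(5 * d) * H * (3 * logFactor d H T δ)) :
    invNorm (𝒜.design2 M x h)
      (∑ t ∈ 𝒜.clean M x, residual 𝒜 M (H - h) h (x t) • 𝒜.phiT M h (x t h).1)
      ≤ (√(1 + 2 / cexc) * √5 * (3 + κ) + 2 * κ / √cexc) * H * √(d : ℝ)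
        * logFactor d H T δ ^ (p + 1) := by
  classical
  set Lf := logFactor d H T δ with hLf
  set n := (𝒜.clean M x).card with hn
  set Γ := 𝒜.design2 M x h with hΓ
  have hΓp : Γ.PosDef := posDef_design2 h𝒜 x h
  have hT₁ : (0 : ℝ) < 𝒜.T₁ := by exact_mod_cast h𝒜.T₁_pos
  have hsT : 0 < √(𝒜.T₁ : ℝ) := Real.sqrt_pos.2 hT₁
  have hd' : (1 : ℝ) ≤ d := by exact_mod_cast hd
  have hsd : 1 ≤ √(d : ℝ) := Real.one_le_sqrt.2 hd'
  have hH' : (0 : ℝ) < H := by exact_mod_cast (by omega : 0 < H)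
  have hLp : 0 < Lf := by linarith
  have hpow : Lf ^ p ≤ Lf ^ (p + 1) := pow_le_pow_right₀ hL1 (by omega)
  have hpow1 : Lf ≤ Lf ^ (p + 1) := by simpa using pow_le_pow_right₀ hL1 (show 1 ≤ p + 1 by omega)
  have hresb : ∀ t, |residual 𝒜 M (H - h) h (x t)| ≤ H := fun t =>
    (abs_residual_le h𝒜 (x t) (by omega)).trans (by exact_mod_cast Nat.sub_le H h)
  have hs5 : √(5 * (d : ℝ)) = √5 * √(d : ℝ) := Real.sqrt_mul (by norm_num) _
  have hsc : 0 < √cexc := Real.sqrt_pos.2 hcexc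
  set Z := ∑ t ∈ 𝒜.clean M x, residual 𝒜 M (H - h) h (x t) • 𝒜.phiT M h (x t h).1 with hZ
  have hP1 : 0 ≤ √(1 + 2 / cexc) * √5 * (3 + κ) * H * √(d : ℝ) * Lf ^ (p + 1) := by positivity
  have hP2 : 0 ≤ 2 * κ / √cexc * H * √(d : ℝ) * Lf ^ (p + 1) := by positivity
  by_cases hcase : (𝒜.T₁ : ℝ) ≤ 2 * n
  · have hnpos : (0 : ℝ) < n := by linarith
    have hncl : (𝒜.T₁ : ℝ) - n ≤ κ * √(𝒜.T₁ : ℝ) * Lf ^ p := by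
      have := hG.clean_length
      linarith
    -- split the full noise sum into clean and discarded episodes
    have hsub : 𝒜.clean M x ⊆ Finset.range 𝒜.T₁ := fun k hk =>
      Finset.mem_range.2 (mem_clean_lt 𝒜 M hk)
    have hsplit : Z = noiseSum 𝒜 M h x + ∑ t ∈ Finset.range 𝒜.T₁ \ 𝒜.clean M x,
        (-residual 𝒜 M (H - h) h (x t)) • 𝒜.phiT M h (x t h).1 := by
      have h1 : noiseSum 𝒜 M h x = ∑ t ∈ Finset.range 𝒜.T₁,
          residual 𝒜 M (H - h) h (x t) • 𝒜.phiT M h (x t h).1 := by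
        unfold noiseSum
        refine Finset.sum_congr rfl fun t ht => ?_
        rw [if_pos (hsupp t (Finset.mem_range.1 ht) h hh)]
      rw [h1, ← Finset.sum_sdiff hsub]
      simp only [neg_smul, Finset.sum_neg_distrib]
      abel
    have hrest := invNorm_sum_smul_le hV (Finset.range 𝒜.T₁ \ 𝒜.clean M x)
      (fun t => -residual 𝒜 M (H - h) h (x t)) (fun t => 𝒜.phiT M h (x t h).1)
      (C := H) (b := √(5 * d) / √𝒜.T₁) (fun t _ => by rw [abs_neg]; exact hresb t)
      (fun t ht => hVφ _ (hsupp t (Finset.mem_range.1 (Finset.mem_sdiff.1 ht).1) h hh))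
    have hcard : ((Finset.range 𝒜.T₁ \ 𝒜.clean M x).card : ℝ) = 𝒜.T₁ - n := by
      rw [Finset.card_sdiff_of_subset hsub, Finset.card_range, Nat.cast_sub card_clean_le]
    rw [hcard] at hrest
    have hrest2 : ((𝒜.T₁ : ℝ) - n) * (H * (√(5 * d) / √𝒜.T₁)) ≤ κ * Lf ^ p * H * √(5 * d) := by
      calc ((𝒜.T₁ : ℝ) - n) * (H * (√(5 * d) / √𝒜.T₁))
          ≤ (κ * √(𝒜.T₁ : ℝ) * Lf ^ p) * (H * (√(5 * d) / √𝒜.T₁)) :=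
            mul_le_mul_of_nonneg_right hncl (by positivity)
        _ = _ := by field_simp
    have hVZ : invNorm V Z ≤ √5 * (3 + κ) * H * √(d : ℝ) * Lf ^ (p + 1) := by
      rw [hsplit]
      refine (invNorm_add_le hV _ _).trans ?_
      have h1 : √(5 * (d : ℝ)) * H * (3 * Lf) ≤ √(5 * (d : ℝ)) * H * (3 * Lf ^ (p + 1)) := by
        gcongr
      have h2 : κ * Lf ^ p * H * √(5 * (d : ℝ)) ≤ κ * Lf ^ (p + 1) * H * √(5 * (d : ℝ)) := by
        gcongr
      rw [hs5] at hnoise h1 h2 hrest hrest2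
      linarith
    have hform : ∀ y : Vec d, y.ofLp ⬝ᵥ (V *ᵥ y.ofLp)
        ≤ (1 + 2 / cexc) * (y.ofLp ⬝ᵥ (Γ *ᵥ y.ofLp)) := by
      intro y
      have hyΓ : y.ofLp ⬝ᵥ (Γ *ᵥ y.ofLp)
          = 𝒜.lam * ‖y‖ ^ 2 + ∑ k ∈ 𝒜.clean M x, ⟪𝒜.phiT M h (x k h).1, y⟫ ^ 2 :=
        dotProduct_gram _ _ _ _
      have hl : 𝒜.lam * ‖y‖ ^ 2 ≤ y.ofLp ⬝ᵥ (Γ *ᵥ y.ofLp) := by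
        have : 0 ≤ ∑ k ∈ 𝒜.clean M x, ⟪𝒜.phiT M h (x k h).1, y⟫ ^ 2 :=
          Finset.sum_nonneg fun k _ => sq_nonneg _
        linarith
      have hΓ0 : 0 ≤ y.ofLp ⬝ᵥ (Γ *ᵥ y.ofLp) :=
        le_trans (mul_nonneg h𝒜.lam_pos.le (sq_nonneg _)) hl
      have h1 := hVq y ((y.ofLp ⬝ᵥ (Γ *ᵥ y.ofLp)) / (cexc * n)) (by positivity) fun s hs => by
        rw [le_div_iff₀ (by positivity)]
        have h2 := inner_sq_le_invNorm_sq_mul hΓp (𝒜.phiT M h s) y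
        have h3 := hG.excitation h hh s hs
        calc ⟪𝒜.phiT M h s, y⟫ ^ 2 * (cexc * n)
            ≤ (invNorm Γ (𝒜.phiT M h s) ^ 2 * (y.ofLp ⬝ᵥ (Γ *ᵥ y.ofLp))) * (cexc * n) :=
              mul_le_mul_of_nonneg_right h2 (by positivity)
          _ = (cexc * n * invNorm Γ (𝒜.phiT M h s) ^ 2) * (y.ofLp ⬝ᵥ (Γ *ᵥ y.ofLp)) := by ring
          _ ≤ 1 * (y.ofLp ⬝ᵥ (Γ *ᵥ y.ofLp)) := mul_le_mul_of_nonneg_right h3 hΓ0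
          _ = _ := one_mul _
      have h4 : (𝒜.T₁ : ℝ) * ((y.ofLp ⬝ᵥ (Γ *ᵥ y.ofLp)) / (cexc * n))
          ≤ 2 / cexc * (y.ofLp ⬝ᵥ (Γ *ᵥ y.ofLp)) := by
        calc (𝒜.T₁ : ℝ) * ((y.ofLp ⬝ᵥ (Γ *ᵥ y.ofLp)) / (cexc * n))
            ≤ (2 * n) * ((y.ofLp ⬝ᵥ (Γ *ᵥ y.ofLp)) / (cexc * n)) :=
              mul_le_mul_of_nonneg_right hcase (by positivity)
          _ = _ := by field_simp
      linarith
    have hcmp := invNorm_sq_le_of_form_le hΓp hV hform Z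
    have h5 : invNorm Γ Z ≤ √(1 + 2 / cexc) * invNorm V Z := by
      refine le_of_sq_le_sq ?_ (mul_nonneg (Real.sqrt_nonneg _) (invNorm_nonneg _ _))
      rw [mul_pow, Real.sq_sqrt (by positivity)]
      exact hcmp
    have h6 := h5.trans (mul_le_mul_of_nonneg_left hVZ (Real.sqrt_nonneg _))
    linarith
  · -- few clean episodes: `T₁` is of logarithmic size, and excitation alone bounds the noise
    have hsq := sqrt_le_of_card_clean_lt hG h𝒜 (by rw [not_le] at hcase; exact hcase)
    have hZle : invNorm Γ Z ≤ 2 * κ / √cexc * H * Lf ^ p := by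
      rcases Nat.eq_zero_or_pos n with hn0 | hn0
      · have : Z = 0 := by
          rw [hZ, show 𝒜.clean M x = ∅ from Finset.card_eq_zero.1 hn0, Finset.sum_empty]
        rw [this]
        have h0 : invNorm Γ (0 : Vec d) = 0 := by simp [invNorm]
        rw [h0]
        positivity
      · have hn0' : (0 : ℝ) < n := by exact_mod_cast hn0
        have h1 := invNorm_sum_smul_le hΓp (𝒜.clean M x)
          (fun t => residual 𝒜 M (H - h) h (x t)) (fun t => 𝒜.phiT M h (x t h).1)
          (C := H) (b := 1 / √(cexc * n)) (fun t _ => hresb t)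
          (fun t ht => invNorm_target_le hG hcexc hn0 hh
            (hsupp t (mem_clean_lt 𝒜 M ht) h hh))
        have hsn : √(n : ℝ) ≤ √(𝒜.T₁ : ℝ) := Real.sqrt_le_sqrt (by exact_mod_cast card_clean_le)
        have hsn0 : 0 < √(n : ℝ) := Real.sqrt_pos.2 hn0'
        calc invNorm Γ Z ≤ n * (H * (1 / √(cexc * n))) := h1
          _ = √(n : ℝ) * √(n : ℝ) * (H * (1 / (√cexc * √n))) := by
              rw [Real.mul_self_sqrt hn0'.le, Real.sqrt_mul hcexc.le]
          _ = √(n : ℝ) * H / √cexc := by field_simp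
          _ ≤ (2 * κ * Lf ^ p) * H / √cexc := by
              gcongr
              exact hsn.trans hsq
          _ = _ := by ring
    have h2 : 2 * κ / √cexc * H * Lf ^ p ≤ 2 * κ / √cexc * H * √(d : ℝ) * Lf ^ (p + 1) := by
      calc 2 * κ / √cexc * H * Lf ^ p = 2 * κ / √cexc * H * 1 * Lf ^ p := by ring
        _ ≤ 2 * κ / √cexc * H * √(d : ℝ) * Lf ^ (p + 1) := by gcongr
    linarith

/-- The confidence bound: the plug-in estimate of the target value has error at most `α_h` in the
inverse design norm, for all features. -/
theorem abs_inner_what_sub_le [MeasurableSingletonClass A] {w : ℕ → Vec d} {K : ℝ}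
    (h𝒜 : 𝒜.IsValid M)
    (hw : ∀ h < H, ∀ s a, M.Q M.reward 𝒜.targetPolicy h s a = ⟪M.φ h s a, w h⟫)
    (hsupp : ∀ t < 𝒜.T₁, ∀ h < H, (x t h).1 ∈ 𝒜.supp h) {h : ℕ} (hh : h < H)
    (hα : √𝒜.lam * ‖w h‖ + K ≤ 𝒜.α h)
    (hK : invNorm (𝒜.design2 M x h)
      (∑ t ∈ 𝒜.clean M x, residual 𝒜 M (H - h) h (x t) • 𝒜.phiT M h (x t h).1) ≤ K)
    (z : Vec d) : |⟪z, 𝒜.what M x h - w h⟫| ≤ 𝒜.α h * invNorm (𝒜.design2 M x h) z := by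
  have h1 := abs_inner_ridge_sub_le h𝒜.lam_pos (𝒜.clean M x)
    (fun t => 𝒜.phiT M h (x t h).1) (fun t => 𝒜.mcReturn M x h t) (w h) z
  have h2 : ∑ t ∈ 𝒜.clean M x, (𝒜.mcReturn M x h t - ⟪𝒜.phiT M h (x t h).1, w h⟫)
        • 𝒜.phiT M h (x t h).1
      = ∑ t ∈ 𝒜.clean M x, residual 𝒜 M (H - h) h (x t) • 𝒜.phiT M h (x t h).1 :=
    Finset.sum_congr rfl fun t ht => by rw [mcReturn_sub_eq_residual hw hsupp hh ht]
  rw [h2] at h1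
  refine h1.trans ?_
  rw [mul_comm]
  exact mul_le_mul_of_nonneg_right ((add_le_add_left hK _).trans (by linarith))
    (invNorm_nonneg _ _)

end confidence

/-! ### Regret, cost and deviations on the success event -/

section outcome

variable {X A : Type*} [MeasurableSpace X] [MeasurableSpace A] {d H T : ℕ}
  {M : LinearMDP X A d H} {𝒜 : Attack X A d} {L : Learner X A H} {δ κ cexc c : ℝ} {p : ℕ}
  {x : Traj X A} {w : ℕ → Vec d}

theorem feasible_of_succeeds (h𝒜 : 𝒜.IsValid M) (hc : 0 < c)
    (hG : Succeeds M 𝒜 T δ κ cexc c p x) : 𝒜.Feasible M x (𝒜.eps2 M x) (𝒜.u x) :=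
  h𝒜.stage2_optimal x ((div_pos hc h𝒜.S_pos).trans_le hG.eps2_ge)

/-- The budget parameter is at least `c`: the penalty of a non-target action is at least `ε₂⋆` and at
most `1`. Without non-target actions the program is unbounded and `ε₂⋆` has the value `0`. -/
theorem le_S_of_succeeds (h𝒜 : 𝒜.IsValid M) (hc : 0 < c) (hα : ∀ h < H, 0 ≤ 𝒜.α h)
    (hG : Succeeds M 𝒜 T δ κ cexc c p x) : c ≤ 𝒜.S := by
  have hpos : 0 < 𝒜.eps2 M x := (div_pos hc h𝒜.S_pos).trans_le hG.eps2_ge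
  have hex : ∃ h < H, ∃ s ∈ 𝒜.supp h, ∃ a, a ≠ 𝒜.target h s := by
    by_contra hne
    push Not at hne
    have huniv : {ε | ∃ u, 𝒜.Feasible M x ε u} = Set.univ := by
      refine Set.eq_univ_of_forall fun ε => ⟨fun _ => 0, fun h hh => ⟨fun s hs a ha => ?_, ?_, ?_⟩⟩
      · exact absurd (hne h hh s hs a) ha
      · intro s _; simp
      · simp
    rw [Attack.eps2, huniv, Real.sSup_univ] at hpos
    exact lt_irrefl _ hpos
  obtain ⟨h, hh, s, hs, a, ha⟩ := hex
  have h1 := (feasible_of_succeeds h𝒜 hc hG h hh).1 s hs a ha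
  have h2 := (hG.penalty_admissible h hh s hs a ha).1
  have h3 : M.reward h s a ≤ 1 := (M.reward_mem h hh s a).2
  have h4 : 0 ≤ 𝒜.g M x h s a :=
    add_nonneg (le_max_right _ _)
      (mul_nonneg (hα h hh) (add_nonneg (invNorm_nonneg _ _) (invNorm_nonneg _ _)))
  have h5 : c / 𝒜.S ≤ 1 := by linarith [hG.eps2_ge]
  rwa [div_le_one h𝒜.S_pos] at h5

theorem rbar_mem_Icc {h : ℕ} (hh : h < H) (s : X) (a : A) :
    𝒜.rbar M x h s a ∈ Set.Icc (0 : ℝ) 1 := by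
  unfold Attack.rbar
  split_ifs
  · exact M.reward_mem h hh s a
  · exact ⟨le_max_left _ _, max_le zero_le_one (min_le_left _ _)⟩

theorem measurable_rbar (hA : MeasurableSet (Set.diagonal A)) (h𝒜 : 𝒜.IsValid M) {h : ℕ}
    (hh : h < H) : Measurable fun q : X × A => 𝒜.rbar M x h q.1 q.2 := by
  classical
  have hr := measurable_reward (M := M) hh
  refine Measurable.ite (measurableSet_eq_target hA (h𝒜.measurable_target h hh)) hr ?_
  exact measurable_const.max (measurable_const.min
    (hr.sub ((M.measurable_φ h hh).inner measurable_const)))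

/-- The reference reward makes every certified non-target action worse than the target action by
at least `ε₂⋆`: the penalty pays for the estimated advantage and for both confidence widths. -/
theorem rbar_add_le_targetValue [MeasurableSingletonClass A] (h𝒜 : 𝒜.IsValid M) (hc : 0 < c)
    (hG : Succeeds M 𝒜 T δ κ cexc c p x)
    (hw : ∀ h < H, ∀ s a, M.Q M.reward 𝒜.targetPolicy h s a = ⟪M.φ h s a, w h⟫)
    (hconf : ∀ h < H, ∀ z,
      |⟪z, 𝒜.what M x h - w h⟫| ≤ 𝒜.α h * invNorm (𝒜.design2 M x h) z)
    {h : ℕ} (hh : h < H) {s : X} (hs : s ∈ 𝒜.supp h) (a : A) :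
    𝒜.rbar M x h s a + c / 𝒜.S * offTarget 𝒜.target h s a
      + ∫ s', targetValue 𝒜 M (H - (h + 1)) (h + 1) s' ∂(M.P h (s, a))
      ≤ targetValue 𝒜 M (H - h) h s := by
  rw [targetValue_eq_Q hh]
  by_cases ha : a = 𝒜.target h s
  · rw [Attack.rbar, if_pos ha, offTarget, if_pos ha, ← ha, Q_eq_add_integral]
    linarith
  · have h1 := (feasible_of_succeeds h𝒜 hc hG h hh).1 s hs a ha
    have h2 := hG.penalty_admissible h hh s hs a ha
    rw [Attack.rbar, if_neg ha, offTarget, if_neg ha, min_eq_right h2.2, max_eq_right h2.1]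
    have hQ := Q_eq_add_integral (M := M) (𝒜 := 𝒜) h s a
    have hQ1 := hw h hh s a
    have hQ2 := hw h hh s (𝒜.target h s)
    have h3 := (abs_le.1 (hconf h hh (M.φ h s a))).1
    have h4 := (abs_le.1 (hconf h hh (𝒜.phiT M h s))).2
    rw [inner_sub_right] at h3 h4
    have h5 : 𝒜.Qhat M x h s a - 𝒜.Qhat M x h s (𝒜.target h s)
        ≤ max (𝒜.Qhat M x h s a - 𝒜.Qhat M x h s (𝒜.target h s)) 0 := le_max_left _ _
    have h6 : 𝒜.Qhat M x h s a = ⟪M.φ h s a, 𝒜.what M x h⟫ := rfl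
    have h7 : 𝒜.Qhat M x h s (𝒜.target h s) = ⟪𝒜.phiT M h s, 𝒜.what M x h⟫ := rfl
    have h8 : ⟪M.φ h s (𝒜.target h s), w h⟫ = ⟪𝒜.phiT M h s, w h⟫ := rfl
    rw [Attack.g] at h1
    linarith [hG.eps2_ge]

/-- The pseudo-regret dominates the expected number of non-target actions. -/
theorem mul_sum_devValue_le_regret2 (hA : MeasurableSet (Set.diagonal A)) (h𝒜 : 𝒜.IsValid M)
    (hL : ∀ t h, IsMarkovKernel (L t h)) (hH : 1 ≤ H) (hc : 0 < c)
    (hG : Succeeds M 𝒜 T δ κ cexc c p x)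
    (hw : ∀ h < H, ∀ s a, M.Q M.reward 𝒜.targetPolicy h s a = ⟪M.φ h s a, w h⟫)
    (hconf : ∀ h < H, ∀ z,
      |⟪z, 𝒜.what M x h - w h⟫| ≤ 𝒜.α h * invNorm (𝒜.design2 M x h) z)
    (hsupp : ∀ t < T, ∀ h < H, (x t h).1 ∈ 𝒜.supp h) :
    c / 𝒜.S * ∑ t ∈ Finset.Ico 𝒜.T₁ T, devValue 𝒜 M L t H 0 (observed 𝒜 M x t) (x t 0).1
      ≤ regret2 L 𝒜 M T x := by
  have := measurableSingletonClass_of_diagonal hA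
  rw [Finset.mul_sum]
  refine Finset.sum_le_sum fun t ht => ?_
  have hsup := value_add_mul_le_of_supersolution (H := H) (r := 𝒜.rbar M x)
    (r' := offTarget 𝒜.target) (c := H) (ε := c / 𝒜.S)
    M.markov_P (fun h hh => measurable_rbar hA h𝒜 hh)
    (fun h hh => measurable_offTarget hA (h𝒜.measurable_target h hh))
    (fun h hh s a => by
      have := rbar_mem_Icc (M := M) (𝒜 := 𝒜) (x := x) hh s a
      rw [abs_of_nonneg this.1]; exact this.2)
    (fun h _ s a => abs_offTarget_le _ _ _ _)
    (isPolicyFamily_learner hL t) (observed 𝒜 M x t) h𝒜.closed_supp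
    (W := fun h => targetValue 𝒜 M (H - h) h)
    (fun h hh => measurable_targetValue h𝒜 (by omega))
    (fun h hh s => by
      have := targetValue_mem_Icc (M := M) h𝒜 (n := H - h) (h := h) (by omega) s
      rw [abs_of_nonneg this.1]
      exact this.2.trans (by exact_mod_cast Nat.sub_le H h))
    (fun s => by simp [targetValue, value])
    (fun h hh s hs a => rbar_add_le_targetValue h𝒜 hc hG hw hconf hh hs a)
    H 0 (by omega) (x t 0).1
    (by rw [if_pos (by omega)]; exact hsupp t (Finset.mem_Ico.1 ht).2 0 (by omega))
  have hV : M.V (𝒜.rbar M x) 𝒜.targetPolicy 0 (x t 0).1 = targetValue 𝒜 M H 0 (x t 0).1 :=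
    value_target_congr M.P 𝒜 (fun h s => by rw [Attack.rbar, if_pos rfl]) H 0 _
  have hsup' : M.V (𝒜.rbar M x) (fun h => policy L 𝒜 M x t h) 0 (x t 0).1
      + c / 𝒜.S * devValue 𝒜 M L t H 0 (observed 𝒜 M x t) (x t 0).1
      ≤ targetValue 𝒜 M H 0 (x t 0).1 := hsup
  rw [hV]
  linarith

theorem abs_sub_le_one {a b : ℝ} (ha : a ∈ Set.Icc (0 : ℝ) 1) (hb : b ∈ Set.Icc (0 : ℝ) 1) :
    |a - b| ≤ 1 := by
  rw [abs_le]
  constructor <;> linarith [ha.1, ha.2, hb.1, hb.2]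

/-- The cost is paid by Stage 1, by the compensation, and by one unit per non-target action. -/
theorem cost_le (h𝒜 : 𝒜.IsValid M) (hc : 0 < c) (hT : 𝒜.T₁ ≤ T)
    (hG : Succeeds M 𝒜 T δ κ cexc c p x) :
    𝒜.cost M T x ≤ 2 * (H * 𝒜.T₁) + ∑ t ∈ Finset.Ico 𝒜.T₁ T, devCount 𝒜 H 0 (x t) := by
  have hpos : 0 < 𝒜.eps2 M x := (div_pos hc h𝒜.S_pos).trans_le hG.eps2_ge
  unfold Attack.cost
  rw [← Finset.sum_range_add_sum_Ico _ hT]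
  have h1 : ∑ t ∈ Finset.range 𝒜.T₁, ∑ h ∈ Finset.range H,
      |M.reward h (x t h).1 (x t h).2 - 𝒜.fed M x t h| ≤ H * 𝒜.T₁ := by
    refine (Finset.sum_le_card_nsmul _ _ (H : ℝ) fun t ht => ?_).trans (by simp [mul_comm])
    refine (Finset.sum_le_card_nsmul _ _ (1 : ℝ) fun h hh => ?_).trans (by simp)
    have hh' := Finset.mem_range.1 hh
    exact abs_sub_le_one (M.reward_mem h hh' _ _)
      (hG.fed_admissible t ((Finset.mem_range.1 ht).trans_le hT) h hh')
  have h2 : ∑ t ∈ Finset.Ico 𝒜.T₁ T, ∑ h ∈ Finset.range H,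
      |M.reward h (x t h).1 (x t h).2 - 𝒜.fed M x t h|
      ≤ ∑ t ∈ Finset.Ico 𝒜.T₁ T, (∑ h ∈ Finset.range H, |𝒜.c x t h| + devCount 𝒜 H 0 (x t)) := by
    refine Finset.sum_le_sum fun t ht => ?_
    rw [devCount, ← Finset.range_eq_Ico, ← Finset.sum_add_distrib]
    refine Finset.sum_le_sum fun h hh => ?_
    have hh' := Finset.mem_range.1 hh
    have hfed := hG.fed_admissible t (Finset.mem_Ico.1 ht).2 h hh'
    have hle := abs_sub_le_one (M.reward_mem h hh' (x t h).1 (x t h).2) hfed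
    have ht' : ¬ t < 𝒜.T₁ := by have := (Finset.mem_Ico.1 ht).1; omega
    by_cases ha : (x t h).2 = 𝒜.target h (x t h).1
    · rw [Attack.fed, if_neg ht', if_pos ⟨hG.certified, hpos⟩, if_pos ha, offTarget, if_pos ha]
      rw [show ∀ r c : ℝ, r - (r + c) = -c from fun r c => by ring, abs_neg, add_zero]
    · rw [offTarget, if_neg ha]
      exact hle.trans (by linarith [abs_nonneg (𝒜.c x t h)])
  rw [Finset.sum_add_distrib] at h2
  linarith [hG.mass_le]

/-- Every episode outside Stage 1 without non-target action follows the target policy. -/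
theorem sub_le_followCount {X A : Type*} {d H T : ℕ} {𝒜 : Attack X A d} {x : Traj X A}
    (hT : 𝒜.T₁ ≤ T) (hsupp : ∀ t < T, ∀ h < H, (x t h).1 ∈ 𝒜.supp h) :
    (T : ℝ) - 𝒜.T₁ - ∑ t ∈ Finset.Ico 𝒜.T₁ T, devCount 𝒜 H 0 (x t) ≤ 𝒜.followCount H T x := by
  classical
  set F : Finset ℕ := (Finset.range T).filter fun t =>
    ∀ h < H, (x t h).1 ∈ 𝒜.supp h ∧ (x t h).2 = 𝒜.target h (x t h).1 with hF
  have hcard : (𝒜.followCount H T x : ℝ) = F.card := by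
    rw [Attack.followCount, hF]
  have h1 : (T : ℝ) - 𝒜.T₁ = ∑ t ∈ Finset.Ico 𝒜.T₁ T, (1 : ℝ) := by
    simp [Nat.cast_sub hT]
  have h2 : ∑ t ∈ Finset.Ico 𝒜.T₁ T, (1 - devCount 𝒜 H 0 (x t))
      ≤ ∑ t ∈ Finset.Ico 𝒜.T₁ T, (if t ∈ F then (1 : ℝ) else 0) := by
    refine Finset.sum_le_sum fun t ht => ?_
    have htT := (Finset.mem_Ico.1 ht).2
    by_cases hf : t ∈ F
    · rw [if_pos hf]
      linarith [devCount_nonneg (𝒜 := 𝒜) (H := H) 0 (x t)]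
    · rw [if_neg hf]
      have : ∃ h < H, (x t h).2 ≠ 𝒜.target h (x t h).1 := by
        by_contra hne
        push Not at hne
        exact hf (Finset.mem_filter.2 ⟨Finset.mem_range.2 htT,
          fun h hh => ⟨hsupp t htT h hh, hne h hh⟩⟩)
      obtain ⟨h, hh, hne⟩ := this
      have h3 : offTarget 𝒜.target h (x t h).1 (x t h).2 ≤ devCount 𝒜 H 0 (x t) :=
        Finset.single_le_sum (f := fun j => offTarget 𝒜.target j (x t j).1 (x t j).2)
          (fun j _ => offTarget_nonneg _ _ _ _) (Finset.mem_Ico.2 ⟨Nat.zero_le h, hh⟩)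
      rw [offTarget, if_neg hne] at h3
      linarith
  have h4 : ∑ t ∈ Finset.Ico 𝒜.T₁ T, (if t ∈ F then (1 : ℝ) else 0) ≤ F.card := by
    rw [Finset.sum_ite_mem, Finset.sum_const, nsmul_eq_mul, mul_one]
    exact_mod_cast Finset.card_le_card Finset.inter_subset_right
  rw [Finset.sum_sub_distrib] at h2
  rw [hcard, h1]
  linarith

theorem corruption_le : 𝒜.corruption H x ≤ H * ((𝒜.T₁ : ℝ) - (𝒜.clean M x).card) := by
  classical
  have hsub : 𝒜.clean M x ⊆ Finset.range 𝒜.T₁ := fun k hk =>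
    Finset.mem_range.2 (mem_clean_lt 𝒜 M hk)
  have hcard : ((Finset.range 𝒜.T₁ \ 𝒜.clean M x).card : ℝ) = 𝒜.T₁ - (𝒜.clean M x).card := by
    rw [Finset.card_sdiff_of_subset hsub, Finset.card_range, Nat.cast_sub card_clean_le]
  rw [← hcard, Attack.corruption, ← Finset.sum_sdiff hsub]
  have h1 : ∑ t ∈ 𝒜.clean M x, ∑ h ∈ Finset.range H, (if 𝒜.Deviates x t h then (1 : ℝ) else 0)
      = 0 :=
    Finset.sum_eq_zero fun t ht => Finset.sum_eq_zero fun h hh =>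
      if_neg (((mem_clean 𝒜 M).1 ht).2.2 h (Finset.mem_range.1 hh))
  rw [h1, add_zero]
  refine (Finset.sum_le_card_nsmul _ _ (H : ℝ) fun t _ => ?_).trans (by simp [mul_comm])
  refine (Finset.sum_le_card_nsmul _ _ (1 : ℝ) fun h _ => ?_).trans (by simp)
  split_ifs <;> norm_num

theorem gammaTar_le (hG : Succeeds M 𝒜 T δ κ cexc c p x) (hcexc : 0 < cexc)
    (hn : 0 < (𝒜.clean M x).card)
    (hw : ∀ h < H, ∀ s a, M.Q M.reward 𝒜.targetPolicy h s a = ⟪M.φ h s a, w h⟫)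
    (hconf : ∀ h < H, ∀ z,
      |⟪z, 𝒜.what M x h - w h⟫| ≤ 𝒜.α h * invNorm (𝒜.design2 M x h) z)
    {a : ℝ} (ha0 : 0 ≤ a) (ha : ∀ h < H, 𝒜.α h ≤ a) :
    𝒜.gammaTar M x ≤ a * (1 / √(cexc * (𝒜.clean M x).card)) := by
  have hr : 0 ≤ a * (1 / √(cexc * (𝒜.clean M x).card)) := by positivity
  refine Real.iSup_le (fun h => Real.iSup_le (fun s => ?_) hr) hr
  rw [hw h h.2, Attack.Qhat, ← inner_sub_right]
  exact (hconf h h.2 _).trans (mul_le_mul (ha h h.2) (invNorm_target_le hG hcexc hn h.2 s.2)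
    (invNorm_nonneg _ _) ha0)

/-- Collecting the three regret contributions: the cold-start term, the Stage 1 corruption and the
target-side mismatch. Here `a = √T`, `b = √T₁`, `sd = √d`, `sH = √H`. -/
theorem regret_terms_le {S d sd H sH a b κ B L₀ S₀ γ : ℝ} (hS : 0 ≤ S) (hd : 0 ≤ d)
    (hsd : 1 ≤ sd) (hH : 1 ≤ H) (hsH : 1 ≤ sH) (ha : 0 ≤ a) (hb : 1 ≤ b) (hκ : 0 ≤ κ)
    (hB : 0 ≤ B) (hL : 1 ≤ L₀) (hS₀ : S₀ ≤ H * (κ * b * L₀)) (hγ : γ ≤ B * H * sd * L₀ / b) :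
    S * (d * (H * sH) * a * (1 + S₀ + γ * a))
      ≤ (1 + κ + B) * L₀ * ((d * sd) * (H ^ 2 * sH) * S * (a * b + a ^ 2 / b)) := by
  have hHsd : 1 ≤ H * sd := one_le_mul_of_one_le_of_one_le hH hsd
  have hb0 : 0 < b := by linarith
  have h1 : a ≤ H * sd * (a * b) * L₀ := by
    calc a = 1 * (a * 1) * 1 := by ring
      _ ≤ H * sd * (a * b) * L₀ := by gcongr
  have h2 : a * S₀ ≤ κ * (H * sd * (a * b) * L₀) := by
    calc a * S₀ ≤ a * (H * (κ * b * L₀)) := by gcongr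
      _ = κ * (H * 1 * (a * b) * L₀) := by ring
      _ ≤ κ * (H * sd * (a * b) * L₀) := by gcongr
  have h3 : a * (γ * a) ≤ B * (H * sd * (a ^ 2 / b) * L₀) := by
    calc a * (γ * a) ≤ a * (B * H * sd * L₀ / b * a) := by gcongr
      _ = _ := by field_simp
  have h4 : 0 ≤ H * sd * (a * b) * L₀ := by positivity
  have h5 : 0 ≤ H * sd * (a ^ 2 / b) * L₀ := by positivity
  have h6 : a * (1 + S₀ + γ * a) ≤ (1 + κ + B) * (H * sd * (a * b + a ^ 2 / b) * L₀) := by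
    have e : (1 + κ + B) * (H * sd * (a * b + a ^ 2 / b) * L₀)
        = (1 + κ + B) * (H * sd * (a * b) * L₀) + (1 + κ + B) * (H * sd * (a ^ 2 / b) * L₀) := by
      ring
    rw [e]
    nlinarith [mul_nonneg hB h4, mul_nonneg hκ h5]
  calc S * (d * (H * sH) * a * (1 + S₀ + γ * a))
      = S * d * (H * sH) * (a * (1 + S₀ + γ * a)) := by ring
    _ ≤ S * d * (H * sH) * ((1 + κ + B) * (H * sd * (a * b + a ^ 2 / b) * L₀)) := by gcongr
    _ = _ := by ring

theorem one_div_sqrt_le {c T₁ n : ℝ} (hc : 0 < c) (hT₁ : 0 < T₁) (hn : T₁ ≤ 2 * n) :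
    1 / √(c * n) ≤ √(2 / c) / √T₁ := by
  have hn0 : 0 < n := by linarith
  rw [div_le_div_iff₀ (Real.sqrt_pos.2 (by positivity)) (Real.sqrt_pos.2 hT₁), one_mul,
    ← Real.sqrt_mul (by positivity)]
  refine Real.sqrt_le_sqrt (hn.trans (le_of_eq ?_))
  field_simp

/-- On the success event, the number of non-target actions of the second stage has the order of the
claimed cost. -/
theorem sum_devCount_le (hA : MeasurableSet (Set.diagonal A)) (h𝒜 : 𝒜.IsValid M)
    (hL : ∀ t h, IsMarkovKernel (L t h)) (hd : 1 ≤ d) (hH : 1 ≤ H) (hT : 𝒜.T₁ ≤ T)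
    (hδ : 0 < δ) (hδ1 : δ < 1) {Cwr Cα : ℝ} {r : ℕ} (hκ : 0 < κ) (hcexc : 0 < cexc) (hc : 0 < c)
    (hCwr : 0 < Cwr) (hG : Succeeds M 𝒜 T δ κ cexc c p x)
    (hw : ∀ h < H, ∀ s a, M.Q M.reward 𝒜.targetPolicy h s a = ⟪M.φ h s a, w h⟫)
    (hconf : ∀ h < H, ∀ z,
      |⟪z, 𝒜.what M x h - w h⟫| ≤ 𝒜.α h * invNorm (𝒜.design2 M x h) z)
    (hα : ∀ h < H, 0 ≤ 𝒜.α h)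
    (hαC : ∀ h < H, 𝒜.α h ≤ Cα * H * √(d : ℝ) * logFactor d H T δ ^ r)
    (hsupp : ∀ t < T, ∀ h < H, (x t h).1 ∈ 𝒜.supp h)
    (hreg : regret2 L 𝒜 M T x ≤ Cwr * d * (H : ℝ) ^ (3 / 2 : ℝ) * √(T : ℝ) *
      (1 + 𝒜.corruption H x + 𝒜.gammaTar M x * √(T : ℝ)))
    (hdev : ∑ t ∈ Finset.Ico 𝒜.T₁ T, devCount 𝒜 H 0 (x t)
      ≤ (Real.exp 1 - 1) * (∑ t ∈ Finset.Ico 𝒜.T₁ T,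
          devValue 𝒜 M L t H 0 (observed 𝒜 M x t) (x t 0).1) + H * Real.log (1 / δ)) :
    ∑ t ∈ Finset.Ico 𝒜.T₁ T, devCount 𝒜 H 0 (x t)
      ≤ (1 + 2 * Cwr / c * (1 + κ + |Cα| * √(2 / cexc)) + 2 * κ / c)
        * logFactor d H T δ ^ (p + r + 1) *
        ((H : ℝ) * 𝒜.T₁ + (d : ℝ) ^ (3 / 2 : ℝ) * (H : ℝ) ^ (5 / 2 : ℝ) * 𝒜.S *
          (√((T : ℝ) * 𝒜.T₁) + (T : ℝ) / √(𝒜.T₁ : ℝ))) := by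
  have hT₁ : (1 : ℝ) ≤ 𝒜.T₁ := by exact_mod_cast h𝒜.T₁_pos
  have hT1 : 1 ≤ T := h𝒜.T₁_pos.trans hT
  have hTR : (1 : ℝ) ≤ T := by exact_mod_cast hT1
  have hd' : (1 : ℝ) ≤ d := by exact_mod_cast hd
  have hH' : (1 : ℝ) ≤ H := by exact_mod_cast hH
  have hL1 : 1 ≤ logFactor d H T δ := one_le_logFactor hd hH hT1 hδ hδ1
  have hlog : Real.log (1 / δ) ≤ logFactor d H T δ :=
    (log_le_logFactor hd hH hT1 hδ).2.trans (by linarith)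
  have hcS := le_S_of_succeeds h𝒜 hc hα hG
  have hS := h𝒜.S_pos
  set Lf := logFactor d H T δ with hLf
  set L₀ := Lf ^ (p + r + 1) with hL₀
  set N := ∑ t ∈ Finset.Ico 𝒜.T₁ T, devCount 𝒜 H 0 (x t) with hN
  have hLL : Lf ≤ L₀ := by simpa using pow_le_pow_right₀ hL1 (show 1 ≤ p + r + 1 by omega)
  have hLp : Lf ^ p ≤ L₀ := pow_le_pow_right₀ hL1 (by omega)
  have hLr : Lf ^ r ≤ L₀ := pow_le_pow_right₀ hL1 (by omega)
  have hL₀1 : 1 ≤ L₀ := hL1.trans hLL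
  have hr3 : (H : ℝ) ^ (3 / 2 : ℝ) = H * √(H : ℝ) := by
    rw [show (3 / 2 : ℝ) = 1 + 1 / 2 by norm_num, Real.rpow_add (by linarith), Real.rpow_one,
      Real.sqrt_eq_rpow]
  have hr3d : (d : ℝ) ^ (3 / 2 : ℝ) = d * √(d : ℝ) := by
    rw [show (3 / 2 : ℝ) = 1 + 1 / 2 by norm_num, Real.rpow_add (by linarith), Real.rpow_one,
      Real.sqrt_eq_rpow]
  have hr5 : (H : ℝ) ^ (5 / 2 : ℝ) = (H : ℝ) ^ 2 * √(H : ℝ) := by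
    rw [show (5 / 2 : ℝ) = 2 + 1 / 2 by norm_num, Real.rpow_add (by linarith), Real.sqrt_eq_rpow]
    norm_num
  rw [hr3d, hr5, Real.sqrt_mul (by linarith)]
  rw [hr3] at hreg
  set sd := √(d : ℝ) with hsd
  set sH := √(H : ℝ) with hsH
  set a := √(T : ℝ) with ha
  set b := √(𝒜.T₁ : ℝ) with hb
  have hsd1 : 1 ≤ sd := Real.one_le_sqrt.2 hd'
  have hsH1 : 1 ≤ sH := Real.one_le_sqrt.2 hH'
  have ha1 : 1 ≤ a := Real.one_le_sqrt.2 hTR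
  have hb1 : 1 ≤ b := Real.one_le_sqrt.2 hT₁
  have hb0 : 0 < b := by linarith
  have haT : (T : ℝ) = a ^ 2 := (Real.sq_sqrt (by linarith)).symm
  rw [haT]
  clear_value a b sd sH L₀ Lf
  set F := (d * sd) * ((H : ℝ) ^ 2 * sH) * 𝒜.S * (a * b + a ^ 2 / b) with hF
  have hF0 : 0 ≤ F := by positivity
  have hHT : 0 ≤ (H : ℝ) * 𝒜.T₁ := by positivity
  have hC1 : 0 ≤ 2 * Cwr / c * (1 + κ + |Cα| * √(2 / cexc)) := by positivity
  have hC2 : 0 ≤ 2 * κ / c := by positivity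
  by_cases hcase : (𝒜.T₁ : ℝ) ≤ 2 * (𝒜.clean M x).card
  · have hnR : (0 : ℝ) < (𝒜.clean M x).card := by linarith
    have hn : 0 < (𝒜.clean M x).card := by exact_mod_cast hnR
    have hS₀ : 𝒜.corruption H x ≤ H * (κ * b * L₀) := by
      refine (corruption_le (M := M)).trans (mul_le_mul_of_nonneg_left ?_ (by linarith))
      have h1 := hG.clean_length
      rw [← hLf, ← hb] at h1
      have h2 : κ * b * Lf ^ p ≤ κ * b * L₀ := by gcongr
      linarith
    have hγ : 𝒜.gammaTar M x ≤ |Cα| * √(2 / cexc) * H * sd * L₀ / b := by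
      have h1 := gammaTar_le hG hcexc hn hw hconf (a := |Cα| * H * sd * L₀) (by positivity)
        fun h hh => (hαC h hh).trans (by gcongr; exact le_abs_self _)
      have h2 : 1 / √(cexc * (𝒜.clean M x).card) ≤ √(2 / cexc) / b := by
        rw [hb]
        exact one_div_sqrt_le hcexc (by linarith) hcase
      calc 𝒜.gammaTar M x ≤ |Cα| * H * sd * L₀ * (1 / √(cexc * (𝒜.clean M x).card)) := h1
        _ ≤ |Cα| * H * sd * L₀ * (√(2 / cexc) / b) := by gcongr
        _ = _ := by ring
    have hterms := regret_terms_le hS.le (by linarith : (0 : ℝ) ≤ d) hsd1 hH' hsH1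
      (by linarith : 0 ≤ a) hb1 hκ.le (by positivity : 0 ≤ |Cα| * √(2 / cexc)) hL₀1 hS₀ hγ
    rw [← hF] at hterms
    have hE := mul_sum_devValue_le_regret2 hA h𝒜 hL hH hc hG hw hconf hsupp
    set E := ∑ t ∈ Finset.Ico 𝒜.T₁ T, devValue 𝒜 M L t H 0 (observed 𝒜 M x t) (x t 0).1 with hEdef
    have hE0 : 0 ≤ E := Finset.sum_nonneg fun t _ => devValue_nonneg (by omega) _ _
    have hE2 : E ≤ Cwr / c * ((1 + κ + |Cα| * √(2 / cexc)) * L₀ * F) := by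
      have h1 := hE.trans hreg
      have h2 : E = 𝒜.S / c * (c / 𝒜.S * E) := by field_simp
      rw [h2]
      calc 𝒜.S / c * (c / 𝒜.S * E) ≤ 𝒜.S / c * (Cwr * d * (H * sH) * a *
            (1 + 𝒜.corruption H x + 𝒜.gammaTar M x * a)) := by gcongr
        _ = Cwr / c * (𝒜.S * (d * (H * sH) * a *
            (1 + 𝒜.corruption H x + 𝒜.gammaTar M x * a))) := by ring
        _ ≤ _ := by gcongr
    have he : Real.exp 1 - 1 ≤ 2 := by linarith [Real.exp_one_lt_d9]
    have h3 : (Real.exp 1 - 1) * E ≤ 2 * E := by gcongr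
    have h4 : (H : ℝ) * Real.log (1 / δ) ≤ L₀ * (H * 𝒜.T₁) := by
      calc (H : ℝ) * Real.log (1 / δ) ≤ H * L₀ := by gcongr; exact hlog.trans hLL
        _ = L₀ * (H * 1) := by ring
        _ ≤ L₀ * (H * 𝒜.T₁) := by gcongr
    have h5 : N ≤ 2 * (Cwr / c * ((1 + κ + |Cα| * √(2 / cexc)) * L₀ * F)) + L₀ * (H * 𝒜.T₁) := by
      linarith
    refine h5.trans ?_
    have h6 : 0 ≤ L₀ * F := mul_nonneg (by linarith) hF0
    have h7 : 0 ≤ L₀ * ((H : ℝ) * 𝒜.T₁) := mul_nonneg (by linarith) hHT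
    generalize (1 + κ + |Cα| * √(2 / cexc)) = Q at hC1 ⊢
    clear_value F
    have h8 := mul_nonneg hC1 h7
    have h9 := mul_nonneg hC2 (add_nonneg h6 h7)
    have e : (1 + 2 * Cwr / c * Q + 2 * κ / c) * L₀ * (H * 𝒜.T₁ + F)
        = 2 * (Cwr / c * (Q * L₀ * F)) + L₀ * (H * 𝒜.T₁) + L₀ * F
          + 2 * Cwr / c * Q * (L₀ * (H * 𝒜.T₁))
          + 2 * κ / c * (L₀ * F + L₀ * (H * 𝒜.T₁)) := by ring
    rw [e]
    linarith
  · -- few clean episodes: `√T₁` is of logarithmic size and the trivial bound `H T` suffices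
    have hsq := sqrt_le_of_card_clean_lt hG h𝒜 (by rw [not_le] at hcase; exact hcase)
    rw [← hb, ← hLf] at hsq
    have hNT : N ≤ H * T := by
      refine (Finset.sum_le_card_nsmul _ _ (H : ℝ) fun t _ => devCount_le _ _).trans ?_
      rw [Nat.card_Ico, nsmul_eq_mul, mul_comm]
      gcongr
      exact Nat.sub_le _ _
    have h1 : (T : ℝ) ≤ 2 * κ * L₀ * (a ^ 2 / b) := by
      calc (T : ℝ) = b * (a ^ 2 / b) := by rw [haT]; field_simp
        _ ≤ (2 * κ * Lf ^ p) * (a ^ 2 / b) := by gcongr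
        _ ≤ _ := by gcongr
    have h2 : (H : ℝ) * (a ^ 2 / b) ≤ F / c := by
      rw [le_div_iff₀ hc, hF]
      calc (H : ℝ) * (a ^ 2 / b) * c = (1 * 1) * ((H * 1) * 1) * c * (0 + a ^ 2 / b) := by ring
        _ ≤ (d * sd) * ((H * H) * sH) * 𝒜.S * (a * b + a ^ 2 / b) := by
            gcongr
            positivity
        _ = _ := by ring
    calc N ≤ H * (2 * κ * L₀ * (a ^ 2 / b)) := hNT.trans (by gcongr)
      _ = 2 * κ * L₀ * (H * (a ^ 2 / b)) := by ring
      _ ≤ 2 * κ * L₀ * (F / c) := by gcongr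
      _ = (0 + 2 * κ / c) * L₀ * (0 + F) := by ring
      _ ≤ _ := by
          gcongr
          all_goals positivity

/-- The balanced choice `T₁ ≍ √T` of the length of the first stage. -/
theorem balanced_le {d H : ℕ} {T₁ T : ℝ} {S b c : ℝ} (hd : 1 ≤ d) (hH : 1 ≤ H) (hT₁ : 1 ≤ T₁)
    (hT : 1 ≤ T) (hc : 0 < c) (hcS : c ≤ S) (hb : 0 < b) (h1 : √T ≤ b * T₁) (h2 : T₁ ≤ b * √T) :
    (H : ℝ) * T₁ + (d : ℝ) ^ (3 / 2 : ℝ) * (H : ℝ) ^ (5 / 2 : ℝ) * S * (√(T * T₁) + T / √T₁)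
      ≤ (b / c + 2 * √b) *
        ((d : ℝ) ^ (3 / 2 : ℝ) * (H : ℝ) ^ (5 / 2 : ℝ) * S * T ^ (3 / 4 : ℝ)) := by
  have hd' : (1 : ℝ) ≤ d := by exact_mod_cast hd
  have hH' : (1 : ℝ) ≤ H := by exact_mod_cast hH
  have hHY : (H : ℝ) * c ≤ (d : ℝ) ^ (3 / 2 : ℝ) * (H : ℝ) ^ (5 / 2 : ℝ) * S := by
    have e1 : (1 : ℝ) ≤ (d : ℝ) ^ (3 / 2 : ℝ) := Real.one_le_rpow hd' (by norm_num)
    have e2 : (H : ℝ) ≤ (H : ℝ) ^ (5 / 2 : ℝ) := by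
      simpa using Real.rpow_le_rpow_of_exponent_le hH' (show (1 : ℝ) ≤ 5 / 2 by norm_num)
    calc (H : ℝ) * c = 1 * H * c := by ring
      _ ≤ _ := by gcongr
  set Y := (d : ℝ) ^ (3 / 2 : ℝ) * (H : ℝ) ^ (5 / 2 : ℝ) * S with hY
  have hY0 : 0 ≤ Y := le_trans (by positivity) hHY
  have hr : T ^ (3 / 4 : ℝ) = √T * √√T := by
    rw [Real.sqrt_eq_rpow, Real.sqrt_eq_rpow, ← Real.rpow_mul (by linarith),
      ← Real.rpow_add (by linarith)]
    norm_num
  rw [hr, Real.sqrt_mul (by linarith)]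
  set a := √T with ha
  have ha1 : 1 ≤ a := Real.one_le_sqrt.2 hT
  have hsa1 : 1 ≤ √a := Real.one_le_sqrt.2 ha1
  have hb1 : 0 < √T₁ := Real.sqrt_pos.2 (by linarith)
  have haT : T = a * a := (Real.mul_self_sqrt (by linarith)).symm
  have hsT : √T₁ ≤ √b * √a := by
    rw [← Real.sqrt_mul hb.le]; exact Real.sqrt_le_sqrt h2
  have hsa : √a ≤ √b * √T₁ := by
    rw [← Real.sqrt_mul hb.le]; exact Real.sqrt_le_sqrt h1
  have p1 : (H : ℝ) * T₁ ≤ b / c * (Y * (a * √a)) := by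
    calc (H : ℝ) * T₁ ≤ H * (b * a) := by gcongr
      _ = b / c * ((H * c) * (a * 1)) := by field_simp
      _ ≤ _ := by gcongr
  have p2 : a * √T₁ ≤ √b * (a * √a) := by
    calc a * √T₁ ≤ a * (√b * √a) := by gcongr
      _ = _ := by ring
  have p3 : T / √T₁ ≤ √b * (a * √a) := by
    rw [div_le_iff₀ hb1]
    calc T = a * (√a * √a) := by rw [Real.mul_self_sqrt (by linarith), haT]
      _ ≤ a * ((√b * √T₁) * √a) := by gcongr
      _ = _ := by ring
  have p4 : Y * (a * √T₁ + T / √T₁) ≤ Y * (2 * (√b * (a * √a))) := by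
    gcongr
    linarith
  linarith

end outcome

end BlackBox

theorem mainTheorem2
    (κ cexc c Cwr b : ℝ) (p : ℕ)
    (hκ : 0 < κ) (hcexc : 0 < cexc) (hc : 0 < c) (hCwr : 0 < Cwr) (hb : 0 < b) :
    ∃ (K : ℝ) (k : ℕ), 0 < K ∧ ∀ (Cα : ℝ) (r : ℕ), ∃ (C : ℝ) (l : ℕ),
      ∀ (X A : Type*) [MeasurableSpace X] [MeasurableSpace A],
      MeasurableSet (Set.diagonal A) →
      ∀ (d H T : ℕ) (δ : ℝ), 1 ≤ d → 1 ≤ H → 0 < δ → δ < 1 →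
      ∀ (M : BlackBox.LinearMDP X A d H) (𝒜 : BlackBox.Attack X A d)
        (L : BlackBox.Learner X A H) (μ : MeasureTheory.Measure (BlackBox.Traj X A))
        (w : ℕ → BlackBox.Vec d),
      MeasureTheory.IsProbabilityMeasure μ →
      (∀ t h, ProbabilityTheory.IsMarkovKernel (L t h)) →
      𝒜.IsValid M → 𝒜.T₁ ≤ T → c / 𝒜.S ≤ 𝒜.η₁ →
      BlackBox.IsInteraction M 𝒜 L T μ →
      -- Stage 2 confidence radii: `w h` is a coefficient vector of `Q_h^{π†,r}`
      (∀ h < H, ∀ s a, M.Q M.reward 𝒜.targetPolicy h s a = inner ℝ (M.φ h s a) (w h)) →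
      (∀ h < H, √𝒜.lam * ‖w h‖ + K * H * √(d : ℝ) * BlackBox.logFactor d H T δ ^ k ≤ 𝒜.α h) →
      (∀ h < H, 𝒜.α h ≤ Cα * H * √(d : ℝ) * BlackBox.logFactor d H T δ ^ r) →
      -- warm-start regret interface of the learner
      μ {x | BlackBox.Succeeds M 𝒜 T δ κ cexc c p x ∧
          ¬ BlackBox.regret2 L 𝒜 M T x ≤
            Cwr * d * (H : ℝ) ^ (3 / 2 : ℝ) * √(T : ℝ) *
              (1 + 𝒜.corruption H x + 𝒜.gammaTar M x * √(T : ℝ))} ≤ ENNReal.ofReal δ →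
      μ {x | BlackBox.Succeeds M 𝒜 T δ κ cexc c p x ∧
          ¬ (𝒜.cost M T x ≤ C * BlackBox.logFactor d H T δ ^ l *
                ((H : ℝ) * 𝒜.T₁ + (d : ℝ) ^ (3 / 2 : ℝ) * (H : ℝ) ^ (5 / 2 : ℝ) * 𝒜.S *
                  (√((T : ℝ) * 𝒜.T₁) + (T : ℝ) / √(𝒜.T₁ : ℝ))) ∧
            (√(T : ℝ) ≤ b * 𝒜.T₁ → (𝒜.T₁ : ℝ) ≤ b * √(T : ℝ) →
              𝒜.cost M T x ≤ C * BlackBox.logFactor d H T δ ^ l *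
                ((d : ℝ) ^ (3 / 2 : ℝ) * (H : ℝ) ^ (5 / 2 : ℝ) * 𝒜.S * (T : ℝ) ^ (3 / 4 : ℝ)) ∧
              (T : ℝ) - C * BlackBox.logFactor d H T δ ^ l *
                ((d : ℝ) ^ (3 / 2 : ℝ) * (H : ℝ) ^ (5 / 2 : ℝ) * 𝒜.S * (T : ℝ) ^ (3 / 4 : ℝ))
                ≤ (𝒜.followCount H T x : ℝ)))} ≤ ENNReal.ofReal (4 * δ) := by
  classical
  -- `K` is the constant of `invNorm_clean_noise_le`, `C₂` that of `sum_devCount_le`, `C₃` that of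
  -- `balanced_le`; the additional `2` pays for Stage 1 and the compensation
  set K : ℝ := √(1 + 2 / cexc) * √5 * (3 + κ) + 2 * κ / √cexc with hKdef
  have hK : 0 < K := by
    have : 0 < √cexc := Real.sqrt_pos.2 hcexc
    positivity
  refine ⟨K, p + 1, hK, fun Cα r => ?_⟩
  set C₂ : ℝ := 1 + 2 * Cwr / c * (1 + κ + |Cα| * √(2 / cexc)) + 2 * κ / c with hC₂
  set C₃ : ℝ := b / c + 2 * √b with hC₃
  have hC₂0 : 0 ≤ C₂ := by positivity
  have hC₃0 : 0 ≤ C₃ := by positivity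
  refine ⟨(C₂ + 2) * (1 + C₃), p + r + 1, ?_⟩
  intro X A _ _ hA d H T δ hd hH hδ hδ1 M 𝒜 L μ w hμ hL h𝒜 hT _ hint hw hα hαC hreg
  have hsing := BlackBox.measurableSingletonClass_of_diagonal hA
  have hT1 : 1 ≤ T := h𝒜.T₁_pos.trans hT
  have hL1 := BlackBox.one_le_logFactor hd hH hT1 hδ hδ1
  obtain ⟨hlogH, hlog1⟩ := BlackBox.log_le_logFactor hd hH hT1 hδ
  have hH' : (1 : ℝ) ≤ H := by exact_mod_cast hH
  set Lf := BlackBox.logFactor d H T δ with hLf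
  -- the exceptional events: the regret interface, the count of non-target actions, the regression
  -- noise of each stage (probability `δ / H` each), and leaving the certified support (null)
  set B₁ : Set (BlackBox.Traj X A) := {x | BlackBox.Succeeds M 𝒜 T δ κ cexc c p x ∧
      ¬ BlackBox.regret2 L 𝒜 M T x ≤ Cwr * d * (H : ℝ) ^ (3 / 2 : ℝ) * √(T : ℝ) *
        (1 + 𝒜.corruption H x + 𝒜.gammaTar M x * √(T : ℝ))} with hB₁
  have hdev := BlackBox.devCount_tail (μ := μ) hA hL h𝒜 hH hint (Real.log (1 / δ))
  set B₂ : Set (BlackBox.Traj X A) := {x | (Real.exp 1 - 1) * (∑ t ∈ Finset.Ico 𝒜.T₁ T,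
          BlackBox.devValue 𝒜 M L t H 0 (BlackBox.observed 𝒜 M x t) (x t 0).1)
          + H * Real.log (1 / δ)
        < ∑ t ∈ Finset.Ico 𝒜.T₁ T, BlackBox.devCount 𝒜 H 0 (x t)} with hB₂
  have hℓ0 : 0 ≤ Real.log (H / δ) :=
    Real.log_nonneg (by rw [le_div_iff₀ hδ]; linarith)
  have hdesign : ∀ h : Fin H, _ := fun h =>
    BlackBox.exists_noise_design (μ := μ) hA h𝒜 hint hd hT h.2 hℓ0
  choose V hV hVφ hVq hVtail using hdesign
  set B₃ : Fin H → Set (BlackBox.Traj X A) := fun h =>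
    {x | √(5 * d) * H * (3 / 2 + √(2 * Real.log (H / δ)))
      < BlackBox.invNorm (V h) (BlackBox.noiseSum 𝒜 M h x)} with hB₃
  set B₄ : Set (BlackBox.Traj X A) :=
    {x | ¬ ∀ t < T, ∀ h < H, (x t h).1 ∈ 𝒜.supp h} with hB₄
  have hm₂ : μ B₂ ≤ ENNReal.ofReal δ := by
    refine hdev.trans (le_of_eq ?_)
    rw [one_div, Real.log_inv, neg_neg, Real.exp_log hδ]
  have hm₃ : μ (⋃ h, B₃ h) ≤ ENNReal.ofReal δ := by
    refine (measure_iUnion_fintype_le μ B₃).trans ?_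
    refine (Finset.sum_le_card_nsmul _ _ _ fun h _ => hVtail h).trans (le_of_eq ?_)
    rw [Finset.card_univ, Fintype.card_fin, ← Real.log_inv, Real.exp_log (by positivity),
      ← ENNReal.ofReal_nsmul, nsmul_eq_mul]
    congr 1
    field_simp
  have hm₄ : μ B₄ = 0 := by
    have : ∀ᵐ x ∂μ, ∀ t < T, ∀ h < H, (x t h).1 ∈ 𝒜.supp h := by
      refine ae_all_iff.2 fun t => ?_
      by_cases ht : t < T
      · refine (ae_all_iff.2 fun h => ?_).mono fun x hx _ => hx
        by_cases hh : h < H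
        · exact (BlackBox.ae_mem_supp h𝒜 hint ht h hh).mono fun x hx _ => hx
        · exact ae_of_all _ fun x h' => absurd h' hh
      · exact ae_of_all _ fun x h' => absurd h' ht
    exact this
  refine (measure_mono (t := B₁ ∪ B₂ ∪ (⋃ h, B₃ h) ∪ B₄) ?_).trans ?_
  · rintro x ⟨hG, hbad⟩
    by_contra hx
    simp only [Set.mem_union, Set.mem_iUnion, not_or, not_exists] at hx
    obtain ⟨⟨⟨hx1, hx2⟩, hx3⟩, hx4⟩ := hx
    have hsupp : ∀ t < T, ∀ h < H, (x t h).1 ∈ 𝒜.supp h := not_not.1 hx4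
    have hsupp1 : ∀ t < 𝒜.T₁, ∀ h < H, (x t h).1 ∈ 𝒜.supp h := fun t ht =>
      hsupp t (ht.trans_le hT)
    have hregx := not_not.1 fun hn => hx1 ⟨hG, hn⟩
    rw [hB₂, Set.mem_ofPred_eq, not_lt] at hx2
    have hα0 : ∀ h < H, 0 ≤ 𝒜.α h := fun h hh => le_trans (by positivity) (hα h hh)
    have hconf : ∀ h < H, ∀ z, |inner ℝ z (𝒜.what M x h - w h)|
        ≤ 𝒜.α h * BlackBox.invNorm (𝒜.design2 M x h) z := by
      intro h hh z
      refine BlackBox.abs_inner_what_sub_le h𝒜 hw hsupp1 hh (hα h hh) ?_ z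
      refine BlackBox.invNorm_clean_noise_le h𝒜 hcexc hκ hG hd hL1 hsupp1 hh (hV ⟨h, hh⟩)
        (hVφ ⟨h, hh⟩) (hVq ⟨h, hh⟩) ((not_lt.1 (hx3 ⟨h, hh⟩)).trans ?_)
      have hs : √(2 * Real.log (H / δ)) ≤ 1 + Real.log (H / δ) / 2 :=
        Real.sqrt_le_iff.2 ⟨by positivity, by nlinarith [sq_nonneg (1 - Real.log (H / δ) / 2)]⟩
      gcongr
      linarith
    have hcS := BlackBox.le_S_of_succeeds h𝒜 hc hα0 hG
    have hN := BlackBox.sum_devCount_le hA h𝒜 hL hd hH hT hδ hδ1 hκ hcexc hc hCwr hG hw hconf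
      hα0 hαC hsupp hregx hx2
    have hcost := BlackBox.cost_le h𝒜 hc hT hG
    have hfol := BlackBox.sub_le_followCount hT hsupp
    have hT₁R : (1 : ℝ) ≤ 𝒜.T₁ := by exact_mod_cast h𝒜.T₁_pos
    have hbal := BlackBox.balanced_le (S := 𝒜.S) (b := b) (c := c) hd hH hT₁R
      (by exact_mod_cast hT1 : (1 : ℝ) ≤ T) hc hcS hb
    have hS := h𝒜.S_pos
    rw [← hLf, ← hC₂] at hN
    rw [← hC₃] at hbal
    have hL₀ : 1 ≤ Lf ^ (p + r + 1) := one_le_pow₀ hL1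
    generalize Lf ^ (p + r + 1) = L₀ at hN hbad hL₀
    generalize ∑ t ∈ Finset.Ico 𝒜.T₁ T, BlackBox.devCount 𝒜 H 0 (x t) = N at hN hcost hfol
    have hHT : (𝒜.T₁ : ℝ) ≤ H * 𝒜.T₁ := le_mul_of_one_le_left (by linarith) hH'
    have hF : 0 ≤ (d : ℝ) ^ (3 / 2 : ℝ) * (H : ℝ) ^ (5 / 2 : ℝ) * 𝒜.S *
        (√((T : ℝ) * 𝒜.T₁) + (T : ℝ) / √(𝒜.T₁ : ℝ)) := by positivity
    have hY : 0 ≤ (d : ℝ) ^ (3 / 2 : ℝ) * (H : ℝ) ^ (5 / 2 : ℝ) * 𝒜.S * (T : ℝ) ^ (3 / 4 : ℝ) := by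
      positivity
    set G := (H : ℝ) * 𝒜.T₁ + (d : ℝ) ^ (3 / 2 : ℝ) * (H : ℝ) ^ (5 / 2 : ℝ) * 𝒜.S *
        (√((T : ℝ) * 𝒜.T₁) + (T : ℝ) / √(𝒜.T₁ : ℝ)) with hGdef
    set Y := (d : ℝ) ^ (3 / 2 : ℝ) * (H : ℝ) ^ (5 / 2 : ℝ) * 𝒜.S * (T : ℝ) ^ (3 / 4 : ℝ)
    have hG0 : (H : ℝ) * 𝒜.T₁ ≤ G := by linarith
    have hGpos : 0 ≤ G := by linarith
    have hGL : G ≤ L₀ * G := le_mul_of_one_le_left hGpos hL₀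
    have hall : 2 * ((H : ℝ) * 𝒜.T₁) + N ≤ (C₂ + 2) * L₀ * G := by
      calc 2 * ((H : ℝ) * 𝒜.T₁) + N ≤ 2 * (L₀ * G) + C₂ * L₀ * G := by linarith
        _ = _ := by ring
    have hLG : 0 ≤ L₀ * G := hGpos.trans hGL
    refine hbad ⟨hcost.trans (hall.trans ?_), fun h1 h2 => ?_⟩
    · have h3 : 0 ≤ (C₂ + 2) * C₃ * (L₀ * G) := by positivity
      linarith
    · have h4 : (C₂ + 2) * L₀ * G ≤ (C₂ + 2) * (1 + C₃) * L₀ * Y := by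
        calc (C₂ + 2) * L₀ * G ≤ (C₂ + 2) * L₀ * (C₃ * Y) :=
              mul_le_mul_of_nonneg_left (hbal h1 h2) (by positivity)
          _ ≤ (C₂ + 2) * L₀ * ((1 + C₃) * Y) :=
              mul_le_mul_of_nonneg_left (mul_le_mul_of_nonneg_right (by linarith) hY)
                (by positivity)
          _ = _ := by ring
      exact ⟨hcost.trans (hall.trans h4), by linarith⟩
  · calc μ (B₁ ∪ B₂ ∪ (⋃ h, B₃ h) ∪ B₄) ≤ μ B₁ + μ B₂ + μ (⋃ h, B₃ h) + μ B₄ :=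
          (measure_union_le _ _).trans (add_le_add_left ((measure_union_le _ _).trans
            (add_le_add_left (measure_union_le _ _) _)) _)
      _ ≤ ENNReal.ofReal δ + ENNReal.ofReal δ + ENNReal.ofReal δ + 0 := by
          gcongr
          exact hm₄.le
      _ ≤ ENNReal.ofReal (4 * δ) := by
          rw [add_zero, ← ENNReal.ofReal_add hδ.le hδ.le, ← ENNReal.ofReal_add (by linarith) hδ.le]
          exact ENNReal.ofReal_le_ofReal (by linarith)
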